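/- Let $T$ be the triangular grid of the plane (equilateral triangles of side one, some grid lines horizontal), viewed as a $2$-dimensional simplicial complex whose vertices, $1$-simplices and $2$-simplices are the grid points, the unit segments (panes) and the unit triangles. A *generalized grid polygon* is a finite simply connected simplicial complex $X$ in which every simplex is a face of a $2$-simplex and which has dimension $2$, together with a simplicial map $f\colon X\to T$, such that (1) the geometric realization of $X$ is a wedge of disks along boundary points; (2) $f$ maps each simplex to a simplex of the same dimension; (3) each interior vertex lies in exactly six $2$-simplices; (4) each $1$-simplex not on the boundary lies in exactly two $2$-simplices, and their images under $f$ form a diamond (two distinct unit triangles sharing a pane). Here a $1$-simplex is on the boundary if it lies in exactly one $2$-simplex, and a vertex is on the boundary if it is an endpoint of a boundary $1$-simplex. The wedge of generalized grid polygons $(X,f)$ and $(Y,g)$ at boundary vertices $x\in X$ and $y\in Y$ is the wedge of the complexes $X$ and $Y$ at these base points with the map $h$ given by $h(z)=f(z)$ for $z\in X$ and $h(w)=g(w)-g(y)+f(x)$ for $w\in Y$. A generalized grid polygon is *indecomposable* if it is not the wedge of any two generalized grid polygons. Label a $1$-simplex $1$, $2$, $3$ (taken modulo $3$) if its image makes an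 angle of $0^\circ$, $60^\circ$, $120^\circ$, respectively, with the positive $x$-axis. From each boundary $1$-simplex emit a beam into the $2$-simplex containing it. A beam that enters a $2$-simplex through its side labeled $i$ leaves it through its side labeled $i-1$ if the image of the $2$-simplex points upwards, and through its side labeled $i+1$ if it points downwards; it continues into the adjacent $2$-simplex unless that side is on the boundary, where it ends. (Under $f$, the beam is a straight segment in one of the directions $60^\circ$, $180^\circ$, $300^\circ$.) The *billiards permutation* sends each boundary $1$-simplex to the one at which its beam ends. **Lemma.** Let $P$ be an indecomposable generalized grid polygon. If every cycle of the billiards permutation of $P$ has length $3$, then $P$ is either a unit triangle or a unit hexagon consisting of six unit triangles; that is, $f$ maps $P$ isomorphically onto a single unit triangle of $T$, or onto the subcomplex of $T$ formed by the six unit triangles around some grid point. -/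

import Mathlib

/-! ### The triangular grid

The grid points are written in the lattice basis `(1, 0)`, `(0, 1)`, which stand for the unit vectors
at angles `0°` and `60°` to the positive `x`-axis; hence `(-1, 1)` is the unit vector at `120°`. -/

/-- The vertices of the upward-pointing unit triangle with lower left corner `p`. -/
def upTri (p : ℤ × ℤ) : Finset (ℤ × ℤ) := {p, p + (1, 0), p + (0, 1)}

/-- The vertices of the downward-pointing unit triangle with upper left corner `p`. -/
def downTri (p : ℤ × ℤ) : Finset (ℤ × ℤ) := {p, p + (1, 0), p + (1, -1)}

/-- The triangular grid as a two-dimensional simplicial complex: the simplices are the nonempty sets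
of vertices of unit grid triangles (the grid points, the panes and the unit triangles). -/
def triGrid : PreAbstractSimplicialComplex (ℤ × ℤ) where
  faces := {s | s.Nonempty ∧ ∃ p, s ⊆ upTri p ∨ s ⊆ downTri p}
  isRelLowerSet_faces := by
    rintro s ⟨hs, p, hp⟩
    refine ⟨hs, fun t hts ht => ⟨ht, p, ?_⟩⟩
    exact hp.imp (fun h => hts.trans h) (fun h => hts.trans h)

/-- The unit vector of a pane with a given label. The labels `1, 2, 3` are taken modulo `3`, so that
`3` is written `0`: label `1` is the direction at `0°`, label `2` at `60°`, label `0 = 3` at `120°`. -/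
def paneDir : Fin 3 → ℤ × ℤ := ![(-1, 1), (1, 0), (0, 1)]

/-! ### Simplicial complexes -/

namespace PreAbstractSimplicialComplex

variable {V : Type*}

/-- The vertices of a complex. (The type `V` may contain further points, which are not vertices.) -/
def verts (K : PreAbstractSimplicialComplex V) : Set V := {v | {v} ∈ K.faces}

/-- The geometric realization, in barycentric coordinates. (For the finite complexes considered here
the topology induced by the product topology is the usual one.) -/
def realization (K : PreAbstractSimplicialComplex V) : Set (V → ℝ) :=
  {w | (∀ v, 0 ≤ w v) ∧ ∃ s ∈ K.faces, (∀ v, v ∉ s → w v = 0) ∧ ∑ v ∈ s, w v = 1}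

/-- The `2`-simplices that contain the simplex `s`. -/
def trianglesAt (K : PreAbstractSimplicialComplex V) (s : Finset V) : Set (Finset V) :=
  {t | t ∈ K.faces ∧ t.card = 3 ∧ s ⊆ t}

/-- A boundary `1`-simplex of a two-dimensional complex: it lies in exactly one `2`-simplex. -/
def IsBoundaryEdge (K : PreAbstractSimplicialComplex V) (e : Finset V) : Prop :=
  e ∈ K.faces ∧ e.card = 2 ∧ ∃! t, t ∈ K.trianglesAt e

/-- A boundary vertex: an endpoint of a boundary `1`-simplex. -/
def IsBoundaryVertex (K : PreAbstractSimplicialComplex V) (v : V) : Prop :=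
  ∃ e, K.IsBoundaryEdge e ∧ v ∈ e

/-- The complex `K` is the union of its subcomplexes `A` and `B`, which have exactly one vertex, `x`,
in common, and `x` is a boundary vertex of both of them. -/
structure IsBoundaryWedge (K A B : PreAbstractSimplicialComplex V) (x : V) : Prop where
  union : K = A ⊔ B
  inter : A.verts ∩ B.verts = {x}
  left : A.IsBoundaryVertex x
  right : B.IsBoundaryVertex x

/-- The geometric realization is a (finite, iterated) wedge of closed disks along boundary points. -/
inductive IsWedgeOfDisks : PreAbstractSimplicialComplex V → Prop
  | disk (K : PreAbstractSimplicialComplex V)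
      (h : Nonempty (K.realization ≃ₜ Metric.closedBall (0 : EuclideanSpace ℝ (Fin 2)) 1)) :
      IsWedgeOfDisks K
  | wedge (K A B : PreAbstractSimplicialComplex V) (x : V) (hA : IsWedgeOfDisks A)
      (hB : IsWedgeOfDisks B) (h : K.IsBoundaryWedge A B x) : IsWedgeOfDisks K

end PreAbstractSimplicialComplex

/-! ### Generalized grid polygons -/

/-- A generalized grid polygon: a finite simply connected homogeneous simplicial complex of dimension
`2` with vertices in `V`, together with a simplicial map `f` to the triangular grid (only the values
of `f` at the vertices of the complex matter). -/
structure GridPolygon (V : Type*) where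
  complex : PreAbstractSimplicialComplex V
  f : V → ℤ × ℤ
  finite : complex.faces.Finite
  simplyConnected : SimplyConnectedSpace complex.realization
  /-- homogeneous of dimension two: each simplex is a face of a `2`-simplex -/
  homogeneous : ∀ s ∈ complex.faces, ∃ t ∈ complex.faces, t.card = 3 ∧ s ⊆ t
  wedgeOfDisks : complex.IsWedgeOfDisks
  /-- each simplex is mapped to a simplex of the same dimension -/
  map_simplex : ∀ s ∈ complex.faces, s.image f ∈ triGrid.faces ∧ (s.image f).card = s.card
  /-- each interior vertex is contained in exactly six `2`-simplices -/
  six_triangles : ∀ v ∈ complex.verts, ¬ complex.IsBoundaryVertex v →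
    (complex.trianglesAt {v}).ncard = 6
  /-- each `1`-simplex not on the boundary is in exactly two `2`-simplices, whose images form a
  diamond, that is, two different unit triangles with a common pane -/
  diamond : ∀ e ∈ complex.faces, e.card = 2 → ¬ complex.IsBoundaryEdge e →
    ∃ t₁ t₂, t₁ ≠ t₂ ∧ complex.trianglesAt e = {t₁, t₂} ∧
      t₁.image f ≠ t₂.image f ∧ (t₁.image f ∩ t₂.image f).card = 2

namespace GridPolygon

variable {V : Type*}

/-- `P` is the wedge of `X` and `Y` at the boundary vertices `x` of `X` and `x` of `Y` (vertices are
named so that `X` and `Y` are subcomplexes of `P`); the map of `P` is that of `X` on `X` and the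
translate of that of `Y` which agrees with it at the base point on `Y`. -/
def IsWedge (P X Y : GridPolygon V) (x : V) : Prop :=
  P.complex.IsBoundaryWedge X.complex Y.complex x ∧
    (∀ z ∈ X.complex.verts, P.f z = X.f z) ∧
    (∀ w ∈ Y.complex.verts, P.f w = Y.f w - Y.f x + X.f x)

/-- `P` is not the wedge of any two generalized grid polygons. -/
def Indecomposable (P : GridPolygon V) : Prop := ¬ ∃ X Y : GridPolygon V, ∃ x, P.IsWedge X Y x

/-- The `1`-simplex `e` has label `i`: its image is a pane parallel to `paneDir i`. -/
def HasLabel (P : GridPolygon V) (e : Finset V) (i : Fin 3) : Prop :=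
  ∃ q, e.image P.f = {q, q + paneDir i}

/-- The image of the `2`-simplex `t` points upwards. -/
def IsUp (P : GridPolygon V) (t : Finset V) : Prop := ∃ p, t.image P.f = upTri p

/-- The image of the `2`-simplex `t` points downwards. -/
def IsDown (P : GridPolygon V) (t : Finset V) : Prop := ∃ p, t.image P.f = downTri p

/-- A beam that enters the `2`-simplex `t` through its side `e` leaves it through its side `e'`: if `e`
has label `i`, then `e'` has label `i - 1` in an upward and label `i + 1` in a downward triangle
(so the beam runs in the direction of `60°`, `180°` or `300°`). -/
def Crosses (P : GridPolygon V) (t e e' : Finset V) : Prop :=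
  e ⊆ t ∧ e.card = 2 ∧ e' ⊆ t ∧ e'.card = 2 ∧
    ∃ i, P.HasLabel e i ∧ (P.IsUp t ∧ P.HasLabel e' (i - 1) ∨ P.IsDown t ∧ P.HasLabel e' (i + 1))

/-- The beam emitted from the boundary `1`-simplex `b` passes through the `2`-simplex `t` and leaves it
through its side `e`; it goes on into the next `2`-simplex if `e` is not on the boundary. -/
inductive Beam (P : GridPolygon V) (b : Finset V) : Finset V → Finset V → Prop
  | emit (t e : Finset V) (ht : t ∈ P.complex.trianglesAt b) (h : P.Crosses t b e) : Beam P b t e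
  | cross (t e t' e' : Finset V) (h : Beam P b t e) (he : ¬ P.complex.IsBoundaryEdge e)
      (ht' : t' ∈ P.complex.trianglesAt e) (hne : t' ≠ t) (h' : P.Crosses t' e e') : Beam P b t' e'

/-- The beam emitted from the boundary `1`-simplex `b` ends at the boundary `1`-simplex `b'`. -/
def BeamHits (P : GridPolygon V) (b b' : Finset V) : Prop :=
  P.complex.IsBoundaryEdge b' ∧ ∃ t, P.Beam b t b'

/-- The boundary `1`-simplices. -/
abbrev BoundaryEdge (P : GridPolygon V) : Type _ := {e : Finset V // P.complex.IsBoundaryEdge e}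

/-! The beams define a permutation of the boundary `1`-simplices. -/

theorem image_tri (P : GridPolygon V) {t : Finset V} (ht : t ∈ P.complex.faces) (h3 : t.card = 3) :
    P.IsUp t ∨ P.IsDown t := by
  obtain ⟨⟨_, p, hp⟩, hc⟩ := P.map_simplex t ht
  have hu : ∀ q, (upTri q).card ≤ 3 := fun q => Finset.card_le_three
  have hd : ∀ q, (downTri q).card ≤ 3 := fun q => Finset.card_le_three
  rcases hp with hp | hp
  · exact Or.inl ⟨p, Finset.eq_of_subset_of_card_le hp (by rw [hc, h3]; exact hu p)⟩
  · exact Or.inr ⟨p, Finset.eq_of_subset_of_card_le hp (by rw [hc, h3]; exact hd p)⟩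

theorem not_up_down (P : GridPolygon V) {t : Finset V} (hu : P.IsUp t) (hd : P.IsDown t) : False := by
  obtain ⟨p, hp⟩ := hu
  obtain ⟨q, hq⟩ := hd
  have h : ∑ x ∈ upTri p, x.1 = ∑ x ∈ downTri q, x.1 := by rw [← hp, hq]
  have e1 : ∑ x ∈ upTri p, x.1 = 3 * p.1 + 1 := by
    unfold upTri
    rw [Finset.sum_insert, Finset.sum_insert, Finset.sum_singleton]
    · simp; ring
    · simp
    · simp [Prod.ext_iff]
  have e2 : ∑ x ∈ downTri q, x.1 = 3 * q.1 + 2 := by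
    unfold downTri
    rw [Finset.sum_insert, Finset.sum_insert, Finset.sum_singleton]
    · simp; ring
    · simp
    · simp [Prod.ext_iff]
  omega

/-- The three sides of a `2`-simplex have the three labels. -/
theorem exists_sides (P : GridPolygon V) {t : Finset V} (ht : t ∈ P.complex.faces)
    (h3 : t.card = 3) : ∃ s : Fin 3 → Finset V,
      (∀ i, s i ⊆ t ∧ (s i).card = 2 ∧ ∀ j, P.HasLabel (s i) j ↔ j = i) ∧
      ∀ e, e ⊆ t → e.card = 2 → ∃ i, e = s i := by
  classical
  have key : ∀ a b c : V, t = {a, b, c} → a ≠ b → a ≠ c → b ≠ c → ∀ s : Fin 3 → Finset V,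
      (s 0 = {b, c} ∧ s 1 = {a, b} ∧ s 2 = {a, c} ∨ s 0 = {a, c} ∧ s 1 = {a, b} ∧ s 2 = {b, c}) →
      (∀ i j, P.HasLabel (s i) j ↔ j = i) →
      (∀ i, s i ⊆ t ∧ (s i).card = 2 ∧ ∀ j, P.HasLabel (s i) j ↔ j = i) ∧
      ∀ e, e ⊆ t → e.card = 2 → ∃ i, e = s i := by
    intro a b c rfl hab hac hbc s hs hl
    refine ⟨fun i => ⟨?_, ?_, hl i⟩, ?_⟩
    · fin_cases i <;> rcases hs with ⟨h0, h1, h2⟩ | ⟨h0, h1, h2⟩ <;> simp [*]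
    · fin_cases i <;> rcases hs with ⟨h0, h1, h2⟩ | ⟨h0, h1, h2⟩ <;> simp [*]
    · intro e he h2
      have : e = {a, b} ∨ e = {a, c} ∨ e = {b, c} := by
        obtain ⟨x, y, hxy, rfl⟩ := Finset.card_eq_two.1 h2
        have hx := he (Finset.mem_insert_self x _)
        have hy := he (Finset.mem_insert_of_mem (Finset.mem_singleton_self y))
        simp only [Finset.mem_insert, Finset.mem_singleton] at hx hy
        rcases hx with rfl | rfl | rfl <;> rcases hy with rfl | rfl | rfl <;>
          simp_all [Finset.pair_comm]
      rcases hs with ⟨h0, h1, h2⟩ | ⟨h0, h1, h2⟩ <;> rcases this with h | h | h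
      exacts [⟨1, h.trans h1.symm⟩, ⟨2, h.trans h2.symm⟩, ⟨0, h.trans h0.symm⟩,
        ⟨1, h.trans h1.symm⟩, ⟨0, h.trans h0.symm⟩, ⟨2, h.trans h2.symm⟩]
  have lab : ∀ (x y : V) (i : Fin 3), P.f y = P.f x + paneDir i →
      ∀ j, P.HasLabel {x, y} j ↔ j = i := by
    intro x y i h j
    constructor
    · rintro ⟨q, hq⟩
      rw [Finset.image_insert, Finset.image_singleton, h] at hq
      have h1 : q ∈ ({P.f x, P.f x + paneDir i} : Finset (ℤ × ℤ)) := by rw [hq]; simp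
      have h2 : q + paneDir j ∈ ({P.f x, P.f x + paneDir i} : Finset (ℤ × ℤ)) := by rw [hq]; simp
      have h3 : P.f x ∈ ({q, q + paneDir j} : Finset (ℤ × ℤ)) := by rw [← hq]; simp
      revert h1 h2 h3
      generalize P.f x = u
      obtain ⟨u1, u2⟩ := u
      obtain ⟨q1, q2⟩ := q
      fin_cases i <;> fin_cases j <;> simp [paneDir] <;> omega
    · rintro rfl
      exact ⟨P.f x, by rw [Finset.image_insert, Finset.image_singleton, h]⟩
  have hinj : Set.InjOn P.f t := by
    rw [← Finset.card_image_iff]; exact (P.map_simplex t ht).2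
  have three : ∀ u v w : ℤ × ℤ, t.image P.f = {u, v, w} →
      ∃ a b c, t = {a, b, c} ∧ P.f a = u ∧ P.f b = v ∧ P.f c = w := by
    intro u v w h
    obtain ⟨a, ha, hau⟩ := Finset.mem_image.1 (show u ∈ t.image P.f by rw [h]; simp)
    obtain ⟨b, hb, hbv⟩ := Finset.mem_image.1 (show v ∈ t.image P.f by rw [h]; simp)
    obtain ⟨c, hc, hcw⟩ := Finset.mem_image.1 (show w ∈ t.image P.f by rw [h]; simp)
    refine ⟨a, b, c, ?_, hau, hbv, hcw⟩
    apply Finset.Subset.antisymm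
    · intro x hx
      have : P.f x ∈ ({u, v, w} : Finset (ℤ × ℤ)) := h ▸ Finset.mem_image_of_mem _ hx
      simp only [Finset.mem_insert, Finset.mem_singleton] at this ⊢
      rcases this with h' | h' | h'
      · exact Or.inl (hinj hx ha (h'.trans hau.symm))
      · exact Or.inr (Or.inl (hinj hx hb (h'.trans hbv.symm)))
      · exact Or.inr (Or.inr (hinj hx hc (h'.trans hcw.symm)))
    · intro x hx
      simp only [Finset.mem_insert, Finset.mem_singleton] at hx
      rcases hx with rfl | rfl | rfl <;> assumption
  rcases P.image_tri ht h3 with ⟨p, hp⟩ | ⟨p, hp⟩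
  · obtain ⟨a, b, c, habc, ha, hb, hc⟩ := three _ _ _ hp
    refine ⟨![{b, c}, {a, b}, {a, c}], key a b c habc ?_ ?_ ?_ _ (Or.inl ⟨rfl, rfl, rfl⟩) ?_⟩
    · rintro rfl; rw [ha] at hb; simp at hb
    · rintro rfl; rw [ha] at hc; simp at hc
    · rintro rfl; rw [hb] at hc; simp at hc
    · intro i
      fin_cases i
      · exact lab b c 0 (by rw [hb, hc]; ext <;> simp [paneDir])
      · exact lab a b 1 (by rw [ha, hb]; simp [paneDir])
      · exact lab a c 2 (by rw [ha, hc]; simp [paneDir])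
  · obtain ⟨a, b, c, habc, ha, hb, hc⟩ := three _ _ _ hp
    refine ⟨![{a, c}, {a, b}, {b, c}], key a b c habc ?_ ?_ ?_ _ (Or.inr ⟨rfl, rfl, rfl⟩) ?_⟩
    · rintro rfl; rw [ha] at hb; simp at hb
    · rintro rfl; rw [ha] at hc; simp at hc
    · rintro rfl; rw [hb] at hc; simp at hc
    · intro i
      fin_cases i
      · have h := lab c a 0 (by rw [hc, ha]; ext <;> simp [paneDir])
        rw [Finset.pair_comm] at h
        exact h
      · exact lab a b 1 (by rw [ha, hb]; simp [paneDir])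
      · have h := lab c b 2 (by rw [hc, hb]; ext <;> simp [paneDir])
        rw [Finset.pair_comm] at h
        exact h

theorem exists_crosses (P : GridPolygon V) {t e : Finset V} (ht : t ∈ P.complex.faces)
    (h3 : t.card = 3) (he : e ⊆ t) (h2 : e.card = 2) : ∃ e', P.Crosses t e e' := by
  obtain ⟨s, hs, hs'⟩ := P.exists_sides ht h3
  obtain ⟨i, rfl⟩ := hs' e he h2
  rcases P.image_tri ht h3 with h | h
  · exact ⟨s (i - 1), (hs i).1, (hs i).2.1, (hs _).1, (hs _).2.1, i, ((hs i).2.2 i).2 rfl,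
      Or.inl ⟨h, ((hs _).2.2 _).2 rfl⟩⟩
  · exact ⟨s (i + 1), (hs i).1, (hs i).2.1, (hs _).1, (hs _).2.1, i, ((hs i).2.2 i).2 rfl,
      Or.inr ⟨h, ((hs _).2.2 _).2 rfl⟩⟩

theorem crosses_iff (P : GridPolygon V) {t : Finset V} (ht : t ∈ P.complex.faces)
    (h3 : t.card = 3) {e₁ e₁' e₂ e₂' : Finset V} (h₁ : P.Crosses t e₁ e₁')
    (h₂ : P.Crosses t e₂ e₂') : e₁ = e₂ ↔ e₁' = e₂' := by
  obtain ⟨s, hs, hs'⟩ := P.exists_sides ht h3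
  obtain ⟨a1, b1, c1, d1, i, hi, hi'⟩ := h₁
  obtain ⟨a2, b2, c2, d2, j, hj, hj'⟩ := h₂
  obtain ⟨k1, rfl⟩ := hs' _ a1 b1
  obtain ⟨k2, rfl⟩ := hs' _ c1 d1
  obtain ⟨k3, rfl⟩ := hs' _ a2 b2
  obtain ⟨k4, rfl⟩ := hs' _ c2 d2
  have sinj : ∀ m n, s m = s n ↔ m = n := fun m n =>
    ⟨fun h => ((hs n).2.2 m).1 (h ▸ ((hs m).2.2 m).2 rfl), fun h => h ▸ rfl⟩
  rw [sinj, sinj]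
  simp only [(hs _).2.2] at hi hi' hj hj'
  rcases hi' with ⟨hu, rfl⟩ | ⟨hu, rfl⟩ <;> rcases hj' with ⟨hv, rfl⟩ | ⟨hv, rfl⟩
  · subst hi hj; exact sub_left_inj.symm
  · exact (P.not_up_down hu hv).elim
  · exact (P.not_up_down hv hu).elim
  · subst hi hj; exact (add_left_inj 1).symm

theorem Beam.mem {P : GridPolygon V} {b t e : Finset V} (h : P.Beam b t e) :
    t ∈ P.complex.trianglesAt e ∧ e.card = 2 := by
  cases h with
  | emit _ _ ht h => exact ⟨⟨ht.1, ht.2.1, h.2.2.1⟩, h.2.2.2.1⟩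
  | cross _ _ _ _ _ _ ht _ h => exact ⟨⟨ht.1, ht.2.1, h.2.2.1⟩, h.2.2.2.1⟩

theorem mem_faces_of_trianglesAt (P : GridPolygon V) {t e : Finset V}
    (ht : t ∈ P.complex.trianglesAt e) (h2 : e.card = 2) : e ∈ P.complex.faces :=
  (P.complex.isRelLowerSet_faces ht.1).2 ht.2.2 (Finset.card_pos.1 (by omega))

theorem other_unique (P : GridPolygon V) {e t t₁ t₂ : Finset V} (h2 : e.card = 2)
    (hb : ¬ P.complex.IsBoundaryEdge e) (ht : t ∈ P.complex.trianglesAt e)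
    (h₁ : t₁ ∈ P.complex.trianglesAt e) (h₂ : t₂ ∈ P.complex.trianglesAt e)
    (n₁ : t₁ ≠ t) (n₂ : t₂ ≠ t) : t₁ = t₂ := by
  obtain ⟨a, b, -, hab, -⟩ := P.diamond e (P.mem_faces_of_trianglesAt ht h2) h2 hb
  rw [hab] at ht h₁ h₂
  simp only [Set.mem_insert_iff, Set.mem_singleton_iff] at ht h₁ h₂
  rcases ht with rfl | rfl <;> rcases h₁ with rfl | rfl <;> rcases h₂ with rfl | rfl <;> simp_all

theorem exists_other (P : GridPolygon V) {e t : Finset V} (h2 : e.card = 2)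
    (hb : ¬ P.complex.IsBoundaryEdge e) (ht : t ∈ P.complex.trianglesAt e) :
    ∃ t', t' ∈ P.complex.trianglesAt e ∧ t' ≠ t := by
  obtain ⟨a, b, hne, hab, -⟩ := P.diamond e (P.mem_faces_of_trianglesAt ht h2) h2 hb
  rw [hab] at ht ⊢
  rcases ht with rfl | rfl
  · exact ⟨b, by simp, hne.symm⟩
  · exact ⟨a, by simp, hne⟩

/-- Beams can be traced back. -/
theorem Beam.source_unique {P : GridPolygon V} {b₁ t e : Finset V} (hb₁ : P.complex.IsBoundaryEdge b₁)
    (h₁ : P.Beam b₁ t e) : ∀ {b₂ : Finset V}, P.complex.IsBoundaryEdge b₂ → P.Beam b₂ t e →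
      b₁ = b₂ := by
  induction h₁ with
  | emit t e ht h =>
    intro b₂ hb₂ h₂
    cases h₂ with
    | emit _ _ ht' h' => exact (P.crosses_iff ht.1 ht.2.1 h h').2 rfl
    | cross t₀ e₀ _ _ hB he₀ ht' hne h' =>
      obtain rfl := (P.crosses_iff ht.1 ht.2.1 h h').2 rfl
      exact (he₀ hb₁).elim
  | cross t₀ e₀ t e hB he₀ ht hne h ih =>
    intro b₂ hb₂ h₂
    cases h₂ with
    | emit _ _ ht' h' =>
      obtain rfl := (P.crosses_iff ht.1 ht.2.1 h h').2 rfl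
      exact (he₀ hb₂).elim
    | cross t₁ e₁ _ _ hB' he₁ ht' hne' h' =>
      obtain rfl := (P.crosses_iff ht.1 ht.2.1 h h').2 rfl
      obtain rfl := P.other_unique hB.mem.2 he₀ ht hB.mem.1 hB'.mem.1 hne.symm hne'.symm
      exact ih hb₂ hB'

/-- Each beam ends at the boundary. -/
theorem exists_beamHits (P : GridPolygon V) {b : Finset V} (hb : P.complex.IsBoundaryEdge b) :
    ∃ b', P.BeamHits b b' := by
  by_contra hno
  have hnb : ∀ t e, P.Beam b t e → ¬ P.complex.IsBoundaryEdge e :=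
    fun t e h he => hno ⟨e, he, t, h⟩
  let S := {x : Finset V × Finset V // P.Beam b x.1 x.2}
  have hfin : Finite S := by
    have : ({x : Finset V × Finset V | P.Beam b x.1 x.2}).Finite := by
      refine (P.finite.prod P.finite).subset ?_
      rintro ⟨t, e⟩ h
      exact ⟨(Beam.mem h).1.1, P.mem_faces_of_trianglesAt (Beam.mem h).1 (Beam.mem h).2⟩
    exact this
  have hstep : ∀ x : S, ∃ y : S, y.1.1 ∈ P.complex.trianglesAt x.1.2 ∧ y.1.1 ≠ x.1.1 ∧
      P.Crosses y.1.1 x.1.2 y.1.2 := by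
    rintro ⟨⟨t, e⟩, h⟩
    obtain ⟨t', ht', hne⟩ := P.exists_other h.mem.2 (hnb _ _ h) h.mem.1
    obtain ⟨e', he'⟩ := P.exists_crosses ht'.1 ht'.2.1 ht'.2.2 h.mem.2
    exact ⟨⟨(t', e'), Beam.cross _ _ _ _ h (hnb _ _ h) ht' hne he'⟩, ht', hne, he'⟩
  choose g hg using hstep
  have ginj : Function.Injective g := by
    intro x y hxy
    have h1 := hg x
    have h2 := hg y
    rw [← hxy] at h2
    have h12 : x.1.2 = y.1.2 := (P.crosses_iff h1.1.1 h1.1.2.1 h1.2.2 h2.2.2).2 rfl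
    have h11 : x.1.1 = y.1.1 := by
      refine P.other_unique (Beam.mem x.2).2 (hnb _ _ x.2) h1.1 (Beam.mem x.2).1 ?_
        h1.2.1.symm h2.2.1.symm
      rw [h12]; exact (Beam.mem y.2).1
    exact Subtype.ext (Prod.ext h11 h12)
  obtain ⟨t, ht, -⟩ := hb.2.2
  obtain ⟨e, he⟩ := P.exists_crosses ht.1 ht.2.1 ht.2.2 hb.2.1
  obtain ⟨x, hx⟩ := (Finite.injective_iff_surjective.1 ginj) ⟨(t, e), Beam.emit t e ht he⟩
  have h := hg x
  rw [hx] at h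
  have hbe : x.1.2 = b := (P.crosses_iff ht.1 ht.2.1 h.2.2 he).2 rfl
  exact hnb _ _ x.2 (by rw [hbe]; exact hb)

/-- Two beams that end at the same boundary `1`-simplex come from the same one. -/
theorem BeamHits.source_unique {P : GridPolygon V} {b₁ b₂ b' : Finset V}
    (hb₁ : P.complex.IsBoundaryEdge b₁) (hb₂ : P.complex.IsBoundaryEdge b₂)
    (h₁ : P.BeamHits b₁ b') (h₂ : P.BeamHits b₂ b') : b₁ = b₂ := by
  obtain ⟨hb', t₁, h₁⟩ := h₁
  obtain ⟨-, t₂, h₂⟩ := h₂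
  obtain rfl := hb'.2.2.unique h₁.mem.1 h₂.mem.1
  exact h₁.source_unique hb₁ hb₂ h₂

theorem finite_boundaryEdge (P : GridPolygon V) : Finite P.BoundaryEdge :=
  P.finite.subset (fun _ h => h.1)

/-- The billiards map: it sends a boundary `1`-simplex to the one hit by the beam it emits. -/
noncomputable def billiardsMap (P : GridPolygon V) (b : P.BoundaryEdge) : P.BoundaryEdge :=
  ⟨(P.exists_beamHits b.2).choose, (P.exists_beamHits b.2).choose_spec.1⟩

theorem beamHits_billiardsMap (P : GridPolygon V) (b : P.BoundaryEdge) :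
    P.BeamHits b.1 (P.billiardsMap b).1 := (P.exists_beamHits b.2).choose_spec

theorem billiardsMap_bijective (P : GridPolygon V) : Function.Bijective P.billiardsMap := by
  have := P.finite_boundaryEdge
  refine Finite.injective_iff_bijective.1 fun x y h => Subtype.ext ?_
  refine BeamHits.source_unique x.2 y.2 (P.beamHits_billiardsMap x) ?_
  rw [h]
  exact P.beamHits_billiardsMap y

/-- The billiards permutation. -/
noncomputable def billiardsPerm (P : GridPolygon V) : Equiv.Perm P.BoundaryEdge :=
  Equiv.ofBijective P.billiardsMap P.billiardsMap_bijective

/-- The beam emitted from `b` hits no other boundary `1`-simplex than `billiardsPerm b`. -/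
theorem beamHits_iff (P : GridPolygon V) (b b' : P.BoundaryEdge) :
    P.BeamHits b.1 b'.1 ↔ P.billiardsPerm b = b' := by
  constructor
  · intro h
    obtain ⟨c, rfl⟩ := P.billiardsPerm.surjective b'
    have := BeamHits.source_unique b.2 c.2 h (P.beamHits_billiardsMap c)
    rw [Subtype.ext this]
  · rintro rfl
    exact P.beamHits_billiardsMap b

/-- Every cycle of the billiards permutation has length three. -/
def OnlyThreeCycles (P : GridPolygon V) : Prop :=
  ∀ b, Function.minimalPeriod P.billiardsPerm b = 3

/-- `P` is a unit triangle: `f` maps it isomorphically onto a unit triangle of the grid. -/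
def IsUnitTriangle (P : GridPolygon V) : Prop :=
  Set.InjOn P.f P.complex.verts ∧ ∃ t ∈ triGrid.faces, t.card = 3 ∧
    (P.complex.map P.f).faces = {s | s.Nonempty ∧ s ⊆ t}

/-- `P` is a unit hexagon consisting of six unit triangles: `f` maps it isomorphically onto the
subcomplex of the grid formed by the six unit triangles around a grid point. -/
def IsUnitHexagon (P : GridPolygon V) : Prop :=
  Set.InjOn P.f P.complex.verts ∧ ∃ q : ℤ × ℤ,
    (P.complex.map P.f).faces = {s | s.Nonempty ∧ ∃ t ∈ triGrid.faces, t.card = 3 ∧ q ∈ t ∧ s ⊆ t}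

end GridPolygon

/-! An indecomposable polygon is a disk, since the summands of a wedge decomposition of its complex
would again be generalized grid polygons (`Indecomposable.exists_disk`). Three facts about the disk
are kept in `TriSurface`: it is connected through sides (`connected`), its first cohomology vanishes
(`potential`), and the triangles around an interior vertex are told apart by sign and position
(`star_unique`).

A beam passes through the midpoints of the sides it crosses, so it is a chain of midsegments, and
every midsegment lies on some beam (`exists_source`). A reflection turns a beam by 120°, one way in
upward and the other way in downward triangles. Three reflections can close up only if all turn the
same way, so a 3-cycle of beams develops to an equilateral triangle in the plane, whose orientation
is the sign `s` (`isStrand_of_hits`).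

Such a closed strand has a winding number on the vertices: its crossing numbers with the sides form
a cocycle, and a potential of it is constant on the boundary, because the boundary is connected
(`boundary_connected`). The winding number takes only the values `0` and `s`, and it is nonzero only
at vertices over the interior of the developed triangle (`IsStrand.exists_winding`).

Take a corner of a strand `C`, that is, a triangle where `C` reflects. If `C` has size one, it stays
in a triangle all of whose sides are on the boundary, and the surface is this triangle. Otherwise
the inner vertex `v` of the corner is interior. The strand parallel to a side of `C`, one step
further in and next to `v`, cannot have the orientation of `C` (`Chord.sign_ne`). With the opposite
orientation it winds around `v`, so it must run through the third midsegment of the corner triangle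
(`IsStrand.corner_chord`). Hence a single strand `Q` visits all three triangles of sign `s` at `v`.
It then meets each triangle of sign `-s` at `v` in two midsegments, which is possible only if the
side opposite to `v` is on the boundary (`IsStrand.corner_hexagon`). These triangles are corners of
`Q`, so the argument applies to `Q` in place of `C` and shows that the other three sides opposite to
`v` are on the boundary too. By connectedness the surface is the hexagon around `v`. -/

/-! ### Triangulated surfaces over the triangular grid -/

/-- A connected surface made of unit triangles over the triangular grid, in index form. The vertex
`vert t j` is opposite to the side `j` of the triangle `t`; the coordinates `x v` of a vertex add up
to zero; `sgn t` is `1` for upward and `-1` for downward triangles; `nb t j` is the triangle on the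
other side of the side `j` of `t`, and `t` itself if this side is on the boundary. -/
structure TriSurface (T V : Type*) where
  sgn : T → ℤ
  sgn_eq : ∀ t, sgn t = 1 ∨ sgn t = -1
  vert : T → Fin 3 → V
  x : V → Fin 3 → ℤ
  base : T → Fin 3 → ℤ
  x_vert : ∀ t i j, x (vert t j) i = base t i - if i = j then sgn t else 0
  x_sum : ∀ t j, x (vert t j) 0 + x (vert t j) 1 + x (vert t j) 2 = 0
  nb : T → Fin 3 → T
  nb_nb : ∀ t j, nb (nb t j) j = t
  sgn_nb : ∀ t j, nb t j ≠ t → sgn (nb t j) = -sgn t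
  vert_nb : ∀ t j i k, nb t j ≠ t → i ≠ j → k ≠ j → i ≠ k → vert (nb t j) i = vert t k
  star_unique : ∀ t t' i, (∀ s j k, nb s j = s → k ≠ j → vert s k ≠ vert t i) →
    vert t' i = vert t i → sgn t' = sgn t → t' = t
  connected : ∀ S : Set T, S.Nonempty → (∀ t ∈ S, ∀ j, nb t j ∈ S) → S = Set.univ
  potential : ∀ h : T → Fin 3 → ℤ, (∀ t j, h (nb t j) j = h t j) →
    (∀ t, h t 0 + h t 1 + h t 2 = 0) →
    ∃ g : V → ℤ, ∀ t j, g (vert t (j + 2)) - g (vert t (j + 1)) = sgn t * h t j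

theorem Fin.exists_third (i j : Fin 3) : ∃ k, k ≠ i ∧ k ≠ j := by
  revert i j; decide

theorem Fin.add_one_ne_self₃ (j : Fin 3) : j + 1 ≠ j := by revert j; decide

theorem Fin.add_two_ne_self₃ (j : Fin 3) : j + 2 ≠ j := by revert j; decide

theorem Fin.add_one_ne_add_two₃ (j : Fin 3) : j + 1 ≠ j + 2 := by revert j; decide

theorem Fin.eq_third {i j k l : Fin 3} (hij : i ≠ j) (hik : i ≠ k) (hjk : j ≠ k) :
    l = i ∨ l = j ∨ l = k := by
  revert i j k l; decide

theorem Fin.sum_third {i j k : Fin 3} (hij : i ≠ j) (hik : i ≠ k) (hjk : j ≠ k) (f : Fin 3 → ℤ) :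
    f 0 + f 1 + f 2 = f i + f j + f k := by
  fin_cases i <;> fin_cases j <;> fin_cases k <;> simp_all <;> ring

/-- Rotation around an interior vertex: it occurs in every position in both kinds of triangles. -/
theorem exists_rotation {T V : Type*} {sgn : T → ℤ} {vert : T → Fin 3 → V} {nb : T → Fin 3 → T}
    (sgn_eq : ∀ t, sgn t = 1 ∨ sgn t = -1) (sgn_nb : ∀ t j, nb t j ≠ t → sgn (nb t j) = -sgn t)
    (vert_nb : ∀ t j i k, nb t j ≠ t → i ≠ j → k ≠ j → i ≠ k → vert (nb t j) i = vert t k)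
    {v : V} (hv : ∀ s j k, k ≠ j → vert s k = v → nb s j ≠ s) {t : T} {i : Fin 3}
    (ht : vert t i = v) {e : ℤ} (he : e = 1 ∨ e = -1) (j : Fin 3) :
    ∃ s, sgn s = e ∧ vert s j = v := by
  -- Crossing the third side moves `v` from position `a` to position `b` and flips the sign; two
  -- crossings reach any position with the original sign.
  have step : ∀ (s : T) (a b : Fin 3), vert s a = v → a ≠ b →
      ∃ s', sgn s' = - sgn s ∧ vert s' b = v := by
    intro s a b hs hab
    obtain ⟨c, hca, hcb⟩ := Fin.exists_third a b
    have hne : nb s c ≠ s := hv s c a hca.symm hs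
    exact ⟨nb s c, sgn_nb s c hne, by rw [vert_nb s c b a hne hcb.symm hca.symm hab.symm, hs]⟩
  have two : ∀ (b : Fin 3), ∃ s', sgn s' = sgn t ∧ vert s' b = v := by
    intro b
    by_cases hb : i = b
    · subst hb; exact ⟨t, rfl, ht⟩
    · obtain ⟨c, hca, hcb⟩ := Fin.exists_third i b
      obtain ⟨s1, h1, h2⟩ := step t i c ht hca.symm
      obtain ⟨s2, h3, h4⟩ := step s1 c b h2 hcb
      exact ⟨s2, by rw [h3, h1, neg_neg], h4⟩
  by_cases h : sgn t = e
  · rw [← h]; exact two j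
  · obtain ⟨c, hc, -⟩ := Fin.exists_third j j
    obtain ⟨s1, h1, h2⟩ := two c
    obtain ⟨s2, h3, h4⟩ := step s1 c j h2 hc
    refine ⟨s2, ?_, h4⟩
    rw [h3, h1]
    rcases sgn_eq t with h' | h' <;> omega

namespace TriSurface

variable {T V : Type*} (S : TriSurface T V)

/-- A boundary vertex. -/
def Bd (v : V) : Prop := ∃ t j k, S.nb t j = t ∧ k ≠ j ∧ S.vert t k = v

variable {S}

theorem x_self (t : T) (i : Fin 3) : S.x (S.vert t i) i = S.base t i - S.sgn t := by
  simp [S.x_vert]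

theorem x_ne (t : T) {i j : Fin 3} (h : i ≠ j) : S.x (S.vert t j) i = S.base t i := by
  simp [S.x_vert, h]

theorem base_sum (t : T) : S.base t 0 + S.base t 1 + S.base t 2 = S.sgn t := by
  have := S.x_sum t 0
  simp only [S.x_vert] at this
  simp at this
  linarith

theorem base_nb_self {t : T} {j : Fin 3} (h : S.nb t j ≠ t) : S.base (S.nb t j) j = S.base t j := by
  obtain ⟨k, hk, -⟩ := Fin.exists_third j j
  obtain ⟨l, hl, hl'⟩ := Fin.exists_third j k
  have := S.vert_nb t j k l h hk hl hl'.symm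
  have h1 := x_ne (S := S) (S.nb t j) hk.symm
  rw [this, x_ne t hl.symm] at h1
  exact h1.symm

theorem base_nb_ne {t : T} {j l : Fin 3} (h : S.nb t j ≠ t) (hl : l ≠ j) :
    S.base (S.nb t j) l = S.base t l - S.sgn t := by
  obtain ⟨k, hk, hk'⟩ := Fin.exists_third j l
  have := S.vert_nb t j l k h hl hk hk'.symm
  have h1 := x_self (S := S) (S.nb t j) l
  rw [this, x_ne t hk'.symm, S.sgn_nb t j h] at h1
  linarith

theorem star_eq {t t' : T} {i : Fin 3} (hi : ¬ S.Bd (S.vert t i)) (hv : S.vert t' i = S.vert t i)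
    (hs : S.sgn t' = S.sgn t) : t' = t :=
  S.star_unique t t' i (fun s j k h1 h2 h3 => hi ⟨s, j, k, h1, h2, h3⟩) hv hs

theorem nb_ne_of_not_bd {t : T} {i j : Fin 3} (hi : ¬ S.Bd (S.vert t i)) (hij : i ≠ j) :
    S.nb t j ≠ t := fun h => hi ⟨t, j, i, h, hij, rfl⟩

/-! ### Connectedness of the boundary -/

/-- Think of `h` as crossing numbers with a path of triangles that enters through the boundary side
`j₀` of `t₀` and stops inside `t₁`: every triangle is left as often as it is entered, except the
last one. Only parities matter later. The path is lengthened one triangle at a time. -/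
theorem exists_path_cochain (t₀ : T) (j₀ : Fin 3) (h₀ : S.nb t₀ j₀ = t₀) (t₁ : T) :
    ∃ h : T → Fin 3 → ℤ, (∀ t j, h (S.nb t j) j = h t j) ∧
      (∀ t, t ≠ t₁ → h t 0 + h t 1 + h t 2 = 0) ∧ Odd (h t₁ 0 + h t₁ 1 + h t₁ 2) ∧
      Odd (h t₀ j₀) ∧ ∀ t j, S.nb t j = t → (t, j) ≠ (t₀, j₀) → h t j = 0 := by
  classical
  let A : Set T := {t₁ | ∃ h : T → Fin 3 → ℤ, (∀ t j, h (S.nb t j) j = h t j) ∧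
      (∀ t, t ≠ t₁ → h t 0 + h t 1 + h t 2 = 0) ∧ Odd (h t₁ 0 + h t₁ 1 + h t₁ 2) ∧
      Odd (h t₀ j₀) ∧ ∀ t j, S.nb t j = t → (t, j) ≠ (t₀, j₀) → h t j = 0}
  suffices A = Set.univ from (this ▸ Set.mem_univ t₁ : t₁ ∈ A)
  refine S.connected A ⟨t₀, fun t j => if t = t₀ ∧ j = j₀ then 1 else 0, ?_, ?_, ?_, ?_, ?_⟩ ?_
  · intro t j
    by_cases hj : j = j₀
    · subst hj
      by_cases ht : t = t₀
      · subst ht; simp [h₀]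
      · have : S.nb t j ≠ t₀ := by
          intro h; apply ht; rw [← S.nb_nb t j, h, h₀]
        simp [ht, this]
    · simp [hj]
  · intro t ht; simp [ht]
  · simp only [true_and]; fin_cases j₀ <;> simp
  · simp
  · intro t j _ h; simp only [ne_eq, Prod.mk.injEq] at h; simp [h]
  · rintro t ⟨h, hc, hz, ho, hb, hbd⟩ j
    by_cases hj : S.nb t j = t
    · rw [hj]; exact ⟨h, hc, hz, ho, hb, hbd⟩
    -- Subtracting the defect `s` on the common side closes the cochain on `t` and leaves the defect
    -- `-s` on the neighbor.
    · set s := h t 0 + h t 1 + h t 2 with hs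
      have hj' : t ≠ S.nb t j := fun h => hj h.symm
      refine ⟨fun r l => h r l - if l = j ∧ (r = t ∨ r = S.nb t j) then s else 0,
        ?_, ?_, ?_, ?_, ?_⟩
      · intro r l
        simp only [hc]
        congr 1
        by_cases hl : l = j
        · subst hl
          have e1 : S.nb r l = t ↔ r = S.nb t l :=
            ⟨fun h => by rw [← h, S.nb_nb], fun h => by rw [h, S.nb_nb]⟩
          have e2 : S.nb r l = S.nb t l ↔ r = t :=
            ⟨fun h => by rw [← S.nb_nb r l, h, S.nb_nb], fun h => by rw [h]⟩
          simp only [e1, e2, or_comm]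
        · simp [hl]
      · intro r hr
        by_cases hrt : r = t
        · subst hrt
          fin_cases j <;> simp <;> omega
        · have := hz r hrt
          simp [hrt, hr, this]
      · have := hz _ hj
        have e : ∀ a b c : ℤ, a + b + c = 0 → ∀ i : Fin 3, (a - if 0 = i then s else 0) +
          (b - if 1 = i then s else 0) + (c - if 2 = i then s else 0) = - s := by
          intro a b c h i; fin_cases i <;> simp <;> omega
        simp only [or_true, and_true]
        rw [e _ _ _ this]
        exact ho.neg
      · have : ¬ (j₀ = j ∧ (t₀ = t ∨ t₀ = S.nb t j)) := by
          rintro ⟨rfl, rfl | h⟩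
          · exact hj h₀
          · rw [h, S.nb_nb] at h₀; exact hj h₀.symm
        simpa [this] using hb
      · intro r l hr hrl
        have : ¬ (l = j ∧ (r = t ∨ r = S.nb t j)) := by
          rintro ⟨rfl, rfl | h⟩
          · exact hj hr
          · rw [h, S.nb_nb] at hr; exact hj hr.symm
        simpa [this] using hbd r l hr hrl

/-- A function of the vertices that is constant on each boundary side is constant on the
boundary. -/
theorem boundary_connected [Finite T] (n : V → ℤ)
    (hn : ∀ t j, S.nb t j = t → n (S.vert t (j + 1)) = n (S.vert t (j + 2)))
    {t₀ t₁ : T} {j₀ j₁ : Fin 3} (h₀ : S.nb t₀ j₀ = t₀) (h₁ : S.nb t₁ j₁ = t₁) :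
    n (S.vert t₁ (j₁ + 1)) = n (S.vert t₀ (j₀ + 1)) := by
  classical
  by_contra hne
  have hpne : (t₁, j₁) ≠ (t₀, j₀) := by
    intro h; rw [Prod.mk.injEq] at h; exact hne (by rw [h.1, h.2])
  obtain ⟨h, hc, hz, ho, hb, hbd⟩ := S.exists_path_cochain t₀ j₀ h₀ t₁
  set s := h t₁ 0 + h t₁ 1 + h t₁ 2 with hs
  -- Letting the path leave through the boundary side `j₁` removes the defect at its end.
  obtain ⟨g, hg⟩ := S.potential (fun r l => h r l - if l = j₁ ∧ r = t₁ then s else 0) (by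
    intro r l
    simp only [hc]
    congr 1
    by_cases hl : l = j₁
    · subst hl
      have e1 : S.nb r l = t₁ ↔ r = t₁ :=
        ⟨fun h => by rw [← S.nb_nb r l, h, h₁], fun h => by rw [h, h₁]⟩
      simp only [e1]
    · simp [hl]) (by
    intro r
    by_cases hr : r = t₁
    · subst hr; fin_cases j₁ <;> simp <;> omega
    · simp [hr, hz r hr])
  have := Fintype.ofFinite T
  -- The potential modulo 2, cut off to one level set of `n`. The endpoint sums `ψ` add up to zero
  -- over all sides and cancel in pairs on interior sides, so their sum over boundary sides is zero.
  -- But within this level set the path meets the boundary at the side `j₀` only, an odd number of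
  -- times, which makes that sum one.
  let φ : V → ZMod 2 := fun v => if n v = n (S.vert t₀ (j₀ + 1)) then (g v : ZMod 2) else 0
  let ψ : T × Fin 3 → ZMod 2 := fun p => φ (S.vert p.1 (p.2 + 1)) + φ (S.vert p.1 (p.2 + 2))
  have z2 : ∀ a : ZMod 2, a + a = 0 := by decide
  have tot : ∑ p, ψ p = 0 := by
    rw [Fintype.sum_prod_type]
    refine Finset.sum_eq_zero fun t _ => ?_
    rw [Fin.sum_univ_three]
    change (φ (S.vert t 1) + φ (S.vert t 2)) + (φ (S.vert t 2) + φ (S.vert t 0)) +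
      (φ (S.vert t 0) + φ (S.vert t 1)) = 0
    linear_combination z2 (φ (S.vert t 0)) + z2 (φ (S.vert t 1)) + z2 (φ (S.vert t 2))
  have inner : ∑ p with S.nb p.1 p.2 ≠ p.1, ψ p = 0 := by
    refine Finset.sum_involution (fun p _ => (S.nb p.1 p.2, p.2)) ?_ ?_ ?_ ?_
    · rintro ⟨t, j⟩ hp
      simp only [Finset.mem_filter, Finset.mem_univ, true_and] at hp
      have e1 := S.vert_nb t j (j + 1) (j + 2) hp (Fin.add_one_ne_self₃ j)
        (Fin.add_two_ne_self₃ j) (Fin.add_one_ne_add_two₃ j)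
      have e2 := S.vert_nb t j (j + 2) (j + 1) hp (Fin.add_two_ne_self₃ j)
        (Fin.add_one_ne_self₃ j) (Fin.add_one_ne_add_two₃ j).symm
      simp only [ψ, e1, e2]
      linear_combination z2 (φ (S.vert t (j + 1))) + z2 (φ (S.vert t (j + 2)))
    · rintro ⟨t, j⟩ hp _ h
      simp only [Finset.mem_filter, Finset.mem_univ, true_and] at hp
      exact hp (Prod.ext_iff.1 h).1
    · rintro ⟨t, j⟩ hp
      simp only [Finset.mem_filter, Finset.mem_univ, true_and, S.nb_nb] at hp ⊢
      exact hp.symm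
    · rintro ⟨t, j⟩ hp
      simp [S.nb_nb]
  have bdry : ∑ p with S.nb p.1 p.2 = p.1, ψ p = 1 := by
    rw [Finset.sum_eq_single (t₀, j₀)]
    · have hg0 := hg t₀ j₀
      have e : ¬ (j₀ = j₁ ∧ t₀ = t₁) := fun h => hpne (by rw [h.1, h.2])
      simp only [e, if_false, sub_zero] at hg0
      have hodd : Odd (g (S.vert t₀ (j₀ + 2)) - g (S.vert t₀ (j₀ + 1))) := by
        rw [hg0]; rcases S.sgn_eq t₀ with h | h <;> rw [h] <;> simp [hb]
      obtain ⟨m, hm⟩ := hodd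
      have : g (S.vert t₀ (j₀ + 2)) = 2 * m + 1 + g (S.vert t₀ (j₀ + 1)) := by omega
      simp only [ψ, φ, ← hn t₀ j₀ h₀, if_true, this]
      push_cast
      linear_combination z2 (g (S.vert t₀ (j₀ + 1)) : ZMod 2) + z2 (m : ZMod 2)
    · rintro ⟨t, j⟩ hp hne'
      simp only [Finset.mem_filter, Finset.mem_univ, true_and] at hp
      by_cases hp1 : (t, j) = (t₁, j₁)
      · rw [Prod.mk.injEq] at hp1
        obtain ⟨rfl, rfl⟩ := hp1
        simp [ψ, φ, ← hn _ _ h₁, hne]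
      · have hg0 := hg t j
        have e : ¬ (j = j₁ ∧ t = t₁) := fun h => hp1 (by rw [h.1, h.2])
        simp only [e, if_false, sub_zero, hbd t j hp hne', mul_zero] at hg0
        have : g (S.vert t (j + 2)) = g (S.vert t (j + 1)) := by omega
        simp only [ψ, φ, ← hn t j hp, this]
        exact z2 _
    · intro h
      simp [h₀] at h
  have := Finset.sum_filter_add_sum_filter_not Finset.univ (fun p : T × Fin 3 => S.nb p.1 p.2 = p.1) ψ
  rw [tot, bdry, inner] at this
  exact absurd this (by decide)

end TriSurface

/-! ### Closed strands and their winding numbers -/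

namespace TriSurface

variable {T V : Type*} {S : TriSurface T V}

/-- Around an interior vertex there are triangles of either sign in every position. -/
theorem exists_star {t : T} {i : Fin 3} (hi : ¬ S.Bd (S.vert t i)) {e : ℤ} (he : e = 1 ∨ e = -1)
    (j : Fin 3) : ∃ s, S.sgn s = e ∧ S.vert s j = S.vert t i :=
  exists_rotation S.sgn_eq S.sgn_nb S.vert_nb (fun _ _ _ hk hs => nb_ne_of_not_bd (hs ▸ hi) hk)
    (rfl : S.vert t i = _) he j

/-- A closed strand that bounds an equilateral triangle. A midsegment of the triangle `t` parallel to
the side `i` is denoted `(t, i)`; it joins the midpoints of the other two sides. The set `C` of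
midsegments is closed under continuation into adjacent triangles and reflection at the boundary. All
its midsegments of direction `i` lie on the line where twice the coordinate `i` is `a i`, and they meet
the other two lines only at boundary sides. The sign `s` tells which way the triangle points. -/
structure IsStrand (S : TriSurface T V) (C : Set (T × Fin 3)) (a : Fin 3 → ℤ) (s : ℤ) : Prop where
  sign : s = 1 ∨ s = -1
  size : 0 < -s * (a 0 + a 1 + a 2)
  odd : ∀ i, a i % 2 = 1
  cont : ∀ {t i j}, (t, i) ∈ C → i ≠ j → (S.nb t j, i) ∈ C
  refl : ∀ {t i j k}, (t, i) ∈ C → S.nb t j = t → i ≠ j → k ≠ j → (t, k) ∈ C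
  line : ∀ {t i}, (t, i) ∈ C → 2 * S.base t i - S.sgn t = a i
  pos : ∀ {t i j k}, (t, i) ∈ C → S.nb t j ≠ t → i ≠ j → i ≠ k → j ≠ k →
    0 < s * (2 * S.base t j - a j) ∧ 0 < s * (2 * S.base t k - S.sgn t - a k)

/-- The winding number of a strand. -/
structure IsWinding (S : TriSurface T V) (C : Set (T × Fin 3)) (a : Fin 3 → ℤ) (s : ℤ) (n : V → ℤ) :
    Prop where
  bd : ∀ {v}, S.Bd v → n v = 0
  val : ∀ {t i}, n (S.vert t i) ≠ 0 → n (S.vert t i) = s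
  inside : ∀ {t i}, n (S.vert t i) ≠ 0 → ∀ l, 0 < s * (2 * S.x (S.vert t i) l - a l)
  eq_of_iff : ∀ {t i j k}, i ≠ j → i ≠ k → j ≠ k → ((t, i) ∈ C ↔ (t, k) ∈ C) →
    n (S.vert t i) = n (S.vert t k)
  ne_of_cross : ∀ {t i j k}, i ≠ j → i ≠ k → j ≠ k → (t, i) ∈ C → (t, k) ∉ C →
    n (S.vert t i) ≠ n (S.vert t k)

theorem IsStrand.cont_iff {C : Set (T × Fin 3)} {a : Fin 3 → ℤ} {s : ℤ} (h : S.IsStrand C a s)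
    {t : T} {i j : Fin 3} (hij : i ≠ j) : (S.nb t j, i) ∈ C ↔ (t, i) ∈ C :=
  ⟨fun h' => by simpa [S.nb_nb] using h.cont h' hij, fun h' => h.cont h' hij⟩

/-- The winding number is a potential of the signed crossing numbers of the strand with the sides.
By `refl` both or none of the midsegments ending on a boundary side belong to `C`, with opposite
contributions, so the potential is constant along the boundary and can be normalized to zero there.
-/
theorem IsStrand.exists_winding [Finite T] {C : Set (T × Fin 3)} {a : Fin 3 → ℤ} {s : ℤ}
    (h : S.IsStrand C a s) {t₀ : T} {j₀ : Fin 3} (h₀ : S.nb t₀ j₀ = t₀) :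
    ∃ n, S.IsWinding C a s n := by
  classical
  let ind : T → Fin 3 → ℤ := fun t i => if (t, i) ∈ C then 1 else 0
  -- The midsegments meeting the side `j` are `j + 1` and `j + 2`; each cuts off one endpoint of
  -- that side, whence the opposite signs.
  obtain ⟨g, hg⟩ := S.potential (fun t j => ind t (j + 1) - ind t (j + 2)) (by
    intro t j
    simp only [ind, h.cont_iff (Fin.add_one_ne_self₃ j), h.cont_iff (Fin.add_two_ne_self₃ j)]) (by
    intro t
    change ind t 1 - ind t 2 + (ind t 2 - ind t 0) + (ind t 0 - ind t 1) = 0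
    ring)
  have hor : ∀ {i j k : Fin 3}, i ≠ j → i ≠ k → j ≠ k →
      i = j + 1 ∧ k = j + 2 ∨ i = j + 2 ∧ k = j + 1 := by decide
  have hbd : ∀ t j, S.nb t j = t → g (S.vert t (j + 1)) = g (S.vert t (j + 2)) := by
    intro t j hj
    have := hg t j
    have e : (t, j + 1) ∈ C ↔ (t, j + 2) ∈ C :=
      ⟨fun h' => h.refl h' hj (Fin.add_one_ne_self₃ j) (Fin.add_two_ne_self₃ j),
       fun h' => h.refl h' hj (Fin.add_two_ne_self₃ j) (Fin.add_one_ne_self₃ j)⟩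
    simp only [ind, e, sub_self, mul_zero] at this
    omega
  set n : V → ℤ := fun v => g v - g (S.vert t₀ (j₀ + 1)) with hn
  have bd : ∀ {v}, S.Bd v → n v = 0 := by
    rintro v ⟨t, j, k, hj, hk, rfl⟩
    have h1 := S.boundary_connected g hbd h₀ hj
    have h2 := hbd t j hj
    have : k = j + 1 ∨ k = j + 2 := (by decide : ∀ k j : Fin 3, k ≠ j → k = j + 1 ∨ k = j + 2) k j hk
    rcases this with rfl | rfl <;> simp only [hn] <;> omega
  have eq_of_iff : ∀ {t i j k}, i ≠ j → i ≠ k → j ≠ k → ((t, i) ∈ C ↔ (t, k) ∈ C) →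
      n (S.vert t i) = n (S.vert t k) := by
    intro t i j k hij hik hjk hC
    have := hg t j
    rcases hor hij hik hjk with ⟨rfl, rfl⟩ | ⟨rfl, rfl⟩ <;>
      simp only [ind, hC, sub_self, mul_zero] at this <;> simp only [hn] <;> omega
  have ne_of_cross : ∀ {t i j k}, i ≠ j → i ≠ k → j ≠ k → (t, i) ∈ C → (t, k) ∉ C →
      n (S.vert t i) ≠ n (S.vert t k) := by
    intro t i j k hij hik hjk hC hC'
    have := hg t j
    rcases S.sgn_eq t with hs | hs <;> rcases hor hij hik hjk with ⟨rfl, rfl⟩ | ⟨rfl, rfl⟩ <;>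
      simp only [ind, hC, hC', if_true, if_false, hs] at this <;> simp only [hn] <;> omega
  have inside : ∀ {t i}, n (S.vert t i) ≠ 0 → ∀ l, 0 < s * (2 * S.x (S.vert t i) l - a l) := by
    intro t i hni l
    have hnz : s * (2 * S.x (S.vert t i) l - a l) ≠ 0 := by
      have := h.odd l
      rcases h.sign with rfl | rfl <;> omega
    by_contra hneg
    have hneg : s * (2 * S.x (S.vert t i) l - a l) < 0 := by omega
    -- Choose an offending vertex farthest beyond the line `l`. It is interior, so it lies in a
    -- triangle of sign `s` whose vertex `l` is still farther out. The winding number changes on the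
    -- way there, so the strand would cross this side outside its own developed triangle.
    let A : Set (T × Fin 3) := {p | n (S.vert p.1 p.2) ≠ 0 ∧
      s * (2 * S.x (S.vert p.1 p.2) l - a l) < 0}
    obtain ⟨⟨t, i⟩, ⟨hni, hneg⟩, hmin⟩ := Set.exists_min_image A
      (fun p => s * (2 * S.x (S.vert p.1 p.2) l - a l)) A.toFinite ⟨(t, i), hni, hneg⟩
    simp only at hni hneg hmin
    have hint : ¬ S.Bd (S.vert t i) := fun hb => hni (bd hb)
    obtain ⟨m, hm, -⟩ := Fin.exists_third l l
    obtain ⟨r, hr, hrv⟩ := exists_star hint h.sign m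
    obtain ⟨j, hjl, hjm⟩ := Fin.exists_third l m
    rw [← hrv, x_ne r hm.symm] at hneg hmin
    rw [← hrv] at hni
    have hne : ¬ (((r, m) ∈ C ↔ (r, l) ∈ C)) := by
      intro hiff
      have e := eq_of_iff hjm.symm hm hjl hiff
      have h1 : s * (2 * S.x (S.vert r l) l - a l) < 0 := by
        rw [x_self]
        rcases h.sign with rfl | rfl <;> omega
      have := hmin (r, l) ⟨e ▸ hni, h1⟩
      simp only [x_self] at this
      rcases h.sign with rfl | rfl <;> omega
    by_cases hl : (r, l) ∈ C
    · have := h.line hl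
      rcases h.sign with rfl | rfl <;> omega
    · have hm' : (r, m) ∈ C := by tauto
      have hnb : S.nb r j ≠ r := fun hb => hl (h.refl hm' hb hjm.symm hjl.symm)
      have := (h.pos hm' hnb hjm.symm hm hjl).2
      rcases h.sign with rfl | rfl <;> omega
  refine ⟨n, @bd, ?_, @inside, @eq_of_iff, @ne_of_cross⟩
  -- Induction on the distance from the line `0`: the adjacent vertex one unit nearer to this line
  -- has the same winding number, unless the strand passes between them along the line `0`; there
  -- the value jumps from `0` to `s`.
  suffices ∀ N : ℕ, ∀ t i, n (S.vert t i) ≠ 0 → s * (2 * S.x (S.vert t i) 0 - a 0) ≤ N →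
      n (S.vert t i) = s by
    intro t i hni
    exact this (s * (2 * S.x (S.vert t i) 0 - a 0)).toNat t i hni (Int.self_le_toNat _)
  intro N
  induction N with
  | zero =>
    intro t i hni hle
    have := inside hni 0
    push_cast at hle
    omega
  | succ N ih =>
    intro t i hni hle
    have hint : ¬ S.Bd (S.vert t i) := fun hb => hni (bd hb)
    obtain ⟨r, hr, hrv⟩ := exists_star hint h.sign 1
    rw [← hrv] at hni hle ⊢
    have hin := inside hni
    rw [x_ne r (by decide : (0 : Fin 3) ≠ 1)] at hle
    by_cases hC : (r, (1 : Fin 3)) ∈ C ↔ (r, (0 : Fin 3)) ∈ C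
    · have e := eq_of_iff (by decide : (1 : Fin 3) ≠ 2) (by decide) (by decide) hC
      rw [e]
      refine ih r 0 (e ▸ hni) ?_
      rw [x_self]
      push_cast at hle
      rcases h.sign with rfl | rfl <;> omega
    · by_cases h1 : (r, (1 : Fin 3)) ∈ C
      · have h2 := h.line h1
        have h3 := hin 1
        rw [x_self] at h3
        rcases h.sign with rfl | rfl <;> omega
      · have h0 : (r, (0 : Fin 3)) ∈ C := by tauto
        have h2 := h.line h0
        have h4 : n (S.vert r 0) = 0 := by
          by_contra h5
          have h3 := inside h5 0
          rw [x_self] at h3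
          rcases h.sign with rfl | rfl <;> omega
        have h5 := hg r 2
        change g (S.vert r 1) - g (S.vert r 0) = S.sgn r * (ind r 0 - ind r 1) at h5
        simp only [ind, h0, h1, if_true, if_false, hr] at h5
        simp only [hn] at h4 ⊢
        omega

end TriSurface

namespace TriSurface

variable {T V : Type*} {S : TriSurface T V}

/-! ### Strands -/

variable (S) in
/-- The elementary continuations of a strand. -/
inductive StrandStep : T × Fin 3 → T × Fin 3 → Prop
  | cont (t : T) (i j : Fin 3) (h : i ≠ j) : StrandStep (t, i) (S.nb t j, i)
  | refl (t : T) (i j k : Fin 3) (h : S.nb t j = t) (hi : i ≠ j) (hk : k ≠ j) :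
    StrandStep (t, i) (t, k)

variable (S) in
/-- The strand through a given midsegment. -/
def strand (d : T × Fin 3) : Set (T × Fin 3) := {d' | Relation.EqvGen S.StrandStep d d'}

theorem mem_strand (d : T × Fin 3) : d ∈ S.strand d := Relation.EqvGen.refl d

theorem strand_eq {c d : T × Fin 3} (h : d ∈ S.strand c) : S.strand d = S.strand c := by
  ext e
  exact ⟨fun h' => h.trans _ _ _ h', fun h' => (h.symm _ _).trans _ _ _ h'⟩

theorem strand_eq_of_mem {c d e : T × Fin 3} (h : e ∈ S.strand c) (h' : e ∈ S.strand d) :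
    S.strand c = S.strand d := (strand_eq h).symm.trans (strand_eq h')

section

variable {C : Set (T × Fin 3)} {a : Fin 3 → ℤ} {s : ℤ} {n : V → ℤ}

theorem IsWinding.not_bd (hW : S.IsWinding C a s n) {v : V} (h : n v ≠ 0) : ¬ S.Bd v :=
  fun hb => h (hW.bd hb)

/-- After the reflection the strand runs along the line `k` as well. If it goes on through the side
`k`, the midpoint of that side lies strictly inside the line `k`, which fixes the sign. If not, all
three midsegments belong to `C` and the sign is read off from `size`. -/
theorem IsStrand.corner_sgn (h : S.IsStrand C a s) {t : T} {i j : Fin 3} (hi : (t, i) ∈ C)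
    (hj : S.nb t j = t) (hij : i ≠ j) : S.sgn t = s := by
  obtain ⟨k, hki, hkj⟩ := Fin.exists_third i j
  have hk := h.refl hi hj hij hkj
  have li := h.line hi
  have lk := h.line hk
  by_cases hnk : S.nb t k = t
  · have hj := h.refl hi hnk hki.symm hkj.symm
    have lj := h.line hj
    have hsz := h.size
    rw [Fin.sum_third hij hki.symm hkj.symm, ← li, ← lk, ← lj] at hsz
    have hb := base_sum (S := S) t
    rw [Fin.sum_third hij hki.symm hkj.symm] at hb
    rcases h.sign with rfl | rfl <;> rcases S.sgn_eq t with e | e <;> omega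
  · have := (h.pos hi hnk hki.symm hij hkj).1
    rcases h.sign with rfl | rfl <;> rcases S.sgn_eq t with e | e <;> omega

/-- For a point of the line `i`, the doubled distances to the other two lines add up to the size. At
a crossing of an interior side both are positive integers, so size one leaves no room for such a
crossing. -/
theorem IsStrand.all_boundary (h : S.IsStrand C a s) (hs : -s * (a 0 + a 1 + a 2) = 1) {t : T}
    {i : Fin 3} (hi : (t, i) ∈ C) (j : Fin 3) : S.nb t j = t := by
  have key : ∀ i j, (t, i) ∈ C → i ≠ j → S.nb t j = t := by
    intro i j hi hij
    by_contra hj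
    obtain ⟨k, hki, hkj⟩ := Fin.exists_third i j
    have hp := h.pos hi hj hij hki.symm hkj.symm
    have li := h.line hi
    have hb := base_sum (S := S) t
    rw [Fin.sum_third hij hki.symm hkj.symm] at hb hs
    rcases h.sign with rfl | rfl <;> omega
  by_cases hij : i = j
  · subst hij
    obtain ⟨k, hk, -⟩ := Fin.exists_third i i
    obtain ⟨l, hl, hlk⟩ := Fin.exists_third i k
    exact key k i (h.refl hi (key i l hi hl.symm) hl.symm hlk.symm) hk
  · exact key i j hi hij

theorem IsStrand.size_eq_one (h : S.IsStrand C a s) {t : T} {i j k : Fin 3} (hi : (t, i) ∈ C)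
    (hj : S.nb t j = t) (hk : S.nb t k = t) (hij : i ≠ j) (hjk : j ≠ k) :
    -s * (a 0 + a 1 + a 2) = 1 := by
  have hall : ∀ l, (t, l) ∈ C := by
    intro l
    obtain ⟨m, hmj, hmk⟩ := Fin.exists_third j k
    by_cases hl : l = j
    · have hm := h.refl hi hj hij hmj
      rw [hl]; exact h.refl hm hk hmk hjk
    · exact h.refl hi hj hij hl
  have hsz := h.size
  rw [← h.line (hall 0), ← h.line (hall 1), ← h.line (hall 2)] at hsz ⊢
  have hb := base_sum (S := S) t
  rcases h.sign with rfl | rfl <;> rcases S.sgn_eq t with e | e <;> omega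

/-- By `pos`, crossings of interior sides lie strictly inside the other two lines, so the strand
does not meet itself there. -/
theorem IsStrand.not_both (h : S.IsStrand C a s) {t : T} {i j k : Fin 3} (hj : S.nb t j ≠ t)
    (hij : i ≠ j) (hik : i ≠ k) (hjk : j ≠ k) (hi : (t, i) ∈ C) : (t, k) ∉ C := by
  intro hk
  have := (h.pos hi hj hij hik hjk).2
  rw [h.line hk, sub_self, mul_zero] at this
  exact lt_irrefl _ this

/-- The midsegment `i` cuts off the vertex `i`, which lies beyond the line `i` when the triangle has
sign `s`, and inside it when the sign is `-s`. The outer side has winding number zero by `inside`,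
and crossing the strand changes the value. -/
theorem IsWinding.of_sgn_eq (h : S.IsStrand C a s) (hW : S.IsWinding C a s n) {t : T}
    {i j k : Fin 3} (hi : (t, i) ∈ C) (hj : S.nb t j ≠ t) (hij : i ≠ j) (hik : i ≠ k) (hjk : j ≠ k)
    (hs : S.sgn t = s) : n (S.vert t k) = s ∧ n (S.vert t i) = 0 := by
  have hne := hW.ne_of_cross hij hik hjk hi (h.not_both hj hij hik hjk hi)
  have h0 : n (S.vert t i) = 0 := by
    by_contra h0
    have := hW.inside h0 i
    rw [x_self] at this
    have := h.line hi
    rcases h.sign with rfl | rfl <;> omega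
  exact ⟨hW.val (fun hk => hne (h0.trans hk.symm)), h0⟩

theorem IsWinding.of_sgn_neg (h : S.IsStrand C a s) (hW : S.IsWinding C a s n) {t : T}
    {i j k : Fin 3} (hi : (t, i) ∈ C) (hj : S.nb t j ≠ t) (hij : i ≠ j) (hik : i ≠ k) (hjk : j ≠ k)
    (hs : S.sgn t = -s) : n (S.vert t i) = s ∧ n (S.vert t k) = 0 := by
  have hne := hW.ne_of_cross hij hik hjk hi (h.not_both hj hij hik hjk hi)
  have h0 : n (S.vert t k) = 0 := by
    by_contra h0
    have := hW.inside h0 i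
    rw [x_ne t hik] at this
    have := h.line hi
    rcases h.sign with rfl | rfl <;> omega
  exact ⟨hW.val (fun hk => hne (hk.trans h0.symm)), h0⟩

/-- The winding number does not vanish when passing to a vertex inside the triangle. -/
theorem IsWinding.ne_zero_of_inside (h : S.IsStrand C a s) (hW : S.IsWinding C a s n) {t : T}
    {i k : Fin 3} (hik : i ≠ k) (hi : n (S.vert t i) ≠ 0)
    (hk : ∀ l, 0 < s * (2 * S.x (S.vert t k) l - a l)) : n (S.vert t k) ≠ 0 := by
  obtain ⟨j, hji, hjk⟩ := Fin.exists_third i k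
  by_cases hC : (t, i) ∈ C ↔ (t, k) ∈ C
  · rwa [← hW.eq_of_iff hji.symm hik hjk hC]
  · exfalso
    have hin := hW.inside hi
    by_cases h1 : (t, i) ∈ C
    · have l1 := h.line h1
      have h2 := hin i
      have h3 := hk i
      rw [x_self] at h2
      rw [x_ne t hik] at h3
      rcases h.sign with rfl | rfl <;> rcases S.sgn_eq t with e | e <;> omega
    · have h1 : (t, k) ∈ C := by tauto
      have l1 := h.line h1
      have h2 := hin k
      have h3 := hk k
      rw [x_self] at h3
      rw [x_ne t hik.symm] at h2
      rcases h.sign with rfl | rfl <;> rcases S.sgn_eq t with e | e <;> omega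

/-- A walk along a strip of triangles ends at the boundary. -/
theorem exists_row_end [Finite T] (hs : s = 1 ∨ s = -1) {e f : Fin 3} (hef : e ≠ f) (P : T → Prop)
    (t₀ : T) (h₀ : P t₀) (step₁ : ∀ t, P t → S.sgn t = -s → S.nb t e ≠ t → P (S.nb t e))
    (step₂ : ∀ t, P t → S.sgn t = s → S.nb t f ≠ t → P (S.nb t f)) :
    ∃ t, P t ∧ (S.sgn t = -s ∧ S.nb t e = t ∨ S.sgn t = s ∧ S.nb t f = t) := by
  -- Each crossing of the walk raises this quantity by one, so the walk is stuck at a maximum.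
  obtain ⟨t, ht, hmax⟩ := Set.exists_max_image {t | P t} (fun t => s * (S.base t f - S.base t e))
    (Set.toFinite _) ⟨t₀, h₀⟩
  refine ⟨t, ht, ?_⟩
  have hor : S.sgn t = -s ∨ S.sgn t = s := by
    rcases hs with rfl | rfl <;> rcases S.sgn_eq t with e | e <;> omega
  rcases hor with h | h
  · refine Or.inl ⟨h, ?_⟩
    by_contra hne
    have := hmax _ (step₁ t ht h hne)
    simp only [base_nb_self hne, base_nb_ne hne hef.symm] at this
    rcases hs with rfl | rfl <;> omega
  · refine Or.inr ⟨h, ?_⟩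
    by_contra hne
    have := hmax _ (step₂ t ht h hne)
    simp only [base_nb_self hne, base_nb_ne hne hef] at this
    rcases hs with rfl | rfl <;> omega

variable (S) in
/-- The midsegment of direction `i` next to the vertex `w`, on the side of sign `s`, is in `Q`. -/
def Chord (Q : Set (T × Fin 3)) (s : ℤ) (i : Fin 3) (w : V) : Prop :=
  ∃ τ, S.sgn τ = s ∧ S.vert τ i = w ∧ (τ, i) ∈ Q

variable {Q : Set (T × Fin 3)} {a' : Fin 3 → ℤ} {s' : ℤ} {n' : V → ℤ}

/-- The same strand runs next to a side of a strand from one corner to the other. -/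
theorem Chord.row [Finite T] (h : S.IsStrand C a s) (hW : S.IsWinding C a s n)
    (hQ : S.IsStrand Q a' s') {tc : T} {i e f : Fin 3} (hie : i ≠ e) (hif : i ≠ f) (hef : e ≠ f)
    (he : S.nb tc e = tc) (hi : (tc, i) ∈ C) (hf : S.nb tc f ≠ tc)
    (hch : S.Chord Q s i (S.vert tc e)) :
    ∃ r, S.nb r f = r ∧ (r, i) ∈ C ∧ S.nb r e ≠ r ∧ S.Chord Q s i (S.vert r f) := by
  have hsc := h.corner_sgn hi he hie
  have key := exists_row_end (S := S) h.sign hef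
    (fun t => (t, i) ∈ C ∧ (S.sgn t = -s → S.Chord Q s i (S.vert t i)) ∧
      (S.sgn t = s → S.nb t e ≠ t ∧ S.Chord Q s i (S.vert t f))) (S.nb tc f)
  have hs0 : s ≠ -s := by rcases h.sign with rfl | rfl <;> decide
  refine Exists.elim (key ?_ ?_ ?_) ?_
  · refine ⟨h.cont hi hif, fun _ => ?_, fun h' => ?_⟩
    · rwa [S.vert_nb tc f i e hf hif hef hie]
    · rw [S.sgn_nb _ _ hf] at h'
      rcases h.sign with rfl | rfl <;> omega
  · rintro t ⟨ht, hc, -⟩ hs hne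
    refine ⟨h.cont ht hie, fun h' => ?_, fun _ => ⟨?_, ?_⟩⟩
    · rw [S.sgn_nb _ _ hne] at h'
      rcases h.sign with rfl | rfl <;> omega
    · rw [S.nb_nb]; exact hne.symm
    · rw [S.vert_nb t e f i hne hef.symm hie hif.symm]; exact hc hs
  · rintro t ⟨ht, -, hc⟩ hs hne
    obtain ⟨hnb, τ, hτs, hτv, hτ⟩ := hc hs
    have hs0 : s ≠ 0 := by rcases h.sign with rfl | rfl <;> decide
    -- Both ends of the side `i` of `t` have winding number `s` and are therefore interior. So the
    -- triangle beyond this side and its two further neighbors exist, and `Q` runs straight through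
    -- these three triangles.
    have hw : ¬ S.Bd (S.vert t f) := hW.not_bd (by
      rw [(hW.of_sgn_eq h ht hnb hie hif hef hs).1]; exact hs0)
    have hw' : ¬ S.Bd (S.vert t e) := hW.not_bd (by
      rw [(hW.of_sgn_eq h ht hne hif hie hef.symm hs).1]; exact hs0)
    refine ⟨h.cont ht hif, fun _ => ?_, fun h' => ?_⟩
    · rw [S.vert_nb t f i e hne hif hef hie]
      have hu := nb_ne_of_not_bd hw hif.symm
      have hus := S.sgn_nb _ _ hu
      have e1 := S.vert_nb t i e f hu hie.symm hif.symm hef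
      have e2 := S.vert_nb t i f e hu hif.symm hie.symm hef.symm
      have hu1 := nb_ne_of_not_bd (e1 ▸ hw) hef
      have hu2 := nb_ne_of_not_bd (e2 ▸ hw') hef.symm
      have e3 := S.vert_nb (S.nb t i) f i e hu1 hif hef hie
      have : S.nb (S.nb t i) f = τ := by
        refine star_eq (hτv ▸ hw) (by rw [e3, e1, hτv]) ?_
        rw [S.sgn_nb _ _ hu1, hus, neg_neg, hs, hτs]
      rw [← this, hQ.cont_iff hif] at hτ
      refine ⟨S.nb (S.nb t i) e, ?_, ?_, hQ.cont hτ hie⟩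
      · rw [S.sgn_nb _ _ hu2, hus, neg_neg, hs]
      · rw [S.vert_nb (S.nb t i) e i f hu2 hie hef.symm hif, e2]
    · rw [S.sgn_nb _ _ hne] at h'
      rcases h.sign with rfl | rfl <;> omega
  · rintro r ⟨⟨hr, -, hr'⟩, h1 | h1⟩
    · exact absurd ((h.corner_sgn hr h1.2 hie).symm.trans h1.1) hs0
    · exact ⟨r, h1.2, hr, (hr' h1.1).1, (hr' h1.1).2⟩

/-- Near the inner vertex of a corner there is at most one further strand. -/
theorem IsStrand.corner_unique (h : S.IsStrand C a s) (hW' : S.IsWinding Q a' s' n')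
    (hQ : S.IsStrand Q a' s') {t : T} {i d : Fin 3} (hid : i ≠ d) (hd : S.nb t d = t)
    (hi : (t, i) ∈ C) (hn : n' (S.vert t d) ≠ 0) : (t, i) ∈ Q ∨ (t, d) ∈ Q ∧ s' = -s := by
  obtain ⟨k, hki, hkd⟩ := Fin.exists_third i d
  have h0 : n' (S.vert t i) = 0 := hW'.bd ⟨t, d, i, hd, hid, rfl⟩
  by_cases h1 : (t, i) ∈ Q
  · exact Or.inl h1
  · have h2 : (t, d) ∈ Q := by
      by_contra h2
      apply hn
      rw [← h0]
      exact hW'.eq_of_iff hkd.symm hid.symm hki (by tauto)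
    refine Or.inr ⟨h2, ?_⟩
    have h3 := hW'.inside hn d
    have := hQ.line h2
    rw [x_self] at h3
    have := h.corner_sgn hi hd hid
    rcases h.sign with rfl | rfl <;> rcases hQ.sign with rfl | rfl <;> omega

end

end TriSurface

/-! ### Corners of strands and the classification -/

namespace TriSurface

variable {T V : Type*} {S : TriSurface T V}

section

variable {a : Fin 3 → ℤ} {s : ℤ} {n : V → ℤ} {a' : Fin 3 → ℤ} {s' : ℤ} {n' : V → ℤ}

/-- Going down from a chord along the other side of the corner one reaches another corner, whose inner
vertex cannot be inside a second triangle of the same orientation. -/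
theorem Chord.sign_ne [Finite T] {c q : T × Fin 3} (h : S.IsStrand (S.strand c) a s)
    (hW : S.IsWinding (S.strand c) a s n) (hQ : S.IsStrand (S.strand q) a' s')
    (hW' : S.IsWinding (S.strand q) a' s' n') {tc : T} {i k d : Fin 3} (hik : i ≠ k) (hid : i ≠ d)
    (hkd : k ≠ d) (hd : S.nb tc d = tc) (hi : (tc, i) ∈ S.strand c) (hni : S.nb tc i ≠ tc)
    (hnk : S.nb tc k ≠ tc) (hch : S.Chord (S.strand q) s i (S.vert tc d)) : s' = -s := by
  -- If the signs agree, the line `i` of `Q` is one step further in than that of `C`, while the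
  -- other two lines of `Q` are not further in. Then the inner vertices of `C` along its side `k`,
  -- past the chord, stay inside `Q` as far as the next corner of `C`. There `corner_unique` forces
  -- `Q` to be `C`, against the lines `i`, or to have the opposite sign.
  by_contra hss
  have hss : s' = s := by
    rcases h.sign with rfl | rfl <;> rcases hQ.sign with rfl | rfl <;> simp at hss ⊢
  subst hss
  have hs0 : s' ≠ 0 := by rcases h.sign with rfl | rfl <;> decide
  have hsn : s' ≠ -s' := by rcases h.sign with rfl | rfl <;> decide
  have hor : ∀ t, S.sgn t = -s' ∨ S.sgn t = s' := fun t => by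
    rcases h.sign with rfl | rfl <;> rcases S.sgn_eq t with e | e <;> omega
  have hsc := h.corner_sgn hi hd hid
  have hk := h.refl hi hd hid hkd
  have li := h.line hi
  have lk := h.line hk
  have hv : n (S.vert tc d) ≠ 0 := by
    rw [(hW.of_sgn_eq h hi hnk hik hid hkd hsc).1]; exact hs0
  have hvb := hW.not_bd hv
  -- the far end of the side
  have hfd : 0 < s' * (a d + s' - a' d) := by
    obtain ⟨r, hr, hri, hrd, τ, hτs, hτv, hτ⟩ := hch.row h hW hQ hid hik hkd.symm hd hi hnk
    have hrs := h.corner_sgn hri hr hik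
    have hw : n (S.vert r k) ≠ 0 := by
      rw [(hW.of_sgn_eq h hri hrd hid hik hkd.symm hrs).1]; exact hs0
    have hwb := hW.not_bd hw
    have h1 : n' (S.vert τ k) ≠ 0 := by
      rw [(hW'.of_sgn_eq hQ hτ (nb_ne_of_not_bd (hτv ▸ hwb) hid) hid hik hkd.symm hτs).1]
      exact hs0
    have h2 := hW'.inside h1 d
    have h3 := x_ne (S := S) τ hid.symm
    rw [hτv, x_ne r hkd.symm] at h3
    have h4 := h.line (h.refl hri hr hik hkd.symm)
    rw [x_ne τ hkd.symm] at h2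
    rcases h.sign with rfl | rfl <;> omega
  obtain ⟨τ, hτs, hτv, hτ⟩ := hch
  have hτb : ¬ S.Bd (S.vert τ i) := hτv ▸ hvb
  have hxi := x_self (S := S) τ i
  have hxk := x_ne (S := S) τ hik.symm
  rw [hτv, x_ne tc hid] at hxi
  rw [hτv, x_ne tc hkd] at hxk
  have lq := hQ.line hτ
  have hτd : n' (S.vert τ d) ≠ 0 := by
    rw [(hW'.of_sgn_eq hQ hτ (nb_ne_of_not_bd hτb hik) hik hid hkd hτs).1]
    exact hs0
  have hfk : 0 < s' * (a k + s' - a' k) := by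
    have h2 := hW'.inside hτd k
    rw [x_ne τ hkd] at h2
    rcases h.sign with rfl | rfl <;> omega
  have hfi : a' i = a i + 2 * s' := by omega
  have key := exists_row_end (S := S) h.sign hid.symm
    (fun t => (t, k) ∈ S.strand c ∧ (S.sgn t = -s' → n' (S.vert t k) ≠ 0) ∧
      (S.sgn t = s' → S.nb t d ≠ t ∧ n' (S.vert t i) ≠ 0)) (S.nb τ i)
  refine Exists.elim (key ?_ ?_ ?_) ?_
  · have hτi := nb_ne_of_not_bd (hW'.not_bd hτd) hid.symm
    have e1 := S.vert_nb tc i k d hni hik.symm hid.symm hkd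
    have h1 := nb_ne_of_not_bd (e1 ▸ hvb) hkd
    have e2 := S.vert_nb (S.nb tc i) d i k h1 hid hkd hik
    have : S.nb (S.nb tc i) d = τ := by
      refine star_eq hτb (by rw [e2, e1, hτv]) ?_
      rw [S.sgn_nb _ _ h1, S.sgn_nb _ _ hni, hsc, hτs, neg_neg]
    have hτk : (τ, k) ∈ S.strand c := this ▸ h.cont (h.cont hk hik.symm) hkd
    refine ⟨h.cont hτk hik.symm, fun _ => ?_, fun h' => ?_⟩
    · rwa [S.vert_nb τ i k d hτi hik.symm hid.symm hkd]
    · rw [S.sgn_nb _ _ hτi, hτs] at h'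
      exact absurd h'.symm hsn
  · rintro t ⟨ht, hc, -⟩ hs hne
    refine ⟨h.cont ht hkd, fun h' => ?_, fun _ => ⟨?_, ?_⟩⟩
    · rw [S.sgn_nb _ _ hne, hs, neg_neg] at h'
      exact absurd h' hsn
    · rw [S.nb_nb]; exact hne.symm
    · rw [S.vert_nb t d i k hne hid hkd hik]; exact hc hs
  · rintro t ⟨ht, -, hc⟩ hs hne
    obtain ⟨hnb, hn'⟩ := hc hs
    have hnd : n (S.vert t d) ≠ 0 := by
      rw [(hW.of_sgn_eq h ht hne hik.symm hkd hid hs).1]; exact hs0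
    refine ⟨h.cont ht hik.symm, fun _ => ?_, fun h' => ?_⟩
    · rw [S.vert_nb t i k d hne hik.symm hid.symm hkd]
      -- The next inner vertex of `C` is farther from the line `i` than the previous one; for the
      -- other two lines, being inside `C` is enough.
      refine hW'.ne_zero_of_inside hQ hid hn' fun l => ?_
      have hl := hW.inside hnd l
      rcases Fin.eq_third (l := l) hik hid hkd with rfl | rfl | rfl
      · have := hW'.inside hn' l
        rw [x_self] at this
        rw [x_ne t hid]
        rcases h.sign with rfl | rfl <;> omega
      · rcases h.sign with rfl | rfl <;> omega
      · rcases h.sign with rfl | rfl <;> omega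
    · rw [S.sgn_nb _ _ hne, hs] at h'
      exact absurd h'.symm hsn
  · rintro r ⟨⟨hr, -, hr'⟩, h1 | h1⟩
    · exact absurd ((h.corner_sgn hr h1.2 hkd).symm.trans h1.1) hsn
    · rcases h.corner_unique hW' hQ hik.symm h1.2 hr (hr' h1.1).2 with h2 | h2
      · have := strand_eq_of_mem h2 hr
        rw [this] at hτ
        have := h.line hτ
        rcases h.sign with rfl | rfl <;> omega
      · exact hsn h2.2

/-- At each corner of a strand of size at least three, the strand through the third midsegment of the
corner triangle is the chord of the two sides and points the other way. -/
theorem IsStrand.corner_chord [Finite T] (H : ∀ d, ∃ a s, S.IsStrand (S.strand d) a s)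
    {c : T × Fin 3} (h : S.IsStrand (S.strand c) a s) (hW : S.IsWinding (S.strand c) a s n)
    (hsz : -s * (a 0 + a 1 + a 2) ≠ 1) {tc : T} {i d : Fin 3} (hid : i ≠ d)
    (hd : S.nb tc d = tc) (hi : (tc, i) ∈ S.strand c) (hQ : S.IsStrand (S.strand (tc, d)) a' s') :
    S.Chord (S.strand (tc, d)) s i (S.vert tc d) ∧ s' = -s ∧ a' i = a i + 2 * s := by
  obtain ⟨k, hki, hkd⟩ := Fin.exists_third i d
  have hs0 : s ≠ 0 := by rcases h.sign with rfl | rfl <;> decide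
  have hsc := h.corner_sgn hi hd hid
  have hk := h.refl hi hd hid hkd
  have hni : S.nb tc i ≠ tc := fun hb => hsz (h.size_eq_one hk hb hd hki hid)
  have hnk : S.nb tc k ≠ tc := fun hb => hsz (h.size_eq_one hi hb hd hki.symm hkd)
  have hvb : ¬ S.Bd (S.vert tc d) := hW.not_bd (by
    rw [(hW.of_sgn_eq h hi hnk hki.symm hid hkd hsc).1]; exact hs0)
  -- The strand through the chord position has sign `-s`, so it winds around the inner vertex and
  -- must cross the corner triangle. It cannot do so along `(tc, i)`, because its own line `i` lies
  -- one step further in; hence it uses `(tc, d)`.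
  obtain ⟨τ, hτs, hτv⟩ := exists_star hvb h.sign i
  obtain ⟨a₀, s₀, h₀⟩ := H (τ, i)
  obtain ⟨n₀, hW₀⟩ := h₀.exists_winding hd
  have hτ := S.mem_strand (τ, i)
  have hs₀ := Chord.sign_ne h hW h₀ hW₀ hki.symm hid hkd hd hi hni hnk ⟨τ, hτs, hτv, hτ⟩
  have hnv : n₀ (S.vert tc d) ≠ 0 := by
    rw [← hτv, (hW₀.of_sgn_neg h₀ hτ (nb_ne_of_not_bd (hτv ▸ hvb) hid) hid hki.symm hkd.symm
      (by rw [hτs, hs₀, neg_neg])).1, hs₀]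
    exact neg_ne_zero.2 hs0
  have hx := x_self (S := S) τ i
  rw [hτv, x_ne tc hid] at hx
  have hτd : (tc, d) ∈ S.strand (τ, i) := by
    rcases h.corner_unique hW₀ h₀ hid hd hi hnv with h1 | h1
    · have l1 := h₀.line h1
      have l2 := h₀.line hτ
      omega
    · exact h1.1
  have e := strand_eq hτd
  rw [← e] at hτ
  obtain ⟨n', hW'⟩ := hQ.exists_winding hd
  have hch : S.Chord (S.strand (tc, d)) s i (S.vert tc d) := ⟨τ, hτs, hτv, hτ⟩
  refine ⟨hch, Chord.sign_ne h hW hQ hW' hki.symm hid hkd hd hi hni hnk hch, ?_⟩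
  have l1 := h.line hi
  have l2 := hQ.line hτ
  omega

/-- The triangles of opposite orientation at the inner vertex of a corner lie on the boundary. -/
theorem IsStrand.corner_hexagon [Finite T] (H : ∀ d, ∃ a s, S.IsStrand (S.strand d) a s)
    {c : T × Fin 3} (h : S.IsStrand (S.strand c) a s) (hsz : -s * (a 0 + a 1 + a 2) ≠ 1)
    {tc : T} {i d : Fin 3} (hid : i ≠ d) (hd : S.nb tc d = tc) (hi : (tc, i) ∈ S.strand c) :
    ¬ S.Bd (S.vert tc d) ∧ ∃ q a', S.IsStrand (S.strand q) a' (-s) ∧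
      - -s * (a' 0 + a' 1 + a' 2) ≠ 1 ∧ ∀ t j, S.vert t j = S.vert tc d → S.sgn t = -s →
        S.nb t j = t ∧ ∀ m, m ≠ j → (t, m) ∈ S.strand q := by
  obtain ⟨k, hki, hkd⟩ := Fin.exists_third i d
  obtain ⟨n, hW⟩ := h.exists_winding hd
  have hs0 : s ≠ 0 := by rcases h.sign with rfl | rfl <;> decide
  have hsc := h.corner_sgn hi hd hid
  have hk := h.refl hi hd hid hkd
  have hnk : S.nb tc k ≠ tc := fun hb => hsz (h.size_eq_one hi hb hd hki.symm hkd)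
  have hvb : ¬ S.Bd (S.vert tc d) := hW.not_bd (by
    rw [(hW.of_sgn_eq h hi hnk hki.symm hid hkd hsc).1]; exact hs0)
  obtain ⟨a', s', hQ⟩ := H (tc, d)
  obtain ⟨chi, rfl, hai⟩ := h.corner_chord H hW hsz hid hd hi hQ
  obtain ⟨chk, -, hak⟩ := h.corner_chord H hW hsz hkd hd hk hQ
  obtain ⟨n', hW'⟩ := hQ.exists_winding hd
  -- The same strand is the chord at the far corner of the side `i`, which gives the third line.
  have had : a' d = a d + 2 * s := by
    obtain ⟨r, hr, hri, hrd, τ, hτs, hτv, hτ⟩ :=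
      chi.row h hW hQ hid hki.symm hkd.symm hd hi hnk
    have hrs := h.corner_sgn hri hr hki.symm
    have hwb : ¬ S.Bd (S.vert r k) := hW.not_bd (by
      rw [(hW.of_sgn_eq h hri hrd hid hki.symm hkd.symm hrs).1]; exact hs0)
    obtain ⟨a₁, s₁, h₁⟩ := H (r, k)
    obtain ⟨⟨τ', hτs', hτv', hτ'⟩, -, -⟩ := h.corner_chord H hW hsz hki.symm hr hri h₁
    have : τ' = τ := star_eq (hτv ▸ hwb) (hτv'.trans hτv.symm) (hτs'.trans hτs.symm)
    subst this
    have e := strand_eq_of_mem hτ' hτ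
    rw [e] at h₁
    exact (h.corner_chord H hW hsz hkd.symm hr (h.refl hri hr hki.symm hkd.symm)
      (a' := a') (s' := -s) (e ▸ hQ)).2.2
  refine ⟨hvb, (tc, d), a', hQ, ?_, ?_⟩
  · have hv : n' (S.vert tc d) ≠ 0 := by
      obtain ⟨τ, hτs, hτv, hτ⟩ := chi
      rw [← hτv, (hW'.of_sgn_neg hQ hτ (nb_ne_of_not_bd (hτv ▸ hvb) hid) hid hki.symm hkd.symm
        (by rw [hτs, neg_neg])).1]
      exact neg_ne_zero.2 hs0
    have hin := hW'.inside hv d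
    rw [x_self] at hin
    have hb := base_sum (S := S) tc
    rw [Fin.sum_third hid hki.symm hkd.symm] at hb ⊢
    have l1 := h.line hi
    have l2 := h.line hk
    rcases h.sign with rfl | rfl <;> omega
  · intro t j hv hs
    -- `Q` meets all three triangles of sign `s` at the inner vertex: two as chords, and the corner
    -- triangle itself. A triangle of sign `-s` lies between two of these, so `Q` passes through it
    -- in two directions, and `not_both` puts its outer side on the boundary.
    have hchord : ∀ m, S.Chord (S.strand (tc, d)) s m (S.vert tc d) := by
      intro m
      rcases Fin.eq_third (l := m) hid hki.symm hkd.symm with rfl | rfl | rfl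
      · exact chi
      · exact ⟨tc, hsc, rfl, S.mem_strand _⟩
      · exact chk
    have htb : ¬ S.Bd (S.vert t j) := hv ▸ hvb
    have hm : ∀ m, m ≠ j → (t, m) ∈ S.strand (tc, d) := by
      intro m hmj
      obtain ⟨l, hlm, hlj⟩ := Fin.exists_third m j
      obtain ⟨τ, hτs, hτv, hτ⟩ := hchord m
      have hne := nb_ne_of_not_bd htb hlj.symm
      have e := S.vert_nb t l m j hne hlm.symm hlj.symm hmj
      have : S.nb t l = τ := by
        refine star_eq (hτv ▸ hvb) (by rw [e, hv, hτv]) ?_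
        rw [S.sgn_nb _ _ hne, hs, hτs, neg_neg]
      rw [← this] at hτ
      exact (hQ.cont_iff hlm.symm).1 hτ
    refine ⟨?_, hm⟩
    by_contra hne
    obtain ⟨m, hmj, -⟩ := Fin.exists_third j j
    obtain ⟨l, hlm, hlj⟩ := Fin.exists_third m j
    exact hQ.not_both hne hmj hlm.symm hlj.symm (hm m hmj) (hm l hlj)

/-- If every strand bounds an equilateral triangle, then the surface is a single triangle or a
hexagon. -/
theorem triangle_or_hexagon [Finite T] [Nonempty T]
    (H : ∀ d, ∃ a s, S.IsStrand (S.strand d) a s) :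
    (∃ t : T, ∀ t', t' = t) ∨
      ∃ (t : T) (i : Fin 3), ¬ S.Bd (S.vert t i) ∧ ∀ t', ∃ j, S.vert t' j = S.vert t i := by
  obtain ⟨t₀⟩ := ‹Nonempty T›
  obtain ⟨a, s, h⟩ := H (t₀, 0)
  obtain ⟨t, ht, hor⟩ := exists_row_end (S := S) h.sign (by decide : (1 : Fin 3) ≠ 2)
    (fun t => (t, 0) ∈ S.strand (t₀, 0)) t₀ (S.mem_strand _)
    (fun t ht _ _ => h.cont ht (by decide)) (fun t ht _ _ => h.cont ht (by decide))
  obtain ⟨j, hj, hnb⟩ : ∃ j, (0 : Fin 3) ≠ j ∧ S.nb t j = t := by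
    rcases hor with h | h
    · exact ⟨1, by decide, h.2⟩
    · exact ⟨2, by decide, h.2⟩
  by_cases hsz : -s * (a 0 + a 1 + a 2) = 1
  · left
    have hb := h.all_boundary hsz ht
    have := S.connected {t} ⟨t, rfl⟩ (by rintro _ rfl j; exact hb j)
    exact ⟨t, fun t' => (this ▸ Set.mem_univ t' : t' ∈ ({t} : Set T))⟩
  · right
    obtain ⟨hvb, q, a', hQ, hsz', hq⟩ := h.corner_hexagon H hsz hj hnb ht
    -- The triangles of sign `-s` at the inner vertex are corners of `Q`. Applied to `Q` at one of
    -- them, the same lemma settles the triangles of sign `s`.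
    obtain ⟨r, hrs, hrv⟩ := exists_star hvb (hQ.sign) 0
    obtain ⟨hr0, hrm⟩ := hq r 0 hrv hrs
    obtain ⟨-, q', a'', -, -, hq'⟩ := hQ.corner_hexagon H hsz' (by decide : (1 : Fin 3) ≠ 0) hr0
      (hrm 1 (by decide))
    have hall : ∀ t' j', S.vert t' j' = S.vert t j → S.nb t' j' = t' := by
      intro t' j' hv
      by_cases hs : S.sgn t' = -s
      · exact (hq t' j' hv hs).1
      · refine (hq' t' j' (hv.trans hrv.symm) ?_).1
        rcases h.sign with rfl | rfl <;> rcases S.sgn_eq t' with e | e <;> omega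
    refine ⟨t, j, hvb, fun t' => ?_⟩
    have := S.connected {t' | ∃ j', S.vert t' j' = S.vert t j} ⟨t, j, rfl⟩ (by
      rintro r ⟨l, hl⟩ m
      by_cases hml : l = m
      · subst hml
        rw [hall r l hl]; exact ⟨l, hl⟩
      · obtain ⟨p, hpl, hpm⟩ := Fin.exists_third l m
        exact ⟨p, by rw [S.vert_nb r m p l (nb_ne_of_not_bd (hl ▸ hvb) hml) hpm hml hpl, hl]⟩)
    exact (this ▸ Set.mem_univ t' : t' ∈ {t' | ∃ j', S.vert t' j' = S.vert t j})

end

end TriSurface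

namespace TriSurface

variable {T V : Type*} (S : TriSurface T V)

/-! ### Beams -/

/-- The index of the side through which a beam of direction `i` leaves an upward (`true`) or downward
triangle; also the direction of the beam that enters through the side `i`. -/
def exitIdx (b : Bool) (i : Fin 3) : Fin 3 := if b then i + 2 else i + 1

/-- The index of the side through which a beam of direction `i` enters an upward (`true`) or downward
triangle; also the direction of the beam that leaves through the side `i`. -/
def entryIdx (b : Bool) (i : Fin 3) : Fin 3 := if b then i + 1 else i + 2

/-- Whether the triangle points upwards. -/
def isUp (t : T) : Bool := decide (S.sgn t = 1)

/-- The continuation of a beam into the next triangle, if there is one. -/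
def fwd (p : T × Fin 3) : T × Fin 3 := (S.nb p.1 (exitIdx (S.isUp p.1) p.2), p.2)

/-- The beam emitted from the side `j` of `t` ends at the boundary side `j'` of `t'`. -/
def Hits (t : T) (j : Fin 3) (t' : T) (j' : Fin 3) : Prop :=
  S.nb t' j' = t' ∧ ∃ n, S.fwd^[n] (t, exitIdx (S.isUp t) j) = (t', entryIdx (S.isUp t') j')

/-- Twice the coordinate `l` of the midpoint of the side `k` of `t`. -/
def mid (t : T) (k l : Fin 3) : ℤ := 2 * S.base t l - if l = k then 0 else S.sgn t

variable {S}

theorem exit_entry (b : Bool) (i : Fin 3) : exitIdx b (entryIdx b i) = i := by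
  revert b i; decide

theorem entry_exit (b : Bool) (i : Fin 3) : entryIdx b (exitIdx b i) = i := by
  revert b i; decide

theorem entry_not (b : Bool) (i : Fin 3) : entryIdx (!b) i = exitIdx b i := by
  revert b i; decide

theorem eq_exit_or_entry (b : Bool) {i j : Fin 3} (h : j ≠ i) : j = exitIdx b i ∨ j = entryIdx b i := by
  revert b i j; decide

theorem exit_ne (b : Bool) (i : Fin 3) : exitIdx b i ≠ i := by
  revert b i; decide

theorem entry_ne (b : Bool) (i : Fin 3) : entryIdx b i ≠ i := by
  revert b i; decide

theorem isUp_nb {t : T} {j : Fin 3} (h : S.nb t j ≠ t) : S.isUp (S.nb t j) = !S.isUp t := by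
  unfold isUp
  rw [S.sgn_nb t j h]
  rcases S.sgn_eq t with e | e <;> rw [e] <;> decide

theorem mid_nb (t : T) (j l : Fin 3) : S.mid (S.nb t j) j l = S.mid t j l := by
  by_cases h : S.nb t j = t
  · rw [h]
  · unfold mid
    by_cases hl : l = j
    · subst hl; simp [base_nb_self h]
    · simp only [hl, if_false, base_nb_ne h hl, S.sgn_nb t j h]; ring

theorem mid_sum (t : T) (k : Fin 3) : S.mid t k 0 + S.mid t k 1 + S.mid t k 2 = 0 := by
  have := base_sum (S := S) t
  unfold mid
  fin_cases k <;> simp <;> omega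

/-- In doubled coordinates both kinds of triangles contribute the same displacement along the
direction `i`: beams are straight. -/
theorem mid_step (t : T) (i : Fin 3) :
    S.mid t (entryIdx (S.isUp t) i) i = 2 * S.base t i - S.sgn t ∧
    S.mid t (exitIdx (S.isUp t) i) i = 2 * S.base t i - S.sgn t ∧
    S.mid t (exitIdx (S.isUp t) i) (i + 1) = S.mid t (entryIdx (S.isUp t) i) (i + 1) - 1 ∧
    S.mid t (exitIdx (S.isUp t) i) (i + 2) = S.mid t (entryIdx (S.isUp t) i) (i + 2) + 1 := by
  unfold mid exitIdx entryIdx isUp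
  rcases S.sgn_eq t with e | e <;> rw [e] <;> fin_cases i <;> simp

/-- The geometry of a beam between two boundary sides. -/
theorem run_spec {t t' : T} {j j' i : Fin 3} (hi : i = exitIdx (S.isUp t) j) (hj : S.nb t j = t)
    (hj' : S.nb t' j' = t') {n' : ℕ}
    (hn' : S.fwd^[n'] (t, i) = (t', entryIdx (S.isUp t') j')) :
    ∃ N : ℕ, (S.mid t' j' i = S.mid t j i ∧ S.mid t' j' (i + 1) = S.mid t j (i + 1) - (N + 1) ∧
        S.mid t' j' (i + 2) = S.mid t j (i + 2) + (N + 1)) ∧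
      ∀ n, ∃ r, S.fwd^[n] (t, i) = (r, i) ∧ 2 * S.base r i - S.sgn r = S.mid t j i ∧
        ∀ k, k ≠ i → (S.nb r k ≠ r ∧ (∃ m, S.fwd^[m] (t, i) = (S.nb r k, i)) ∧
            S.mid t j (i + 1) - (N + 1) < S.mid r k (i + 1) ∧ S.mid r k (i + 1) < S.mid t j (i + 1) ∧
            S.mid t j (i + 2) < S.mid r k (i + 2) ∧
            S.mid r k (i + 2) < S.mid t j (i + 2) + (N + 1)) ∨
          (S.nb r k = r ∧ (r = t ∧ k = j ∨ (r, i) = (t', entryIdx (S.isUp t') j') ∧ k = j')) := by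
  have hex : ∃ n, S.fwd (S.fwd^[n] (t, i)) = S.fwd^[n] (t, i) := by
    refine ⟨n', ?_⟩
    rw [hn']
    simp only [fwd, exit_entry, hj']
  classical
  -- `fwd` stays in place at the boundary, so the iterates become constant; `N` is the first index
  -- where this happens, and the beam runs through `N + 1` triangles.
  set N := Nat.find hex with hN
  have hNs : S.fwd (S.fwd^[N] (t, i)) = S.fwd^[N] (t, i) := Nat.find_spec hex
  have hstay : ∀ m, S.fwd^[N + m] (t, i) = S.fwd^[N] (t, i) := by
    intro m
    induction m with
    | zero => rfl
    | succ m ih => rw [← add_assoc, Function.iterate_succ_apply', ih, hNs]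
  have hmain : ∀ n, n ≤ N → ∃ r, S.fwd^[n] (t, i) = (r, i) ∧
      S.mid r (entryIdx (S.isUp r) i) i = S.mid t j i ∧
      S.mid r (entryIdx (S.isUp r) i) (i + 1) = S.mid t j (i + 1) - n ∧
      S.mid r (entryIdx (S.isUp r) i) (i + 2) = S.mid t j (i + 2) + n ∧
      (n = 0 ∧ r = t ∨ S.nb r (entryIdx (S.isUp r) i) ≠ r ∧
        ∃ m, S.fwd^[m] (t, i) = (S.nb r (entryIdx (S.isUp r) i), i)) := by
    intro n
    induction n with
    | zero =>
      intro _
      refine ⟨t, rfl, ?_⟩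
      have : entryIdx (S.isUp t) i = j := by rw [hi, entry_exit]
      rw [this]
      simp
    | succ n ih =>
      intro hn
      obtain ⟨r, hr, h0, h1, h2, -⟩ := ih (by omega)
      have hnf : S.fwd (r, i) ≠ (r, i) := by
        rw [← hr]; exact Nat.find_min hex (by omega)
      have hne : S.nb r (exitIdx (S.isUp r) i) ≠ r := fun h => hnf (by simp only [fwd, h])
      obtain ⟨s1, s2, s3, s4⟩ := mid_step (S := S) r i
      refine ⟨S.nb r (exitIdx (S.isUp r) i), ?_, ?_⟩
      · rw [Function.iterate_succ_apply', hr]; rfl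
      · rw [isUp_nb hne, entry_not, mid_nb, mid_nb, mid_nb, S.nb_nb]
        push_cast
        exact ⟨by omega, by omega, by omega, Or.inr ⟨hne.symm, n, hr⟩⟩
  have hN' : S.fwd^[N] (t, i) = (t', entryIdx (S.isUp t') j') := by
    rcases le_total n' N with hle | hle
    · have hfix : S.fwd (S.fwd^[n'] (t, i)) = S.fwd^[n'] (t, i) := by
        rw [hn']
        simp only [fwd, exit_entry, hj']
      have : N ≤ n' := Nat.find_min' hex hfix
      rw [le_antisymm this hle, hn']
    · rw [← hn']
      obtain ⟨m, rfl⟩ := Nat.exists_eq_add_of_le hle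
      exact (hstay m).symm
  refine ⟨N, ?_, ?_⟩
  · obtain ⟨r, hr, h0, h1, h2, -⟩ := hmain N le_rfl
    rw [hN'] at hr
    have hrt : r = t' := (Prod.ext_iff.1 hr).1.symm
    have hij : entryIdx (S.isUp t') j' = i := (Prod.ext_iff.1 hr).2
    subst hrt
    obtain ⟨s1, s2, s3, s4⟩ := mid_step (S := S) r i
    have : exitIdx (S.isUp r) i = j' := by rw [← hij, exit_entry]
    rw [this] at s2 s3 s4
    omega
  · intro n
    obtain ⟨n, hnN, hn⟩ : ∃ m, m ≤ N ∧ S.fwd^[n] (t, i) = S.fwd^[m] (t, i) := by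
      rcases le_total n N with h | h
      · exact ⟨n, h, rfl⟩
      · obtain ⟨m, rfl⟩ := Nat.exists_eq_add_of_le h
        exact ⟨N, le_rfl, hstay m⟩
    rw [hn]
    obtain ⟨r, hr, h0, h1, h2, hor⟩ := hmain n hnN
    obtain ⟨s1, s2, s3, s4⟩ := mid_step (S := S) r i
    refine ⟨r, hr, by omega, fun k hk => ?_⟩
    rcases eq_exit_or_entry (S.isUp r) hk with rfl | rfl
    · rcases hnN.lt_or_eq with hlt | heq
      · have hnf : S.fwd (r, i) ≠ (r, i) := by
          rw [← hr]; exact Nat.find_min hex hlt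
        have hne : S.nb r (exitIdx (S.isUp r) i) ≠ r := fun h => hnf (by simp only [fwd, h])
        refine Or.inl ⟨hne, ⟨n + 1, ?_⟩, by omega, by omega, by omega, by omega⟩
        rw [Function.iterate_succ_apply', hr]; rfl
      · subst heq
        rw [hr] at hNs hN'
        right
        refine ⟨(Prod.ext_iff.1 hNs).1, Or.inr ⟨hN', ?_⟩⟩
        obtain ⟨h3, h4⟩ := Prod.ext_iff.1 hN'
        simp only at h3 h4
        rw [h4, h3, exit_entry]
    · rcases hor with ⟨rfl, rfl⟩ | ⟨hne, hm⟩
      · right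
        rw [hi, entry_exit]
        exact ⟨hj, Or.inl ⟨rfl, rfl⟩⟩
      · rcases Nat.eq_zero_or_pos n with rfl | hpos
        · right
          have : r = t := (Prod.ext_iff.1 hr).1.symm
          subst this
          rw [hi, entry_exit]
          exact ⟨hj, Or.inl ⟨rfl, rfl⟩⟩
        · exact Or.inl ⟨hne, hm, by omega, by omega, by omega, by omega⟩

/-- A closed beam with three reflections bounds an equilateral triangle. -/
theorem isStrand_of_hits {t : Fin 3 → T} {j : Fin 3 → Fin 3}
    (hb : ∀ r, S.Hits (t r) (j r) (t (r + 1)) (j (r + 1))) {d : T × Fin 3}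
    (hd : ∃ n r, S.fwd^[n] (t r, exitIdx (S.isUp (t r)) (j r)) = d) :
    ∃ a s, S.IsStrand (S.strand d) a s := by
  have hbd : ∀ r, S.nb (t r) (j r) = t r := by
    intro r
    have := (hb (r + 2)).1
    have e : r + 2 + 1 = r := (by decide : ∀ r : Fin 3, r + 2 + 1 = r) r
    rwa [e] at this
  let i : Fin 3 → Fin 3 := fun r => exitIdx (S.isUp (t r)) (j r)
  have hrun := fun r => run_spec (i := i r) rfl (hbd r) (hb r).1 (hb r).2.choose_spec
  choose N hN hn using hrun
  have hend : ∀ r, i r = entryIdx (S.isUp (t (r + 1))) (j (r + 1)) := by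
    intro r
    obtain ⟨r', h1, -⟩ := hn r (hb r).2.choose
    exact (Prod.ext_iff.1 (h1.symm.trans (hb r).2.choose_spec)).2
  -- A reflection changes the direction by `+1` in an upward and by `-1` in a downward triangle.
  -- Three such changes add up to zero modulo 3 only if they are all equal.
  have hcomb : ∀ (b0 b1 b2 : Bool) (j0 j1 j2 : Fin 3), exitIdx b0 j0 = entryIdx b1 j1 →
      exitIdx b1 j1 = entryIdx b2 j2 → exitIdx b2 j2 = entryIdx b0 j0 →
      b1 = b0 ∧ b2 = b0 ∧ j1 = entryIdx b0 j0 ∧ j2 = entryIdx b0 j1 ∧ j0 = entryIdx b0 j2 := by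
    decide
  obtain ⟨hb1, hb2, hj1, hj2, hj0⟩ := hcomb _ _ _ _ _ _ (hend 0) (hend 1) (hend 2)
  change S.isUp (t 1) = _ at hb1
  change S.isUp (t 2) = _ at hb2
  change j 1 = entryIdx _ (j 0) at hj1
  change j 2 = entryIdx _ (j 1) at hj2
  change j 0 = entryIdx _ (j 2) at hj0
  obtain ⟨b, hbb⟩ : ∃ b, b = S.isUp (t 0) := ⟨_, rfl⟩
  rw [← hbb] at hb1 hb2 hj1 hj2 hj0
  have hup : ∀ r, S.isUp (t r) = b := by
    intro r; fin_cases r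
    exacts [hbb.symm, hb1, hb2]
  have hj : ∀ r, j (r + 1) = entryIdx b (j r) := by
    intro r; fin_cases r
    exacts [hj1, hj2, hj0]
  have hir : ∀ r, i r = exitIdx b (j r) := fun r => by rw [← hup r]
  have hne : ∀ r, j r ≠ j (r + 1) := fun r => by rw [hj]; exact (entry_ne b _).symm
  have hthird : ∀ r l, l ≠ j r → l ≠ j (r + 1) → l = i r := by
    intro r l h1 h2
    rw [hj] at h2
    rw [hir]
    exact (eq_exit_or_entry b h1).resolve_right h2
  -- The beam of direction `l` joins the two boundary sides with index other than `l`; either of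
  -- their midpoints gives the position of its line.
  let a : Fin 3 → ℤ := fun l => if l = j 0 then S.mid (t 1) (j 1) l else S.mid (t 0) (j 0) l
  have ha : ∀ r l, l ≠ j r → a l = S.mid (t r) (j r) l := by
    intro r l hl
    by_cases h0 : l = j 0
    · simp only [a, h0, if_true]
      have e1 := (hN 1).1
      have : i 1 = j 0 := (hthird 1 (j 0) (hne 0) (hne 2).symm).symm
      rw [this] at e1
      fin_cases r
      · exact absurd h0 hl
      · rfl
      · exact e1.symm
    · simp only [a, h0, if_false]
      fin_cases r
      · rfl
      · have e0 := (hN 0).1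
        rw [← hthird 0 l h0 hl] at e0
        exact e0.symm
      · have e2 := (hN 2).1
        rw [← hthird 2 l hl h0] at e2
        exact e2
  have hsgn : S.sgn (t 0) = if b then 1 else -1 := by
    rw [hbb]
    unfold isUp
    rcases S.sgn_eq (t 0) with e | e <;> simp [e]
  set s := S.sgn (t 0) with hs
  let C : Set (T × Fin 3) := {p | ∃ r n, S.fwd^[n] (t r, i r) = p}
  have hcont : ∀ {q k l}, (q, k) ∈ C → k ≠ l → (S.nb q l, k) ∈ C := by
    rintro q k l ⟨r, n, h⟩ hkl
    obtain ⟨r', h1, -, h2⟩ := hn r n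
    rw [h, Prod.mk.injEq] at h1
    obtain ⟨rfl, rfl⟩ := h1
    rcases h2 l hkl.symm with ⟨-, ⟨m, hm⟩, -⟩ | ⟨h3, -⟩
    · exact ⟨r, m, hm⟩
    · rw [h3]; exact ⟨r, n, h⟩
  have hrefl : ∀ {q k l m}, (q, k) ∈ C → S.nb q l = q → k ≠ l → m ≠ l → (q, m) ∈ C := by
    rintro q k l m ⟨r, n, h⟩ hq hkl hml
    obtain ⟨r', h1, -, h2⟩ := hn r n
    have hemit : ∀ r, m ≠ j r → (t r, m) ∈ C := by
      intro r hm
      rcases eq_exit_or_entry (S.isUp (t r)) hm with rfl | rfl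
      · exact ⟨r, 0, rfl⟩
      · obtain ⟨n, hn⟩ := (hb (r + 2)).2
        rw [(by decide : ∀ r : Fin 3, r + 2 + 1 = r) r] at hn
        exact ⟨r + 2, n, hn⟩
    rw [h, Prod.mk.injEq] at h1
    obtain ⟨rfl, rfl⟩ := h1
    rcases h2 l hkl.symm with ⟨h3, -⟩ | ⟨-, ⟨rfl, rfl⟩ | ⟨h3, rfl⟩⟩
    · exact absurd hq h3
    · exact hemit r hml
    · rw [Prod.mk.injEq] at h3
      rw [h3.1]
      exact hemit _ hml
  have hsub : S.strand d ⊆ C := by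
    have hstep : ∀ x y, S.StrandStep x y → (x ∈ C ↔ y ∈ C) := by
      rintro _ _ (⟨t, i, j, h⟩ | ⟨t, i, j, k, h, hi, hk⟩)
      · exact ⟨fun h' => hcont h' h, fun h' => by simpa [S.nb_nb] using hcont h' h⟩
      · exact ⟨fun h' => hrefl h' h hi hk, fun h' => hrefl h' h hk hi⟩
    have heqv : ∀ x y, Relation.EqvGen S.StrandStep x y → (x ∈ C ↔ y ∈ C) := by
      intro x y h
      induction h with
      | rel x y h => exact hstep x y h
      | refl => rfl
      | symm x y _ ih => exact ih.symm
      | trans x y z _ _ ih1 ih2 => exact ih1.trans ih2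
    obtain ⟨n, r, h⟩ := hd
    intro p hp
    exact (heqv _ _ hp).1 ⟨r, n, h⟩
  have hi12 : ∀ r, b = true ∧ i r + 1 = j r ∨ b = false ∧ i r + 2 = j r := by
    intro r
    rw [hir]
    exact (by decide : ∀ (b : Bool) (x : Fin 3),
      b = true ∧ exitIdx b x + 1 = x ∨ b = false ∧ exitIdx b x + 2 = x) b (j r)
  have hl12 : ∀ (l m : Fin 3), l ≠ m → l = m + 1 ∨ l = m + 2 := by decide
  refine ⟨a, s, S.sgn_eq _, ?_, ?_, ?_, ?_, ?_, ?_⟩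
  · have h02 : j 0 ≠ j 2 := (hne 2).symm
    rw [Fin.sum_third (hne 0) h02 (hne 1), ha 1 _ (hne 0), ha 0 _ (hne 0).symm, ha 0 _ h02.symm]
    have hz := mid_sum (S := S) (t 0) (j 0)
    rw [Fin.sum_third (hne 0) h02 (hne 1)] at hz
    obtain ⟨-, e1, e2⟩ := hN 0
    rw [zero_add] at hz e1 e2 ⊢
    rcases hi12 0 with ⟨rfl, h⟩ | ⟨rfl, h⟩
    · rw [h] at e1
      simp only [if_true] at hsgn
      rw [hsgn]
      omega
    · rw [h] at e2
      simp only [Bool.false_eq_true, if_false] at hsgn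
      rw [hsgn]
      omega
  · intro l
    obtain ⟨r, hr⟩ : ∃ r, l ≠ j r := by
      by_cases h : l = j 0
      · exact ⟨1, h ▸ hne 0⟩
      · exact ⟨0, h⟩
    rw [ha r l hr]
    unfold mid
    rw [if_neg hr]
    rcases S.sgn_eq (t r) with e | e <;> omega
  · exact fun h h' => (Relation.EqvGen.trans _ _ _ h (.rel _ _ (.cont _ _ _ h')))
  · exact fun h h1 h2 h3 => (Relation.EqvGen.trans _ _ _ h (.rel _ _ (.refl _ _ _ _ h1 h2 h3)))
  · intro q k hq
    obtain ⟨r, n, h⟩ := hsub hq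
    obtain ⟨r', h1, h2, -⟩ := hn r n
    rw [h, Prod.mk.injEq] at h1
    obtain ⟨rfl, rfl⟩ := h1
    rw [h2, ha r]
    rw [hir]; exact exit_ne b _
  · intro q k l m hq hnb hkl hkm hlm
    obtain ⟨r, n, h⟩ := hsub hq
    obtain ⟨r', h1, -, h2⟩ := hn r n
    rw [h, Prod.mk.injEq] at h1
    obtain ⟨rfl, rfl⟩ := h1
    rcases h2 l hkl.symm with ⟨-, -, g1, g2, g3, g4⟩ | ⟨h3, -⟩
    · have key : ∀ l', l' ≠ i r → 0 < s * (S.mid q l l' - a l') := by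
        intro l' hl'
        obtain ⟨-, e1, e2⟩ := hN r
        rcases hi12 r with ⟨rfl, h⟩ | ⟨rfl, h⟩
        · simp only [if_true] at hsgn
          rcases hl12 _ _ hl' with rfl | rfl
          · rw [ha (r + 1) _ (h ▸ hne r)]
            rw [hsgn]; omega
          · rw [ha r _ (by rw [← h]; exact (Fin.add_one_ne_add_two₃ _).symm)]
            rw [hsgn]; omega
        · simp only [Bool.false_eq_true, if_false] at hsgn
          rcases hl12 _ _ hl' with rfl | rfl
          · rw [ha r _ (by rw [← h]; exact (Fin.add_one_ne_add_two₃ _))]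
            rw [hsgn]; omega
          · rw [ha (r + 1) _ (h ▸ hne r)]
            rw [hsgn]; omega
      refine ⟨?_, ?_⟩
      · have := key l hkl.symm
        simpa [mid] using this
      · have := key m hkm.symm
        simpa [mid, hlm.symm] using this
    · exact absurd h3 hnb

/-- Each midsegment is on a beam emitted from the boundary. -/
theorem exists_source [Finite T] (t : T) (i : Fin 3) : ∃ r j n, S.nb r j = r ∧
    S.fwd^[n] (r, exitIdx (S.isUp r) j) = (t, i) := by
  by_contra hcon
  -- Walk against the beam: the predecessor of an unreached midsegment is unreached, but the walk
  -- ends at a boundary side, which emits the midsegment found there.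
  obtain ⟨r, hr, hor⟩ := exists_row_end (S := S) (Or.inl rfl : (1 : ℤ) = 1 ∨ (1 : ℤ) = -1)
    (Fin.add_one_ne_add_two₃ i).symm
    (fun r => ¬ ∃ q j n, S.nb q j = q ∧ S.fwd^[n] (q, exitIdx (S.isUp q) j) = (r, i)) t hcon (by
      rintro r hr hs hne ⟨q, j, n, h1, h2⟩
      refine hr ⟨q, j, n + 1, h1, ?_⟩
      have hup : S.isUp r = false := by simp [isUp, hs]
      rw [Function.iterate_succ_apply', h2]
      simp only [fwd, isUp_nb hne, hup]
      change (S.nb (S.nb r (i + 2)) (i + 2), i) = _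
      rw [S.nb_nb]) (by
      rintro r hr hs hne ⟨q, j, n, h1, h2⟩
      refine hr ⟨q, j, n + 1, h1, ?_⟩
      have hup : S.isUp r = true := by simp [isUp, hs]
      rw [Function.iterate_succ_apply', h2]
      simp only [fwd, isUp_nb hne, hup]
      change (S.nb (S.nb r (i + 1)) (i + 1), i) = _
      rw [S.nb_nb])
  apply hr
  rcases hor with ⟨hs, hnb⟩ | ⟨hs, hnb⟩
  · have hup : S.isUp r = false := by simp [isUp, hs]
    refine ⟨r, i + 2, 0, hnb, ?_⟩
    rw [hup]
    change (r, i + 2 + 1) = _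
    rw [(by decide : ∀ i : Fin 3, i + 2 + 1 = i) i]
  · have hup : S.isUp r = true := by simp [isUp, hs]
    refine ⟨r, i + 1, 0, hnb, ?_⟩
    rw [hup]
    change (r, i + 1 + 2) = _
    rw [(by decide : ∀ i : Fin 3, i + 1 + 2 = i) i]

/-- If each beam closes up after three reflections, the surface is a triangle or a hexagon. -/
theorem triangle_or_hexagon_of_hits [Finite T] [Nonempty T]
    (H : ∀ t j, S.nb t j = t → ∃ t₁ j₁ t₂ j₂, S.Hits t j t₁ j₁ ∧ S.Hits t₁ j₁ t₂ j₂ ∧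
      S.Hits t₂ j₂ t j) :
    (∃ t : T, ∀ t', t' = t) ∨
      ∃ (t : T) (i : Fin 3), ¬ S.Bd (S.vert t i) ∧ ∀ t', ∃ j, S.vert t' j = S.vert t i := by
  refine triangle_or_hexagon fun d => ?_
  obtain ⟨r, j, n, hj, hn⟩ := S.exists_source d.1 d.2
  obtain ⟨t₁, j₁, t₂, j₂, h0, h1, h2⟩ := H r j hj
  refine isStrand_of_hits (t := ![r, t₁, t₂]) (j := ![j, j₁, j₂]) ?_ ⟨n, 0, hn⟩
  intro r
  fin_cases r
  exacts [h0, h1, h2]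

end TriSurface

/-! ### Topology of the realization -/

/-- Homotopies of paths in `X` are pushed back by the retraction. This serves to pass simple
connectedness from a wedge to its summands. -/
theorem SimplyConnectedSpace.of_retract {X Y : Type*} [TopologicalSpace X] [TopologicalSpace Y]
    [SimplyConnectedSpace X] (i : C(Y, X)) (r : C(X, Y)) (h : ∀ y, r (i y) = y) :
    SimplyConnectedSpace Y := by
  rw [simply_connected_iff_paths_homotopic']
  refine ⟨(Function.LeftInverse.surjective h).pathConnectedSpace r.continuous, ?_⟩
  intro x y p q
  have hcast : ∀ (a b : Y) (ha : x = a) (hb : y = b) (P Q : Path a b), P.Homotopic Q →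
      (P.cast ha hb).Homotopic (Q.cast ha hb) := by
    rintro a b rfl rfl P Q hPQ
    exact hPQ
  have e : ∀ p : Path x y, ((p.map i.continuous).map r.continuous).cast (h x).symm (h y).symm = p := by
    intro p
    ext t
    exact h (p t)
  have := hcast _ _ (h x).symm (h y).symm _ _
    ((SimplyConnectedSpace.paths_homotopic (p.map i.continuous) (q.map i.continuous)).map r)
  have e1 := e p
  have e2 := e q
  rw [← e1, ← e2]
  exact this

/-- A closed disk is not separated by a finite set. -/
theorem isPreconnected_compl_finite_closedBall
    {G : Set (Metric.closedBall (0 : EuclideanSpace ℝ (Fin 2)) 1)} (hG : G.Finite) :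
    IsPreconnected Gᶜ := by
  rw [← Topology.IsInducing.subtypeVal.isPreconnected_image]
  set G' : Set (EuclideanSpace ℝ (Fin 2)) := Subtype.val '' G with hG'
  have hfin : G'.Finite := hG.image _
  have hrank : 1 < Module.rank ℝ (EuclideanSpace ℝ (Fin 2)) := by
    rw [← Module.finrank_eq_rank, finrank_euclideanSpace_fin]
    norm_num
  -- The open disk is homeomorphic to the plane, which no countable set separates. The closed disk
  -- minus `G` lies between the punctured open disk and its closure.
  have hball : IsPreconnected (Metric.ball (0 : EuclideanSpace ℝ (Fin 2)) 1 ∩ G'ᶜ) := by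
    let ψ : EuclideanSpace ℝ (Fin 2) → EuclideanSpace ℝ (Fin 2) := fun x => (Homeomorph.unitBall x).1
    have hψ : Continuous ψ := continuous_subtype_val.comp Homeomorph.unitBall.continuous
    have hinj : Function.Injective ψ := Subtype.val_injective.comp Homeomorph.unitBall.injective
    have := ((hfin.preimage hinj.injOn).countable.isConnected_compl_of_one_lt_rank
      hrank).isPreconnected.image ψ hψ.continuousOn
    convert this using 1
    ext x
    constructor
    · rintro ⟨hx, hx'⟩
      refine ⟨Homeomorph.unitBall.symm ⟨x, hx⟩, ?_, ?_⟩
      · simpa [ψ] using hx'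
      · simp [ψ]
    · rintro ⟨y, hy, rfl⟩
      exact ⟨(Homeomorph.unitBall y).2, hy⟩
  refine hball.subset_closure ?_ ?_
  · rintro x ⟨hx, hx'⟩
    refine ⟨⟨x, Metric.ball_subset_closedBall hx⟩, ?_, rfl⟩
    intro h
    exact hx' ⟨_, h, rfl⟩
  · have hdense : Dense G'ᶜ := hfin.countable.dense_compl ℝ
    have h1 := hdense.open_subset_closure_inter (Metric.isOpen_ball (x := (0 : EuclideanSpace ℝ (Fin 2)))
      (ε := 1))
    have h2 := closure_minimal h1 isClosed_closure
    rw [closure_ball _ one_ne_zero] at h2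
    rintro _ ⟨x, -, rfl⟩
    exact h2 x.2

namespace PreAbstractSimplicialComplex

variable {V : Type*} {K : PreAbstractSimplicialComplex V}

theorem mem_realization_of {s : Finset V} (hs : s ∈ K.faces) {w : V → ℝ} (h0 : ∀ v, 0 ≤ w v)
    (h1 : ∀ v, v ∉ s → w v = 0) (h2 : ∑ v ∈ s, w v = 1) : w ∈ K.realization :=
  ⟨h0, s, hs, h1, h2⟩

/-- The triangles of a homogeneous triangulation of a disk are connected through edges. -/
theorem triangles_connected [DecidableEq V] (hfin : K.faces.Finite)
    (e : K.realization ≃ₜ Metric.closedBall (0 : EuclideanSpace ℝ (Fin 2)) 1)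
    (hom : ∀ s ∈ K.faces, ∃ t ∈ K.faces, t.card = 3 ∧ s ⊆ t) (A : Set (Finset V))
    (hA : ∀ t ∈ A, t ∈ K.faces ∧ t.card = 3) (hne : A.Nonempty)
    (hcl : ∀ t ∈ A, ∀ t' ∈ K.faces, t'.card = 3 → (t ∩ t').card = 2 → t' ∈ A) :
    ∀ t ∈ K.faces, t.card = 3 → t ∈ A := by
  intro t₁ ht₁ h3
  by_contra hnot
  obtain ⟨t₀, ht₀⟩ := hne
  let B : Set (Finset V) := {t | t ∈ K.faces ∧ t.card = 3 ∧ t ∉ A}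
  let R : Set (Finset V) → Set K.realization := fun A => ⋃ t ∈ A, {w | ∀ v, v ∉ t → w.1 v = 0}
  have hR : ∀ A : Set (Finset V), A ⊆ K.faces → IsClosed (R A) := by
    intro A hA
    refine (hfin.subset hA).isClosed_biUnion fun t _ => ?_
    simp only [Set.ofPred_forall]
    exact isClosed_iInter fun v => isClosed_iInter fun _ =>
      isClosed_eq ((continuous_apply v).comp continuous_subtype_val) continuous_const
  let N : Set K.realization := {w | ∃ v, w.1 = Pi.single v 1}
  have hN : N.Finite := by
    have : (⋃ s ∈ K.faces, (fun v => (Pi.single v 1 : V → ℝ)) '' (s : Set V)).Finite :=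
      hfin.biUnion fun s _ => s.finite_toSet.image _
    refine (this.preimage Subtype.val_injective.injOn).subset ?_
    rintro ⟨w, h0, s, hs, h1, h2⟩ ⟨v, hv⟩
    simp only at hv
    have hvs : v ∈ s := by
      by_contra h
      have := h1 v h
      rw [hv] at this
      simp at this
    simp only [Set.mem_preimage, Set.mem_iUnion]
    exact ⟨s, hs, v, hvs, hv.symm⟩
  have hpre : IsPreconnected Nᶜ := by
    have := isPreconnected_compl_finite_closedBall (hN.image e)
    have h2 := this.image e.symm e.symm.continuous.continuousOn
    convert h2 using 1
    ext w
    constructor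
    · intro hw
      refine ⟨e w, ?_, e.symm_apply_apply w⟩
      rintro ⟨w', hw', h⟩
      exact hw (e.injective h ▸ hw')
    · rintro ⟨x, hx, rfl⟩ h
      exact hx ⟨_, h, e.apply_symm_apply x⟩
  have hbary : ∀ t ∈ K.faces, t.card = 3 → ∃ w : K.realization, w ∈ Nᶜ ∧ ∀ v, v ∉ t → w.1 v = 0 := by
    intro t ht h3
    refine ⟨⟨fun v => if v ∈ t then 1 / 3 else 0, mem_realization_of ht (fun v => ?_)
      (fun v hv => by simp [hv]) ?_⟩, ?_, fun v hv => by simp [hv]⟩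
    · split_ifs <;> norm_num
    · rw [Finset.sum_congr rfl (fun v hv => if_pos hv)]
      simp [h3]
    · rintro ⟨v, hv⟩
      have := congrFun hv v
      simp only [Pi.single_eq_same] at this
      split_ifs at this <;> norm_num at this
  rw [isPreconnected_closed_iff] at hpre
  -- The triangles in `A` and the remaining ones cover the realization by two closed sets, which
  -- must meet outside the vertices. But a triangle of `A` and one not in `A` share at most one
  -- vertex.
  obtain ⟨w, hwN, hwA, hwB⟩ := hpre (R A) (R B) (hR A fun t h => (hA t h).1) (hR B fun t h => h.1)
    (by
      rintro ⟨w, h0, s, hs, h1, h2⟩ -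
      obtain ⟨t, ht, h3, hst⟩ := hom s hs
      by_cases htA : t ∈ A
      · left
        simp only [R, Set.mem_iUnion]
        exact ⟨t, htA, fun v hv => h1 v fun h => hv (hst h)⟩
      · right
        simp only [R, Set.mem_iUnion]
        exact ⟨t, ⟨ht, h3, htA⟩, fun v hv => h1 v fun h => hv (hst h)⟩)
    (by
      obtain ⟨w, hw, hw'⟩ := hbary t₀ (hA _ ht₀).1 (hA _ ht₀).2
      refine ⟨w, hw, ?_⟩
      simp only [R, Set.mem_iUnion]
      exact ⟨t₀, ht₀, hw'⟩)
    (by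
      obtain ⟨w, hw, hw'⟩ := hbary t₁ ht₁ h3
      refine ⟨w, hw, ?_⟩
      simp only [R, Set.mem_iUnion]
      exact ⟨t₁, ⟨ht₁, h3, hnot⟩, hw'⟩)
  simp only [R, Set.mem_iUnion] at hwA hwB
  obtain ⟨t, ht, hwt⟩ := hwA
  obtain ⟨t', ⟨ht', h3', hnA⟩, hwt'⟩ := hwB
  have hcard : (t ∩ t').card ≤ 1 := by
    by_contra hc
    have h3t := (hA t ht).2
    have hle : (t ∩ t').card ≤ 3 := h3t ▸ Finset.card_le_card Finset.inter_subset_left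
    rcases (by omega : (t ∩ t').card = 2 ∨ (t ∩ t').card = 3) with h | h
    · exact hnA (hcl t ht t' ht' h3' h)
    · have e1 := Finset.eq_of_subset_of_card_le (Finset.inter_subset_left : t ∩ t' ⊆ t) (by omega)
      have e2 := Finset.eq_of_subset_of_card_le (Finset.inter_subset_right : t ∩ t' ⊆ t') (by omega)
      rw [e1] at e2
      exact hnA (e2 ▸ ht)
  obtain ⟨h0, s, hs, h1, h2⟩ := w.2
  have hsupp : ∀ v, w.1 v ≠ 0 → v ∈ s ∧ v ∈ t ∩ t' := by
    intro v hv
    refine ⟨?_, Finset.mem_inter.2 ⟨?_, ?_⟩⟩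
    · by_contra h; exact hv (h1 v h)
    · by_contra h; exact hv (hwt v h)
    · by_contra h; exact hv (hwt' v h)
  obtain ⟨v, hvs, hv⟩ : ∃ v ∈ s, w.1 v ≠ 0 := by
    by_contra hcon
    push Not at hcon
    rw [Finset.sum_eq_zero hcon] at h2
    exact zero_ne_one h2
  apply hwN
  have huniq : ∀ u, u ≠ v → w.1 u = 0 := by
    intro u hu
    by_contra h
    exact hu (Finset.card_le_one.1 hcard u (hsupp u h).2 v (hsupp v hv).2)
  refine ⟨v, funext fun u => ?_⟩
  by_cases hu : u = v
  · subst hu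
    rw [Pi.single_eq_same, ← h2, Finset.sum_eq_single_of_mem u hvs (fun b _ hb => huniq b hb)]
  · rw [huniq u hu, Pi.single_eq_of_ne hu]

/-- On a triangulated disk every integral `1`-cocycle is a coboundary. -/
theorem exists_potential [DecidableEq V] (hfin : K.faces.Finite)
    (e : K.realization ≃ₜ Metric.closedBall (0 : EuclideanSpace ℝ (Fin 2)) 1) (c : V → V → ℤ)
    (hc : ∀ s ∈ K.faces, ∀ u ∈ s, ∀ v ∈ s, ∀ w ∈ s, c u v + c v w = c u w) :
    ∃ g : V → ℤ, ∀ s ∈ K.faces, ∀ u ∈ s, ∀ v ∈ s, c u v = g v - g u := by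
  classical
  let F : Finset V := hfin.toFinset.biUnion id
  have hF : ∀ s ∈ K.faces, s ⊆ F := fun s hs v hv =>
    Finset.mem_biUnion.2 ⟨s, hfin.mem_toFinset.2 hs, hv⟩
  let lin : V → (V → ℝ) → ℝ := fun u w => ∑ v ∈ F, w v * (c u v : ℝ)
  have hlin : ∀ u, Continuous (lin u) := fun u =>
    continuous_finsetSum _ fun v _ => (continuous_apply v).mul continuous_const
  have hlins : ∀ s ∈ K.faces, ∀ w : V → ℝ, (∀ v, v ∉ s → w v = 0) → ∀ u,
      lin u w = ∑ v ∈ s, w v * (c u v : ℝ) := by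
    intro s hs w hw u
    refine (Finset.sum_subset (hF s hs) fun v _ hv => ?_).symm
    rw [hw v hv, zero_mul]
  have hshift : ∀ s ∈ K.faces, ∀ w : V → ℝ, (∀ v, v ∉ s → w v = 0) → ∑ v ∈ s, w v = 1 →
      ∀ u ∈ s, ∀ u' ∈ s, lin u' w = c u' u + lin u w := by
    intro s hs w hw h1 u hu u' hu'
    rw [hlins s hs w hw, hlins s hs w hw]
    have : ∀ v ∈ s, w v * (c u' v : ℝ) = w v * (c u' u : ℝ) + w v * (c u v : ℝ) := by
      intro v hv
      rw [← hc s hs u' hu' u hu v hv]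
      push_cast
      ring
    rw [Finset.sum_congr rfl this, Finset.sum_add_distrib, ← Finset.sum_mul, h1, one_mul]
  have hex : ∀ w : K.realization, ∃ u, w.1 u ≠ 0 := by
    rintro ⟨w, h0, s, hs, h1, h2⟩
    by_contra hcon
    push Not at hcon
    rw [Finset.sum_eq_zero fun v _ => hcon v] at h2
    exact zero_ne_one h2
  choose u₀ hu₀ using hex
  -- Integrating the cocycle modulo 1 gives a map to the circle, since another choice of the base
  -- vertex changes `lin` by an integer. It maps every vertex to zero, so a lift to the line, which
  -- exists on a disk, has integral values at the vertices; these values are the potential.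
  let φ : K.realization → AddCircle (1 : ℝ) := fun w => (lin (u₀ w) w.1 : ℝ)
  have hφ : ∀ w : K.realization, ∀ s ∈ K.faces, (∀ v, v ∉ s → w.1 v = 0) → ∑ v ∈ s, w.1 v = 1 →
      ∀ u ∈ s, φ w = (lin u w.1 : ℝ) := by
    intro w s hs h1 h2 u hu
    have hus : u₀ w ∈ s := by
      by_contra h
      exact hu₀ w (h1 _ h)
    simp only [φ]
    rw [hshift s hs w.1 h1 h2 u hu _ hus, AddCircle.coe_add]
    have : (((c (u₀ w) u : ℤ) : ℝ) : AddCircle (1 : ℝ)) = 0 :=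
      (AddCircle.coe_eq_zero_iff 1).2 ⟨c (u₀ w) u, by simp⟩
    rw [this, zero_add]
  have hcont : Continuous φ := by
    rw [continuous_iff_continuousAt]
    intro w₀
    have hopen : IsOpen {w : K.realization | w.1 (u₀ w₀) ≠ 0} :=
      isOpen_ne_fun ((continuous_apply _).comp continuous_subtype_val) continuous_const
    have hc1 : Continuous fun w : K.realization => ((lin (u₀ w₀) w.1 : ℝ) : AddCircle (1 : ℝ)) :=
      (AddCircle.continuous_mk' 1).comp ((hlin _).comp continuous_subtype_val)
    refine hc1.continuousAt.congr ?_
    filter_upwards [hopen.mem_nhds (hu₀ w₀)] with w hw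
    obtain ⟨h0, s, hs, h1, h2⟩ := w.2
    refine (hφ w s hs h1 h2 _ ?_).symm
    by_contra h
    exact hw (h1 _ h)
  have hlpc : LocallyPathConnectedSpace (Metric.closedBall (0 : EuclideanSpace ℝ (Fin 2)) 1) :=
    (convex_closedBall _ _).locallyPathConnectedSpace
  have hcontr : ContractibleSpace (Metric.closedBall (0 : EuclideanSpace ℝ (Fin 2)) 1) :=
    Metric.contractibleSpace_closedBall zero_le_one
  let a₀ : Metric.closedBall (0 : EuclideanSpace ℝ (Fin 2)) 1 := ⟨0, by simp⟩
  obtain ⟨x₀, hx₀⟩ := QuotientAddGroup.mk_surjective (φ (e.symm a₀))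
  obtain ⟨Φ, ⟨-, hΦ⟩, -⟩ := (AddCircle.isCoveringMap_coe (1 : ℝ)).existsUnique_continuousMap_lifts
    ⟨fun x => φ (e.symm x), hcont.comp e.symm.continuous⟩ a₀ x₀ hx₀
  have hΦ' : ∀ w, ((Φ (e w) : ℝ) : AddCircle (1 : ℝ)) = φ w := by
    intro w
    have := congrFun hΦ (e w)
    simpa using this
  have hc0 : ∀ s ∈ K.faces, ∀ u ∈ s, c u u = 0 := by
    intro s hs u hu
    have := hc s hs u hu u hu u hu
    omega
  let γ : V → V → ℝ → V → ℝ := fun u v τ x => (1 - τ) * (if x = u then 1 else 0) +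
    τ * (if x = v then 1 else 0)
  have hγ0 : ∀ u v τ, 0 ≤ τ → τ ≤ 1 → ∀ x, 0 ≤ γ u v τ x := by
    intro u v τ h0 h1 x
    have : 0 ≤ 1 - τ := by linarith
    simp only [γ]
    split_ifs <;> simp <;> linarith
  have hγ1 : ∀ s : Finset V, ∀ u ∈ s, ∀ v ∈ s, ∀ τ x, x ∉ s → γ u v τ x = 0 := by
    intro s u hu v hv τ x hx
    have h1 : x ≠ u := fun h => hx (h ▸ hu)
    have h2 : x ≠ v := fun h => hx (h ▸ hv)
    simp [γ, h1, h2]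
  have hγ2 : ∀ s : Finset V, ∀ u ∈ s, ∀ v ∈ s, ∀ τ, ∑ x ∈ s, γ u v τ x = 1 := by
    intro s u hu v hv τ
    simp only [γ]
    rw [Finset.sum_add_distrib, ← Finset.mul_sum, ← Finset.mul_sum, Finset.sum_ite_eq',
      Finset.sum_ite_eq', if_pos hu, if_pos hv]
    ring
  have hγlin : ∀ s ∈ K.faces, ∀ u ∈ s, ∀ v ∈ s, ∀ τ, lin u (γ u v τ) = τ * c u v := by
    intro s hs u hu v hv τ
    simp only [lin, γ, add_mul, mul_assoc, ite_mul, one_mul, zero_mul]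
    rw [Finset.sum_add_distrib, ← Finset.mul_sum, ← Finset.mul_sum, Finset.sum_ite_eq',
      Finset.sum_ite_eq', if_pos (hF s hs hu), if_pos (hF s hs hv), hc0 s hs u hu]
    simp
  have key : ∀ s ∈ K.faces, ∀ u (hu : u ∈ s) v (hv : v ∈ s),
      ∃ p : unitInterval → K.realization, (∀ τ, (p τ).1 = γ u v τ) ∧
      Φ (e (p 1)) - c u v = Φ (e (p 0)) := by
    intro s hs u hu v hv
    let p : unitInterval → K.realization := fun τ => ⟨γ u v τ,
      mem_realization_of hs (hγ0 u v τ τ.2.1 τ.2.2) (hγ1 s u hu v hv τ) (hγ2 s u hu v hv τ)⟩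
    have hp : Continuous p := by
      refine Continuous.subtype_mk (continuous_pi fun x => ?_) _
      simp only [γ]
      fun_prop
    refine ⟨p, fun τ => rfl, ?_⟩
    -- Along an edge, the lift minus the linear function is continuous with integral values, hence
    -- constant.
    have := (isPreconnected_univ (α := unitInterval)).constant_of_mapsTo
      (T := ((AddSubgroup.zmultiples (1 : ℝ) : AddSubgroup ℝ) : Set ℝ))
      (f := fun τ => Φ (e (p τ)) - lin u (p τ).1)
      ⟨(inferInstance : DiscreteTopology (AddSubgroup.zmultiples (1 : ℝ)))⟩ (Continuous.continuousOn (by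
        refine Continuous.sub (Φ.continuous.comp (e.continuous.comp hp))
          ((hlin u).comp (continuous_subtype_val.comp hp))))
      (by
        intro τ _
        have h1 := hΦ' (p τ)
        rw [hφ (p τ) s hs (hγ1 s u hu v hv τ) (hγ2 s u hu v hv τ) u hu] at h1
        have h2 : ((Φ (e (p τ)) - lin u (p τ).1 : ℝ) : AddCircle (1 : ℝ)) = 0 := by
          rw [AddCircle.coe_sub, h1, sub_self]
        obtain ⟨n, hn⟩ := (AddCircle.coe_eq_zero_iff 1).1 h2
        exact AddSubgroup.mem_zmultiples_iff.2 ⟨n, hn⟩)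
      (Set.mem_univ (1 : unitInterval)) (Set.mem_univ (0 : unitInterval))
    have e1 : lin u (p 1).1 = c u v := by
      have := hγlin s hs u hu v hv 1
      rw [one_mul] at this
      exact this
    have e0 : lin u (p 0).1 = 0 := by
      have := hγlin s hs u hu v hv 0
      rw [zero_mul] at this
      exact this
    simp only [e1, e0, sub_zero] at this
    exact this
  have hpt : ∀ v, (∃ s ∈ K.faces, v ∈ s) → ∃ (w : K.realization), w.1 = fun x => if x = v then 1 else 0 := by
    rintro v ⟨s, hs, hv⟩
    obtain ⟨p, hp, -⟩ := key s hs v hv v hv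
    refine ⟨p 0, ?_⟩
    rw [hp]
    funext x
    simp [γ]
  let g : V → ℤ := fun v => if h : ∃ s ∈ K.faces, v ∈ s then round (Φ (e (hpt v h).choose)) else 0
  have hg : ∀ v s, s ∈ K.faces → v ∈ s → ∀ w : K.realization,
      (w.1 = fun x => if x = v then 1 else 0) → Φ (e w) = g v := by
    intro v s hs hv w hw
    have hex : ∃ s ∈ K.faces, v ∈ s := ⟨s, hs, hv⟩
    simp only [g, dif_pos hex]
    have : (hpt v hex).choose = w := Subtype.ext ((hpt v hex).choose_spec.trans hw.symm)
    rw [this]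
    have h1 := hΦ' w
    rw [hφ w s hs (fun x hx => by rw [hw]; simp only [ite_eq_right_iff]; rintro rfl; exact absurd hv hx)
      (by rw [hw]; simp [hv]) v hv] at h1
    have h2 : lin v w.1 = 0 := by
      simp only [lin, hw, ite_mul, one_mul, zero_mul]
      rw [Finset.sum_ite_eq', if_pos (hF s hs hv), hc0 s hs v hv, Int.cast_zero]
    rw [h2, AddCircle.coe_zero] at h1
    obtain ⟨n, hn⟩ := (AddCircle.coe_eq_zero_iff 1).1 h1
    rw [← hn]
    simp
  refine ⟨g, fun s hs u hu v hv => ?_⟩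
  obtain ⟨p, hp, hpe⟩ := key s hs u hu v hv
  rw [hg v s hs hv (p 1) (by rw [hp]; funext x; simp [γ]),
    hg u s hs hu (p 0) (by rw [hp]; funext x; simp [γ])] at hpe
  have : ((g v - c u v : ℤ) : ℝ) = (g u : ℤ) := by push_cast; exact hpe
  have := Int.cast_injective this
  omega

end PreAbstractSimplicialComplex

/-! ### Indecomposable polygons are disks -/

namespace PreAbstractSimplicialComplex

variable {V : Type*} {K A B : PreAbstractSimplicialComplex V} {x : V}

theorem mem_sup_faces {s : Finset V} : s ∈ (A ⊔ B).faces ↔ s ∈ A.faces ∨ s ∈ B.faces := Iff.rfl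

theorem mem_verts_of_mem {s : Finset V} (hs : s ∈ K.faces) {v : V} (hv : v ∈ s) : v ∈ K.verts :=
  (K.isRelLowerSet_faces hs).2 (Finset.singleton_subset_iff.2 hv) (Finset.singleton_nonempty v)

theorem nonempty_of_mem {s : Finset V} (hs : s ∈ K.faces) : s.Nonempty := (K.isRelLowerSet_faces hs).1

theorem IsBoundaryWedge.symm (h : K.IsBoundaryWedge A B x) : K.IsBoundaryWedge B A x :=
  ⟨by rw [h.union, sup_comm], by rw [Set.inter_comm, h.inter], h.right, h.left⟩

theorem IsBoundaryWedge.mem_faces (h : K.IsBoundaryWedge A B x) {s : Finset V} :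
    s ∈ K.faces ↔ s ∈ A.faces ∨ s ∈ B.faces := by
  rw [h.union]; exact mem_sup_faces

theorem IsBoundaryWedge.eq_of_mem (h : K.IsBoundaryWedge A B x) {s t : Finset V} {v : V}
    (hs : s ∈ A.faces) (ht : t ∈ B.faces) (hvs : v ∈ s) (hvt : v ∈ t) : v = x := by
  have : v ∈ A.verts ∩ B.verts := ⟨mem_verts_of_mem hs hvs, mem_verts_of_mem ht hvt⟩
  rwa [h.inter] at this

theorem IsBoundaryWedge.trianglesAt_eq (h : K.IsBoundaryWedge A B x) {s : Finset V} {v : V}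
    (hs : s ∈ A.faces) (hv : v ∈ s) (hvx : v ≠ x) : K.trianglesAt s = A.trianglesAt s := by
  ext t
  constructor
  · rintro ⟨ht, h3, hst⟩
    rcases h.mem_faces.1 ht with ht | ht
    · exact ⟨ht, h3, hst⟩
    · exact absurd (h.eq_of_mem hs ht hv (hst hv)) hvx
  · rintro ⟨ht, h3, hst⟩
    exact ⟨h.mem_faces.2 (Or.inl ht), h3, hst⟩

theorem IsBoundaryWedge.isBoundaryEdge_iff (h : K.IsBoundaryWedge A B x) {e : Finset V}
    (he : e ∈ A.faces) (h2 : e.card = 2) : K.IsBoundaryEdge e ↔ A.IsBoundaryEdge e := by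
  obtain ⟨v, hv, hvx⟩ : ∃ v ∈ e, v ≠ x := Finset.exists_mem_ne (by omega) x
  unfold IsBoundaryEdge
  rw [h.trianglesAt_eq he hv hvx]
  simp [he, h2, h.mem_faces]

/-- Collapsing `B` to `x` retracts `K` onto `A`: the weights at the vertices of `A` other than `x`
are kept, and the remaining mass is put on `x`. -/
theorem IsBoundaryWedge.simplyConnected (h : K.IsBoundaryWedge A B x) (hfin : K.faces.Finite)
    [SimplyConnectedSpace K.realization] : SimplyConnectedSpace A.realization := by
  classical
  have hxA : {x} ∈ A.faces := by
    obtain ⟨e, he, hx⟩ := h.left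
    exact mem_verts_of_mem he.1 hx
  have hfinA : A.faces.Finite := hfin.subset fun s hs => h.mem_faces.2 (Or.inl hs)
  let F : Finset V := (hfinA.toFinset.biUnion id).erase x
  have hF : ∀ v, v ∈ F ↔ v ≠ x ∧ ∃ s ∈ A.faces, v ∈ s := by
    intro v
    simp [F]
  let r : (V → ℝ) → V → ℝ := fun w v =>
    if v = x then 1 - ∑ u ∈ F, w u else if v ∈ F then w v else 0
  have hrA : ∀ w ∈ A.realization, r w = w := by
    rintro w ⟨h0, s, hs, h1, h2⟩
    have hsum : ∑ u ∈ F, w u = 1 - w x := by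
      have e1 : ∑ u ∈ insert x F, w u = 1 := by
        rw [← h2]
        refine (Finset.sum_subset (fun v hv => ?_) fun v _ hv => h1 v hv).symm
        by_cases hvx : v = x
        · simp [hvx]
        · exact Finset.mem_insert_of_mem ((hF v).2 ⟨hvx, s, hs, hv⟩)
      rw [Finset.sum_insert (by simp [F])] at e1
      linarith
    funext v
    simp only [r]
    split_ifs with h3 h4
    · rw [hsum, h3]; ring
    · rfl
    · refine (h1 v fun hv => h4 ((hF v).2 ⟨h3, s, hs, hv⟩)).symm
  have hrB : ∀ w ∈ B.realization, r w = Pi.single x 1 := by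
    rintro w ⟨h0, s, hs, h1, h2⟩
    have hz : ∀ v ∈ F, w v = 0 := by
      intro v hv
      obtain ⟨hvx, t, ht, hvt⟩ := (hF v).1 hv
      exact h1 v fun hvs => hvx (h.eq_of_mem ht hs hvt hvs)
    funext v
    simp only [r]
    split_ifs with h3 h4
    · rw [Finset.sum_eq_zero hz, h3]; simp
    · rw [hz v h4, Pi.single_eq_of_ne h3]
    · rw [Pi.single_eq_of_ne h3]
  have hmem : ∀ w ∈ K.realization, r w ∈ A.realization := by
    rintro w ⟨h0, s, hs, h1, h2⟩
    rcases h.mem_faces.1 hs with hs | hs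
    · have hw : w ∈ A.realization := ⟨h0, s, hs, h1, h2⟩
      rwa [hrA w hw]
    · rw [hrB w ⟨h0, s, hs, h1, h2⟩]
      refine ⟨fun v => ?_, {x}, hxA, fun v hv => ?_, by simp⟩
      · by_cases hv : v = x
        · subst hv; simp
        · rw [Pi.single_eq_of_ne hv]
      · exact Pi.single_eq_of_ne (by simpa using hv) _
  have hcont : Continuous fun w : K.realization => r w.1 := by
    have hv : ∀ v, Continuous fun w : K.realization => w.1 v := fun v =>
      (continuous_apply v).comp continuous_subtype_val
    refine continuous_pi fun v => ?_
    simp only [r]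
    split_ifs with h3 h4
    · exact continuous_const.sub (continuous_finsetSum _ fun u _ => hv u)
    · exact hv v
    · exact continuous_const
  have hincl : ∀ w ∈ A.realization, w ∈ K.realization := by
    rintro w ⟨h0, s, hs, h1, h2⟩
    exact ⟨h0, s, h.mem_faces.2 (Or.inl hs), h1, h2⟩
  let i : C(A.realization, K.realization) :=
    ⟨fun w => ⟨w.1, hincl w.1 w.2⟩, continuous_subtype_val.subtype_mk _⟩
  let r' : C(K.realization, A.realization) :=
    ⟨fun w => ⟨r w.1, hmem w.1 w.2⟩, hcont.subtype_mk _⟩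
  exact SimplyConnectedSpace.of_retract i r' fun w => Subtype.ext (hrA w.1 w.2)

theorem IsWedgeOfDisks.cases_disk (h : K.IsWedgeOfDisks) :
    Nonempty (K.realization ≃ₜ Metric.closedBall (0 : EuclideanSpace ℝ (Fin 2)) 1) ∨
      ∃ A B x, IsWedgeOfDisks A ∧ IsWedgeOfDisks B ∧ K.IsBoundaryWedge A B x := by
  cases h with
  | disk _ h => exact Or.inl h
  | wedge _ A B x hA hB h => exact Or.inr ⟨A, B, x, hA, hB, h⟩

end PreAbstractSimplicialComplex

namespace GridPolygon

open PreAbstractSimplicialComplex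

variable {V : Type*}

/-- The summands of a wedge decomposition of the complex are generalized grid polygons. -/
def ofWedge (P : GridPolygon V) {A B : PreAbstractSimplicialComplex V} {x : V}
    (h : P.complex.IsBoundaryWedge A B x) (hA : A.IsWedgeOfDisks) : GridPolygon V where
  complex := A
  f := P.f
  finite := P.finite.subset fun _ hs => h.mem_faces.2 (Or.inl hs)
  simplyConnected := by
    have := P.simplyConnected
    exact h.simplyConnected P.finite
  homogeneous := by
    intro s hs
    by_cases hsx : ∃ v ∈ s, v ≠ x
    · obtain ⟨v, hv, hvx⟩ := hsx
      obtain ⟨t, ht, h3, hst⟩ := P.homogeneous s (h.mem_faces.2 (Or.inl hs))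
      have : t ∈ P.complex.trianglesAt s := ⟨ht, h3, hst⟩
      rw [h.trianglesAt_eq hs hv hvx] at this
      exact ⟨t, this⟩
    · push Not at hsx
      obtain ⟨e, ⟨-, -, t, ht, -⟩, hxe⟩ := h.left
      refine ⟨t, ht.1, ht.2.1, fun v hv => ?_⟩
      rw [hsx v hv]
      exact ht.2.2 hxe
  wedgeOfDisks := hA
  map_simplex := fun s hs => P.map_simplex s (h.mem_faces.2 (Or.inl hs))
  six_triangles := by
    intro v hv hvb
    have hvx : v ≠ x := by
      rintro rfl
      exact hvb h.left
    rw [← h.trianglesAt_eq hv (Finset.mem_singleton_self v) hvx]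
    refine P.six_triangles v (h.mem_faces.2 (Or.inl hv)) ?_
    rintro ⟨e, he, hve⟩
    rcases h.mem_faces.1 he.1 with heA | heB
    · exact hvb ⟨e, (h.isBoundaryEdge_iff heA he.2.1).1 he, hve⟩
    · exact hvx (h.eq_of_mem hv heB (Finset.mem_singleton_self v) hve)
  diamond := by
    intro e he h2 hb
    obtain ⟨v, hv, hvx⟩ : ∃ v ∈ e, v ≠ x := Finset.exists_mem_ne (by omega) x
    rw [← h.isBoundaryEdge_iff he h2] at hb
    rw [← h.trianglesAt_eq he hv hvx]
    exact P.diamond e (h.mem_faces.2 (Or.inl he)) h2 hb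

theorem Indecomposable.exists_disk {P : GridPolygon V} (hP : P.Indecomposable) :
    Nonempty (P.complex.realization ≃ₜ Metric.closedBall (0 : EuclideanSpace ℝ (Fin 2)) 1) := by
  rcases P.wedgeOfDisks.cases_disk with h | ⟨A, B, x, hA, hB, h⟩
  · exact h
  · exact absurd ⟨P.ofWedge h hA, P.ofWedge h.symm hB, x, h, fun _ _ => rfl,
      fun w _ => (sub_add_cancel (P.f w) (P.f x)).symm⟩ hP

end GridPolygon

/-! ### The triangulated surface of a generalized grid polygon -/

/-- The barycentric coordinates of a grid point, up to a constant. They add up to zero. -/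
def gridCoord (p : ℤ × ℤ) : Fin 3 → ℤ := ![-p.1, -p.2, p.1 + p.2]

theorem gridCoord_injective : Function.Injective gridCoord := by
  intro p q h
  have h0 := congrFun h 0
  have h1 := congrFun h 1
  simp only [gridCoord, Matrix.cons_val_zero, Matrix.cons_val_one] at h0 h1
  exact Prod.ext (neg_injective h0) (neg_injective h1)

/-- Two grid triangles with a common side coincide or are reflections of each other. -/
theorem reflect_of_common_side {B B' : Fin 3 → ℤ} {e e' : ℤ} (he : e = 1 ∨ e = -1)
    (he' : e' = 1 ∨ e' = -1) {a b a' b' : Fin 3} (hab : a ≠ b)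
    (ha : ∀ i, B i - (if i = a then e else 0) = B' i - if i = a' then e' else 0)
    (hb : ∀ i, B i - (if i = b then e else 0) = B' i - if i = b' then e' else 0) :
    e' = e ∧ B' = B ∨ e' = -e ∧ a' = b ∧ b' = a := by
  by_cases hee : e' = e
  · subst hee
    have hba : a' = a := by
      by_contra h
      have h1 := ha a
      have h2 := hb a
      have h3 := ha a'
      have h4 := hb a'
      simp only [if_true, if_neg hab, if_neg h, if_neg (Ne.symm h)] at h1 h2 h3 h4
      clear ha hb
      split_ifs at h2 h4 <;> omega
    subst hba
    exact Or.inl ⟨rfl, funext fun i => by have := ha i; omega⟩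
  · have hee' : e' = -e := by omega
    subst hee'
    refine Or.inr ⟨rfl, ?_⟩
    have h0 := ha 0
    have h1 := ha 1
    have h2 := ha 2
    have g0 := hb 0
    have g1 := hb 1
    have g2 := hb 2
    clear ha hb he' hee
    fin_cases a <;> fin_cases b <;> fin_cases a' <;> fin_cases b' <;> simp at * <;> omega

/-- The vertices of a grid triangle are indexed in such a way that the sides with the same index are
parallel. -/
theorem exists_grid_param {τ : Finset (ℤ × ℤ)} (h : (∃ p, τ = upTri p) ∨ ∃ p, τ = downTri p) :
    ∃ (e : ℤ) (b : Fin 3 → ℤ) (w : Fin 3 → ℤ × ℤ),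
      (e = 1 ∧ (∃ p, τ = upTri p) ∨ e = -1 ∧ ∃ p, τ = downTri p) ∧ (∀ u, u ∈ τ ↔ ∃ j, w j = u) ∧
      ∀ i j, gridCoord (w j) i = b i - if i = j then e else 0 := by
  rcases h with ⟨p, rfl⟩ | ⟨p, rfl⟩
  · refine ⟨1, ![-p.1, -p.2, p.1 + p.2 + 1], ![p + (1, 0), p + (0, 1), p], Or.inl ⟨rfl, p, rfl⟩,
      fun u => ?_, fun i j => ?_⟩
    · simp [upTri, Fin.exists_fin_succ, eq_comm]; tauto
    · fin_cases i <;> fin_cases j <;> simp [gridCoord] <;> ring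
  · refine ⟨-1, ![-p.1 - 1, -p.2, p.1 + p.2], ![p, p + (1, -1), p + (1, 0)], Or.inr ⟨rfl, p, rfl⟩,
      fun u => ?_, fun i j => ?_⟩
    · simp [downTri, Fin.exists_fin_succ, eq_comm]; tauto
    · fin_cases i <;> fin_cases j <;> simp [gridCoord] <;> ring

namespace GridPolygon

variable {V : Type*} (P : GridPolygon V)

/-- The `2`-simplices. -/
abbrev Tri : Type _ := {t : Finset V // t ∈ P.complex.faces ∧ t.card = 3}

variable {P}

theorem exists_param (t : P.Tri) : ∃ (e : ℤ) (b : Fin 3 → ℤ) (v : Fin 3 → V),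
    (e = 1 ∧ P.IsUp t.1 ∨ e = -1 ∧ P.IsDown t.1) ∧ (∀ u, u ∈ t.1 ↔ ∃ j, v j = u) ∧
      ∀ i j, gridCoord (P.f (v j)) i = b i - if i = j then e else 0 := by
  have hinj : Set.InjOn P.f t.1 := by
    rw [← Finset.card_image_iff]; exact (P.map_simplex t.1 t.2.1).2
  obtain ⟨e, b, w, he, hw, hb⟩ := exists_grid_param (P.image_tri t.2.1 t.2.2)
  have hv : ∀ j, ∃ u ∈ t.1, P.f u = w j := fun j => Finset.mem_image.1 ((hw _).2 ⟨j, rfl⟩)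
  choose v hv hvw using hv
  refine ⟨e, b, v, he, fun u => ⟨fun hu => ?_, ?_⟩, fun i j => ?_⟩
  · obtain ⟨j, hj⟩ := (hw (P.f u)).1 (Finset.mem_image_of_mem _ hu)
    exact ⟨j, hinj (hv j) hu ((hvw j).trans hj)⟩
  · rintro ⟨j, rfl⟩
    exact hv j
  · rw [hvw, hb]

/-- The sign of a `2`-simplex: `1` if its image points upwards, and `-1` otherwise. -/
noncomputable def sgn (t : P.Tri) : ℤ := (exists_param t).choose

/-- The coordinates of the sides of the image of a `2`-simplex. -/
noncomputable def base (t : P.Tri) : Fin 3 → ℤ := (exists_param t).choose_spec.choose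

/-- The vertices of a `2`-simplex, indexed in the same way for all upward and, reflected, for all
downward triangles. -/
noncomputable def vert (t : P.Tri) : Fin 3 → V := (exists_param t).choose_spec.choose_spec.choose

theorem sgn_spec (t : P.Tri) : sgn t = 1 ∧ P.IsUp t.1 ∨ sgn t = -1 ∧ P.IsDown t.1 :=
  (exists_param t).choose_spec.choose_spec.choose_spec.1

theorem mem_tri {t : P.Tri} {u : V} : u ∈ t.1 ↔ ∃ j, vert t j = u :=
  (exists_param t).choose_spec.choose_spec.choose_spec.2.1 u

theorem coord_vert (t : P.Tri) (i j : Fin 3) :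
    gridCoord (P.f (vert t j)) i = base t i - if i = j then sgn t else 0 :=
  (exists_param t).choose_spec.choose_spec.choose_spec.2.2 i j

theorem sgn_eq (t : P.Tri) : sgn t = 1 ∨ sgn t = -1 := (sgn_spec t).imp And.left And.left

theorem vert_mem (t : P.Tri) (j : Fin 3) : vert t j ∈ t.1 := mem_tri.2 ⟨j, rfl⟩

theorem vert_injective (t : P.Tri) : Function.Injective (vert t) := by
  intro j k h
  by_contra hjk
  have h1 := coord_vert t j j
  have h2 := coord_vert t j k
  rw [h, h2, if_pos rfl, if_neg hjk] at h1
  rcases sgn_eq t with h | h <;> omega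

theorem eq_of_base_eq {t t' : P.Tri} (hs : sgn t' = sgn t) (hb : base t' = base t) (j : Fin 3) :
    P.f (vert t' j) = P.f (vert t j) := by
  apply gridCoord_injective
  ext i
  rw [coord_vert, coord_vert, hs, hb]

/-- The increment along the side from the vertex `a` to the vertex `b` of a cochain given on sides. -/
noncomputable def increment (h : P.Tri → Fin 3 → ℤ) (t : P.Tri) (a b : Fin 3) : ℤ :=
  if a = b then 0 else if b = a + 1 then sgn t * h t (a + 2) else -(sgn t * h t (a + 1))

theorem increment_add {h : P.Tri → Fin 3 → ℤ} {t : P.Tri} (hz : h t 0 + h t 1 + h t 2 = 0)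
    (a b c : Fin 3) : increment h t a b + increment h t b c = increment h t a c := by
  have h2 : h t 2 = - h t 0 - h t 1 := by omega
  fin_cases a <;> fin_cases b <;> fin_cases c <;> simp [increment, h2] <;> ring

theorem exists_tri_of_mem {s : Finset V} (hs : s ∈ P.complex.faces) : ∃ t : P.Tri, s ⊆ t.1 := by
  obtain ⟨t, ht, h3, hst⟩ := P.homogeneous s hs
  exact ⟨⟨t, ht, h3⟩, hst⟩

variable [DecidableEq V]

/-- The side `j` of a `2`-simplex is opposite to the vertex `j`. -/
noncomputable def side (t : P.Tri) (j : Fin 3) : Finset V := t.1.erase (vert t j)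

theorem mem_side {t : P.Tri} {j : Fin 3} {u : V} : u ∈ side t j ↔ ∃ k, k ≠ j ∧ vert t k = u := by
  rw [side, Finset.mem_erase, mem_tri]
  constructor
  · rintro ⟨h, k, rfl⟩
    exact ⟨k, fun hk => h (hk ▸ rfl), rfl⟩
  · rintro ⟨k, hk, rfl⟩
    exact ⟨fun h => hk (vert_injective t h), k, rfl⟩

theorem side_subset (t : P.Tri) (j : Fin 3) : side t j ⊆ t.1 := Finset.erase_subset _ _

theorem side_card (t : P.Tri) (j : Fin 3) : (side t j).card = 2 := by
  rw [side, Finset.card_erase_of_mem (vert_mem t j), t.2.2]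

theorem side_mem_trianglesAt (t : P.Tri) (j : Fin 3) : t.1 ∈ P.complex.trianglesAt (side t j) :=
  ⟨t.2.1, t.2.2, side_subset t j⟩

theorem side_mem_faces (t : P.Tri) (j : Fin 3) : side t j ∈ P.complex.faces :=
  P.mem_faces_of_trianglesAt (side_mem_trianglesAt t j) (side_card t j)

theorem side_injective (t : P.Tri) : Function.Injective (side t) := by
  intro j k h
  by_contra hjk
  have : vert t k ∈ side t j := mem_side.2 ⟨k, Ne.symm hjk, rfl⟩
  rw [h] at this
  obtain ⟨l, hl, hl'⟩ := mem_side.1 this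
  exact hl (vert_injective t hl')

theorem exists_side {t : P.Tri} {e : Finset V} (he : e ⊆ t.1) (h2 : e.card = 2) :
    ∃ j, e = side t j := by
  have h1 : (t.1 \ e).card = 1 := by rw [Finset.card_sdiff_of_subset he, t.2.2, h2]
  obtain ⟨u, hu⟩ := Finset.card_eq_one.1 h1
  have hu' : u ∈ t.1 \ e := hu ▸ Finset.mem_singleton_self u
  obtain ⟨j, rfl⟩ := mem_tri.1 (Finset.mem_sdiff.1 hu').1
  refine ⟨j, Finset.eq_of_subset_of_card_le (fun v hv => ?_) (by rw [side_card, h2])⟩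
  refine Finset.mem_erase.2 ⟨?_, he hv⟩
  rintro rfl
  exact (Finset.mem_sdiff.1 hu').2 hv

theorem exists_neighbor (t : P.Tri) (j : Fin 3) : ∃ t' : P.Tri,
    (P.complex.IsBoundaryEdge (side t j) → t' = t) ∧
      (¬ P.complex.IsBoundaryEdge (side t j) → t' ≠ t ∧ side t j ⊆ t'.1) := by
  by_cases h : P.complex.IsBoundaryEdge (side t j)
  · exact ⟨t, fun _ => rfl, fun h' => absurd h h'⟩
  · obtain ⟨t', ht', hne⟩ := P.exists_other (side_card t j) h (side_mem_trianglesAt t j)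
    exact ⟨⟨t', ht'.1, ht'.2.1⟩, fun h' => absurd h' h,
      fun _ => ⟨fun h' => hne (congrArg Subtype.val h'), ht'.2.2⟩⟩

/-- The neighbor of a `2`-simplex across a side, and the simplex itself at the boundary. -/
noncomputable def neighbor (t : P.Tri) (j : Fin 3) : P.Tri := (exists_neighbor t j).choose

theorem neighbor_eq_iff {t : P.Tri} {j : Fin 3} :
    neighbor t j = t ↔ P.complex.IsBoundaryEdge (side t j) := by
  constructor
  · intro h
    by_contra hb
    exact ((exists_neighbor t j).choose_spec.2 hb).1 h
  · exact (exists_neighbor t j).choose_spec.1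

theorem side_subset_neighbor (t : P.Tri) (j : Fin 3) : side t j ⊆ (neighbor t j).1 := by
  by_cases h : P.complex.IsBoundaryEdge (side t j)
  · rw [neighbor_eq_iff.2 h]; exact side_subset t j
  · exact ((exists_neighbor t j).choose_spec.2 h).2

theorem not_isBoundaryEdge {t t' : P.Tri} {j : Fin 3} (hne : t' ≠ t) (h : side t j ⊆ t'.1) :
    ¬ P.complex.IsBoundaryEdge (side t j) := by
  rintro ⟨-, -, hu⟩
  exact hne (Subtype.ext (hu.unique ⟨t'.2.1, t'.2.2, h⟩ (side_mem_trianglesAt t j)))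

theorem neighbor_eq {t t' : P.Tri} {j : Fin 3} (hne : t' ≠ t) (h : side t j ⊆ t'.1) :
    neighbor t j = t' := by
  have hb := not_isBoundaryEdge hne h
  have hn : neighbor t j ≠ t := fun h' => hb (neighbor_eq_iff.1 h')
  exact Subtype.ext (P.other_unique (side_card t j) hb (side_mem_trianglesAt t j)
    ⟨(neighbor t j).2.1, (neighbor t j).2.2, side_subset_neighbor t j⟩ ⟨t'.2.1, t'.2.2, h⟩
    (fun h' => hn (Subtype.ext h')) fun h' => hne (Subtype.ext h'))

/-- Grid triangles over a common side coincide or are mirror images; `diamond` rules out that the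
surface is folded along the side. -/
theorem sgn_vert_of_side_subset {t t' : P.Tri} {i j k : Fin 3} (hne : t' ≠ t)
    (h : side t j ⊆ t'.1) (hi : i ≠ j) (hk : k ≠ j) (hik : i ≠ k) :
    sgn t' = -sgn t ∧ vert t' i = vert t k := by
  obtain ⟨a, ha⟩ := mem_tri.1 (h (mem_side.2 ⟨k, hk, rfl⟩))
  obtain ⟨b, hb⟩ := mem_tri.1 (h (mem_side.2 ⟨i, hi, rfl⟩))
  rcases reflect_of_common_side (sgn_eq t) (sgn_eq t') hik.symm
    (fun l => by rw [← coord_vert, ← coord_vert, ha] : ∀ l, base t l - (if l = k then sgn t else 0) =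
      base t' l - if l = a then sgn t' else 0)
    (fun l => by rw [← coord_vert, ← coord_vert, hb] : ∀ l, base t l - (if l = i then sgn t else 0) =
      base t' l - if l = b then sgn t' else 0) with ⟨h1, h2⟩ | ⟨h1, rfl, -⟩
  · have himg : t'.1.image P.f = t.1.image P.f := by
      ext p
      simp only [Finset.mem_image, mem_tri]
      constructor
      · rintro ⟨_, ⟨l, rfl⟩, rfl⟩
        exact ⟨_, ⟨l, rfl⟩, (eq_of_base_eq h1 h2 l).symm⟩
      · rintro ⟨_, ⟨l, rfl⟩, rfl⟩
        exact ⟨_, ⟨l, rfl⟩, eq_of_base_eq h1 h2 l⟩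
    obtain ⟨t₁, t₂, -, h12, hd, -⟩ :=
      P.diamond _ (side_mem_faces t j) (side_card t j) (not_isBoundaryEdge hne h)
    have m1 := side_mem_trianglesAt t j
    have m2 : t'.1 ∈ P.complex.trianglesAt (side t j) := ⟨t'.2.1, t'.2.2, h⟩
    have hne' : t'.1 ≠ t.1 := fun h => hne (Subtype.ext h)
    rw [h12] at m1 m2
    rcases m1 with m1 | m1 <;> rcases m2 with m2 | m2
    · exact absurd (m2.trans m1.symm) hne'
    · rw [Set.mem_singleton_iff] at m2
      rw [m1, m2] at himg
      exact absurd himg.symm hd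
    · rw [Set.mem_singleton_iff] at m1
      rw [m1, m2] at himg
      exact absurd himg hd
    · exact absurd (m2.trans m1.symm) hne'
  · exact ⟨h1, ha⟩

theorem sgn_neighbor {t : P.Tri} {j : Fin 3} (h : neighbor t j ≠ t) :
    sgn (neighbor t j) = -sgn t :=
  (sgn_vert_of_side_subset h (side_subset_neighbor t j) (Fin.add_one_ne_self₃ j)
    (Fin.add_two_ne_self₃ j) (Fin.add_one_ne_add_two₃ j)).1

theorem vert_neighbor {t : P.Tri} {i j k : Fin 3} (h : neighbor t j ≠ t) (hi : i ≠ j) (hk : k ≠ j)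
    (hik : i ≠ k) : vert (neighbor t j) i = vert t k :=
  (sgn_vert_of_side_subset h (side_subset_neighbor t j) hi hk hik).2

theorem side_neighbor (t : P.Tri) (j : Fin 3) : side (neighbor t j) j = side t j := by
  by_cases h : neighbor t j = t
  · rw [h]
  · refine Finset.eq_of_subset_of_card_le (fun u hu => ?_) (by rw [side_card, side_card])
    obtain ⟨i, hi, rfl⟩ := mem_side.1 hu
    obtain ⟨k, hki, hkj⟩ := Fin.exists_third i j
    exact mem_side.2 ⟨k, hkj, (vert_neighbor h hi hkj hki.symm).symm⟩

theorem neighbor_neighbor (t : P.Tri) (j : Fin 3) : neighbor (neighbor t j) j = t := by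
  by_cases h : neighbor t j = t
  · rw [h, h]
  · refine neighbor_eq (Ne.symm h) ?_
    rw [side_neighbor]
    exact side_subset t j

theorem exists_neighbor_eq_of_isBoundaryVertex {v : V} (hv : P.complex.IsBoundaryVertex v) :
    ∃ (s : P.Tri) (j k : Fin 3), neighbor s j = s ∧ k ≠ j ∧ vert s k = v := by
  obtain ⟨e, he, hve⟩ := hv
  obtain ⟨s, hs, -⟩ := he.2.2
  obtain ⟨j, hj⟩ := exists_side (t := (⟨s, hs.1, hs.2.1⟩ : P.Tri)) hs.2.2 he.2.1
  rw [hj] at he hve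
  obtain ⟨k, hk, hkv⟩ := mem_side.1 hve
  exact ⟨_, j, k, neighbor_eq_iff.2 he, hk, hkv⟩

/-- Rotation about an interior vertex realizes all six pairs of sign and position, by different
triangles. By `six_triangles` there are no others, so each pair occurs only once. -/
theorem eq_of_sgn_eq {t t' : P.Tri} {i : Fin 3}
    (hi : ∀ (s : P.Tri) j k, neighbor s j = s → k ≠ j → vert s k ≠ vert t i)
    (hv : vert t' i = vert t i) (hs : sgn t' = sgn t) : t' = t := by
  have hb : ¬ P.complex.IsBoundaryVertex (vert t i) := fun h => by
    obtain ⟨s, j, k, h1, h2, h3⟩ := exists_neighbor_eq_of_isBoundaryVertex h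
    exact hi s j k h1 h2 h3
  have hmem : {vert t i} ∈ P.complex.faces :=
    PreAbstractSimplicialComplex.mem_verts_of_mem t.2.1 (vert_mem t i)
  have h6 := P.six_triangles _ hmem hb
  have hG : ∀ p : Bool × Fin 3, ∃ s : P.Tri, sgn s = (if p.1 then 1 else -1) ∧
      vert s p.2 = vert t i := fun p =>
    exists_rotation (sgn := sgn) (vert := vert) (nb := neighbor) sgn_eq
      (fun t j => sgn_neighbor) (fun t j i k => vert_neighbor)
      (fun s j k hk hs h => hi s j k h hk hs) (rfl : vert t i = _) (by split_ifs <;> simp) p.2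
  choose G hG1 hG2 using hG
  have hinj : Function.Injective fun p => (G p).1 := by
    intro p q h
    have h' : G p = G q := Subtype.ext h
    have h1 := hG1 p
    have h2 := hG2 p
    rw [h', hG1 q] at h1
    rw [h', ← hG2 q] at h2
    refine Prod.ext ?_ (vert_injective _ h2)
    revert h1
    cases p.1 <;> cases q.1 <;> simp
  have hrange : Set.range (fun p => (G p).1) = P.complex.trianglesAt {vert t i} := by
    refine Set.eq_of_subset_of_ncard_le ?_ ?_ (P.finite.subset fun _ h => h.1)
    · rintro _ ⟨p, rfl⟩
      refine ⟨(G p).2.1, (G p).2.2, ?_⟩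
      rw [Finset.singleton_subset_iff, ← hG2 p]
      exact vert_mem _ _
    · rw [h6, ← Nat.card_coe_set_eq, Nat.card_range_of_injective hinj]
      simp
  have key : ∀ s : P.Tri, vert s i = vert t i → s = G (decide (sgn s = 1), i) := by
    intro s hs
    have : s.1 ∈ P.complex.trianglesAt {vert t i} := by
      refine ⟨s.2.1, s.2.2, ?_⟩
      rw [Finset.singleton_subset_iff, ← hs]
      exact vert_mem _ _
    rw [← hrange] at this
    obtain ⟨p, hp⟩ := this
    have hp' : G p = s := Subtype.ext hp
    have h1 := hG1 p
    have h2 := hG2 p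
    rw [hp'] at h1 h2
    rw [← hs] at h2
    have h3 : p.2 = i := vert_injective s h2
    have h4 : decide (sgn s = 1) = p.1 := by
      rw [h1]; cases p.1 <;> simp
    rw [h4, ← h3]
    exact hp'.symm
  rw [key t' hv, key t rfl, hs]

/-- Increments thus depend only on the two endpoints. Two different triangles containing both are
neighbors across that side; they have opposite signs and exchanged positions, and the two changes
cancel. -/
theorem increment_congr {h : P.Tri → Fin 3 → ℤ} (hc : ∀ t j, h (neighbor t j) j = h t j)
    {t t' : P.Tri} {a b a' b' : Fin 3} (ha : vert t a = vert t' a') (hb : vert t b = vert t' b') :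
    increment h t a b = increment h t' a' b' := by
  by_cases htt : t' = t
  · subst htt
    rw [vert_injective _ ha, vert_injective _ hb]
  by_cases hab : a = b
  · subst hab
    rw [ha] at hb
    rw [vert_injective _ hb]
    simp [increment]
  · obtain ⟨j, hja, hjb⟩ := Fin.exists_third a b
    have hsub : side t j ⊆ t'.1 := by
      intro u hu
      obtain ⟨k, hk, rfl⟩ := mem_side.1 hu
      rcases Fin.eq_third hab hja.symm hjb.symm (l := k) with rfl | rfl | rfl
      · rw [ha]; exact vert_mem _ _
      · rw [hb]; exact vert_mem _ _
      · exact absurd rfl hk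
    obtain ⟨hs, h1⟩ := sgn_vert_of_side_subset htt hsub hja.symm hjb.symm hab
    obtain ⟨-, h2⟩ := sgn_vert_of_side_subset htt hsub hjb.symm hja.symm (Ne.symm hab)
    rw [← h1] at hb
    rw [← h2] at ha
    obtain rfl := vert_injective _ hb
    obtain rfl := vert_injective _ ha
    have hj : h t' j = h t j := by rw [← hc t j, neighbor_eq htt hsub]
    have : (b = a + 1 ∧ ¬ a = b + 1 ∧ j = a + 2 ∧ j = b + 1) ∨
        (¬ b = a + 1 ∧ a = b + 1 ∧ j = a + 1 ∧ j = b + 2) := by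
      clear hsub h1 h2 ha hb hj
      revert a b j; decide
    unfold increment
    rw [if_neg hab, if_neg (Ne.symm hab)]
    rcases this with ⟨h3, h4, h5, h6⟩ | ⟨h3, h4, h5, h6⟩
    · rw [if_pos h3, if_neg h4, ← h5, ← h6, hj, hs]; ring
    · rw [if_neg h3, if_pos h4, ← h5, ← h6, hj, hs]; ring

/-- The increments form a 1-cocycle on pairs of vertices: they are well defined by
`increment_congr`, and additive on each triangle because of `hz`. -/
theorem exists_cochain_potential
    (disk : P.complex.realization ≃ₜ Metric.closedBall (0 : EuclideanSpace ℝ (Fin 2)) 1)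
    (h : P.Tri → Fin 3 → ℤ) (hc : ∀ t j, h (neighbor t j) j = h t j)
    (hz : ∀ t, h t 0 + h t 1 + h t 2 = 0) :
    ∃ g : V → ℤ, ∀ t j, g (vert t (j + 2)) - g (vert t (j + 1)) = sgn t * h t j := by
  classical
  let c : V → V → ℤ := fun u v =>
    if H : ∃ (t : P.Tri) (a b : Fin 3), vert t a = u ∧ vert t b = v then
      increment h H.choose H.choose_spec.choose H.choose_spec.choose_spec.choose else 0
  have hcv : ∀ t a b, c (vert t a) (vert t b) = increment h t a b := by
    intro t a b
    have H : ∃ (t' : P.Tri) (a' b' : Fin 3), vert t' a' = vert t a ∧ vert t' b' = vert t b :=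
      ⟨t, a, b, rfl, rfl⟩
    simp only [c]
    rw [dif_pos H]
    exact increment_congr hc H.choose_spec.choose_spec.choose_spec.1
      H.choose_spec.choose_spec.choose_spec.2
  obtain ⟨g, hg⟩ := PreAbstractSimplicialComplex.exists_potential P.finite disk c (by
    intro s hs u hu v hv w hw
    obtain ⟨t, hst⟩ := exists_tri_of_mem hs
    obtain ⟨i, rfl⟩ := mem_tri.1 (hst hu)
    obtain ⟨j, rfl⟩ := mem_tri.1 (hst hv)
    obtain ⟨k, rfl⟩ := mem_tri.1 (hst hw)
    rw [hcv, hcv, hcv, increment_add (hz t)])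
  refine ⟨g, fun t j => ?_⟩
  rw [← hg t.1 t.2.1 _ (vert_mem t _) _ (vert_mem t _), hcv]
  unfold increment
  rw [if_neg (Fin.add_one_ne_add_two₃ j), if_pos (by rw [add_assoc]; rfl)]
  congr 2
  rw [add_assoc]
  exact add_zero j

theorem eq_univ_of_neighbor_mem
    (disk : P.complex.realization ≃ₜ Metric.closedBall (0 : EuclideanSpace ℝ (Fin 2)) 1)
    (S : Set P.Tri) (hne : S.Nonempty) (hS : ∀ t ∈ S, ∀ j, neighbor t j ∈ S) : S = Set.univ := by
  have := PreAbstractSimplicialComplex.triangles_connected P.finite disk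
    (fun s hs => (P.homogeneous s hs)) {s | ∃ h, (⟨s, h⟩ : P.Tri) ∈ S}
    (fun t ⟨h, _⟩ => h) (hne.elim fun t ht => ⟨t.1, t.2, ht⟩) (by
      rintro t ⟨h, ht⟩ t' ht' h3 hcard
      obtain ⟨j, hj⟩ := exists_side (t := (⟨t, h⟩ : P.Tri)) Finset.inter_subset_left hcard
      by_cases htt : t' = t
      · subst htt; exact ⟨h, ht⟩
      · have := neighbor_eq (t := (⟨t, h⟩ : P.Tri)) (t' := ⟨t', ht', h3⟩) (j := j)
          (fun h' => htt (congrArg Subtype.val h')) (by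
            rw [← hj]; exact Finset.inter_subset_right)
        exact ⟨⟨ht', h3⟩, this ▸ hS _ ht j⟩)
  ext t
  simp only [Set.mem_univ, iff_true]
  obtain ⟨_, ht⟩ := this t.1 t.2.1 t.2.2
  exact ht

/-- The triangulated surface of a generalized grid polygon whose realization is a disk. -/
noncomputable def surface
    (disk : P.complex.realization ≃ₜ Metric.closedBall (0 : EuclideanSpace ℝ (Fin 2)) 1) :
    TriSurface P.Tri V where
  sgn := sgn
  sgn_eq := sgn_eq
  vert := vert
  x v := gridCoord (P.f v)
  base := base
  x_vert := coord_vert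
  x_sum t j := by simp [gridCoord]; ring
  nb := neighbor
  nb_nb := neighbor_neighbor
  sgn_nb _ _ := sgn_neighbor
  vert_nb _ _ _ _ := vert_neighbor
  star_unique _ _ _ := eq_of_sgn_eq
  connected := eq_univ_of_neighbor_mem disk
  potential := exists_cochain_potential disk

end GridPolygon

/-! ### The unit triangle -/

namespace GridPolygon

open TriSurface

variable {V : Type*} {P : GridPolygon V}

theorem mem_verts_tri {v : V} (hv : v ∈ P.complex.verts) : ∃ t : P.Tri, v ∈ t.1 := by
  obtain ⟨t, ht⟩ := exists_tri_of_mem hv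
  exact ⟨t, ht (Finset.mem_singleton_self v)⟩

theorem mem_map_faces {s : Finset (ℤ × ℤ)} :
    s ∈ (P.complex.map P.f).faces ↔ s.Nonempty ∧ ∃ t : P.Tri, s ⊆ t.1.image P.f := by
  constructor
  · rintro ⟨u, hu, rfl⟩
    obtain ⟨t, ht⟩ := exists_tri_of_mem hu
    exact ⟨(PreAbstractSimplicialComplex.nonempty_of_mem hu).image _, t,
      Finset.image_subset_image ht⟩
  · rintro ⟨hs, t, hst⟩
    obtain ⟨u, hu, rfl⟩ := Finset.subset_image_iff.1 hst
    exact ⟨u, (P.complex.isRelLowerSet_faces t.2.1).2 hu (Finset.image_nonempty.1 hs), rfl⟩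

theorem isUnitTriangle_of_forall_eq {t : P.Tri} (h : ∀ t', t' = t) : P.IsUnitTriangle := by
  refine ⟨fun u hu w hw huw => ?_, t.1.image P.f, (P.map_simplex t.1 t.2.1).1,
    (P.map_simplex t.1 t.2.1).2.trans t.2.2, ?_⟩
  · obtain ⟨t₁, hu⟩ := mem_verts_tri hu
    obtain ⟨t₂, hw⟩ := mem_verts_tri hw
    rw [h t₁] at hu
    rw [h t₂] at hw
    exact Finset.card_image_iff.1 (P.map_simplex t.1 t.2.1).2 hu hw huw
  · ext s
    rw [mem_map_faces]
    exact and_congr_right fun _ => ⟨fun ⟨t', h'⟩ => h t' ▸ h', fun h' => ⟨t, h'⟩⟩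

/-! ### Beams in a generalized grid polygon and in its surface -/

variable [DecidableEq V]

/-- Lowering the label by one means raising the index of the side by one; this links `Crosses` to
`entryIdx` and `exitIdx`. -/
theorem hasLabel_side (t : P.Tri) (j : Fin 3) : P.HasLabel (side t j) (2 - j) := by
  have himg : (side t j).image P.f = {P.f (vert t (j + 1)), P.f (vert t (j + 2))} := by
    have : side t j = {vert t (j + 1), vert t (j + 2)} := by
      ext u
      rw [mem_side, Finset.mem_insert, Finset.mem_singleton]
      constructor
      · rintro ⟨k, hk, rfl⟩
        have : k = j + 1 ∨ k = j + 2 := by revert k j; decide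
        rcases this with rfl | rfl <;> simp
      · rintro (rfl | rfl)
        exacts [⟨_, Fin.add_one_ne_self₃ j, rfl⟩, ⟨_, Fin.add_two_ne_self₃ j, rfl⟩]
    rw [this, Finset.image_insert, Finset.image_singleton]
  have key : P.f (vert t (j + 1)) = P.f (vert t (j + 2)) + paneDir (2 - j) ∨
      P.f (vert t (j + 2)) = P.f (vert t (j + 1)) + paneDir (2 - j) := by
    have a0 := coord_vert t 0 (j + 1)
    have a1 := coord_vert t 1 (j + 1)
    have b0 := coord_vert t 0 (j + 2)
    have b1 := coord_vert t 1 (j + 2)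
    generalize P.f (vert t (j + 1)) = p at *
    generalize P.f (vert t (j + 2)) = q at *
    obtain ⟨p0, p1⟩ := p
    obtain ⟨q0, q1⟩ := q
    rcases sgn_eq t with h | h <;> rw [h] at a0 a1 b0 b1 <;> fin_cases j <;>
      simp [gridCoord, paneDir] at * <;> omega
  rcases key with h | h
  · exact ⟨_, by rw [himg, h, Finset.pair_comm]⟩
  · exact ⟨_, by rw [himg, h]⟩

theorem hasLabel_side_iff (t : P.Tri) (j l : Fin 3) : P.HasLabel (side t j) l ↔ l = 2 - j := by
  obtain ⟨s, hs, hs'⟩ := P.exists_sides t.2.1 t.2.2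
  obtain ⟨i, hi⟩ := hs' _ (side_subset t j) (side_card t j)
  have h := hasLabel_side t j
  rw [hi, (hs i).2.2] at h
  rw [hi, (hs i).2.2, h]

variable {disk : P.complex.realization ≃ₜ Metric.closedBall (0 : EuclideanSpace ℝ (Fin 2)) 1}

theorem crosses_index {t : P.Tri} {e e' : Finset V} (h : P.Crosses t.1 e e') :
    ∃ i, e = side t (entryIdx ((surface disk).isUp t) i) ∧
      e' = side t (exitIdx ((surface disk).isUp t) i) := by
  obtain ⟨he, h2, he', h2', l, hl, hl'⟩ := h
  obtain ⟨a, rfl⟩ := exists_side he h2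
  obtain ⟨b, rfl⟩ := exists_side he' h2'
  clear he h2 he' h2'
  rw [hasLabel_side_iff] at hl
  simp only [hasLabel_side_iff] at hl'
  refine ⟨exitIdx ((surface disk).isUp t) a, by rw [entry_exit], congrArg _ ?_⟩
  have hsgn : (surface disk).sgn t = sgn t := rfl
  rcases sgn_spec t with ⟨hs, hu⟩ | ⟨hs, hd⟩
  · rcases hl' with ⟨-, hl'⟩ | ⟨hd, -⟩
    · have : (surface disk).isUp t = true := by unfold TriSurface.isUp; rw [hsgn, hs]; rfl
      rw [this]
      subst hl
      revert a b; decide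
    · exact (P.not_up_down hu hd).elim
  · rcases hl' with ⟨hu, -⟩ | ⟨-, hl'⟩
    · exact (P.not_up_down hu hd).elim
    · have : (surface disk).isUp t = false := by unfold TriSurface.isUp; rw [hsgn, hs]; rfl
      rw [this]
      subst hl
      revert a b; decide

/-- Induction along the beam. The direction persists because the side by which one triangle is left
is the side by which the next one, of opposite kind, is entered (`entry_not`). -/
theorem Beam.exists_iterate {t₀ : P.Tri} {j₀ : Fin 3} (h₀ : P.complex.IsBoundaryEdge (side t₀ j₀))
    {t e : Finset V} (h : P.Beam (side t₀ j₀) t e) : ∃ (r : P.Tri) (n : ℕ) (i : Fin 3), r.1 = t ∧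
      (surface disk).fwd^[n] (t₀, exitIdx ((surface disk).isUp t₀) j₀) = (r, i) ∧
        e = side r (exitIdx ((surface disk).isUp r) i) := by
  induction h with
  | emit t e ht h =>
    have htt : t = t₀.1 := h₀.2.2.unique ht (side_mem_trianglesAt t₀ j₀)
    subst htt
    obtain ⟨i, hi, hi'⟩ := crosses_index (disk := disk) h
    refine ⟨t₀, 0, i, rfl, ?_, hi'⟩
    rw [side_injective _ hi, exit_entry]
    rfl
  | cross t e t' e' _ hb ht' hne h' ih =>
    obtain ⟨r, n, i, rfl, hn, rfl⟩ := ih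
    let r' : P.Tri := ⟨t', ht'.1, ht'.2.1⟩
    have hrr : r' ≠ r := fun h => hne (congrArg Subtype.val h)
    have hnb : neighbor r (exitIdx ((surface disk).isUp r) i) = r' := neighbor_eq hrr ht'.2.2
    have hup : (surface disk).isUp r' = !(surface disk).isUp r := by
      rw [← hnb]
      exact isUp_nb (S := surface disk) (hnb.trans_ne hrr)
    obtain ⟨i', hi, hi'⟩ := crosses_index (disk := disk) (t := r') h'
    refine ⟨r', n + 1, i', rfl, ?_, hi'⟩
    rw [← side_neighbor, hnb] at hi
    have hii := side_injective _ hi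
    rw [hup, entry_not] at hii
    have : i = i' := by rw [← entry_exit ((surface disk).isUp r) i, hii, entry_exit]
    rw [Function.iterate_succ_apply', hn, ← this]
    exact Prod.ext hnb rfl

theorem BeamHits.exists_hits {t : P.Tri} {j : Fin 3} (h₀ : P.complex.IsBoundaryEdge (side t j))
    {b : Finset V} (h : P.BeamHits (side t j) b) :
    ∃ t' j', b = side t' j' ∧ (surface disk).Hits t j t' j' := by
  obtain ⟨hb, r, hr⟩ := h
  obtain ⟨r, n, i, rfl, hn, rfl⟩ := Beam.exists_iterate (disk := disk) h₀ hr
  exact ⟨r, _, rfl, neighbor_eq_iff.2 hb, n, by rw [hn, entry_exit]⟩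

theorem OnlyThreeCycles.hits (h3 : P.OnlyThreeCycles) (t : P.Tri) (j : Fin 3)
    (hj : (surface disk).nb t j = t) : ∃ t₁ j₁ t₂ j₂, (surface disk).Hits t j t₁ j₁ ∧
      (surface disk).Hits t₁ j₁ t₂ j₂ ∧ (surface disk).Hits t₂ j₂ t j := by
  let b : P.BoundaryEdge := ⟨side t j, neighbor_eq_iff.1 hj⟩
  have hb : P.billiardsMap (P.billiardsMap (P.billiardsMap b)) = b := by
    have := Function.iterate_minimalPeriod (f := P.billiardsPerm) (x := b)
    rwa [h3 b] at this
  have h1 := P.beamHits_billiardsMap b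
  have h2 := P.beamHits_billiardsMap (P.billiardsMap b)
  have h3 := P.beamHits_billiardsMap (P.billiardsMap (P.billiardsMap b))
  have b1 := (P.billiardsMap b).2
  have b2 := (P.billiardsMap (P.billiardsMap b)).2
  obtain ⟨t₁, j₁, e1, H1⟩ := h1.exists_hits (disk := disk) b.2
  rw [e1] at h2 b1
  obtain ⟨t₂, j₂, e2, H2⟩ := h2.exists_hits (disk := disk) b1
  rw [e2, hb] at h3
  rw [e2] at b2
  obtain ⟨t₃, j₃, e3, H3⟩ := h3.exists_hits (disk := disk) b2
  have htt : t₃ = t := by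
    refine Subtype.ext (b.2.2.2.unique ?_ (side_mem_trianglesAt t j))
    have := side_mem_trianglesAt t₃ j₃
    rwa [← e3] at this
  subst htt
  obtain rfl := side_injective _ e3
  exact ⟨t₁, j₁, t₂, j₂, H1, H2, H3⟩

/-! ### The unit hexagon -/

/-- Every vertex shares an upward triangle with the center, and its displacement from the center
tells the two positions, so `f` is injective by `star_eq`. The image is the full star because every
sign and position occurs at the interior center. -/
theorem isUnitHexagon_of_star {t : P.Tri} {i : Fin 3} (hi : ¬ (surface disk).Bd (vert t i))
    (h : ∀ t' : P.Tri, ∃ j, vert t' j = vert t i) : P.IsUnitHexagon := by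
  have hup : ∀ u ∈ P.complex.verts, ∃ (s : P.Tri) (a b : Fin 3), sgn s = 1 ∧
      vert s a = vert t i ∧ vert s b = u := by
    intro u hu
    obtain ⟨s, hs⟩ := mem_verts_tri hu
    obtain ⟨b, rfl⟩ := mem_tri.1 hs
    obtain ⟨a, ha⟩ := h s
    by_cases hab : a = b
    · subst hab
      obtain ⟨r, hr, hrv⟩ := exists_star hi (Or.inl rfl) 0
      exact ⟨r, 0, 0, hr, hrv, hrv.trans ha.symm⟩
    · rcases sgn_eq s with h1 | h1
      · exact ⟨s, a, b, h1, ha, rfl⟩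
      · obtain ⟨c, hca, hcb⟩ := Fin.exists_third a b
        have hne : neighbor s c ≠ s :=
          nb_ne_of_not_bd (S := surface disk) (t := s) (i := a) (j := c)
            (show ¬ (surface disk).Bd (vert s a) from ha ▸ hi) hca.symm
        exact ⟨neighbor s c, b, a, by rw [sgn_neighbor hne, h1, neg_neg],
          by rw [vert_neighbor hne hcb.symm hca.symm (Ne.symm hab), ha],
          vert_neighbor hne hca.symm hcb.symm hab⟩
  refine ⟨fun u hu w hw huw => ?_, P.f (vert t i), ?_⟩
  · obtain ⟨s, a, b, hs, ha, rfl⟩ := hup u hu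
    obtain ⟨s', a', b', hs', ha', rfl⟩ := hup w hw
    have hd : ∀ l, (if l = a then (1 : ℤ) else 0) - (if l = b then 1 else 0) =
        (if l = a' then 1 else 0) - if l = b' then 1 else 0 := by
      intro l
      have h1 := coord_vert s l a
      have h2 := coord_vert s l b
      have h3 := coord_vert s' l a'
      have h4 := coord_vert s' l b'
      rw [huw] at h2
      rw [ha, hs] at h1
      rw [hs] at h2
      rw [ha', hs'] at h3
      rw [hs'] at h4
      omega
    -- A difference of two standard basis vectors determines both of them, unless it is zero.
    have hab : a = b ∧ a' = b' ∨ a = a' ∧ b = b' := by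
      clear huw ha ha' hu hw
      revert a b a' b'; decide
    rcases hab with ⟨rfl, rfl⟩ | ⟨rfl, rfl⟩
    · rw [ha, ha']
    · have hi' : ¬ (surface disk).Bd (vert s a) := ha ▸ hi
      rw [star_eq (S := surface disk) hi' (ha'.trans ha.symm) (hs'.trans hs.symm)]
  · ext s
    rw [mem_map_faces]
    refine and_congr_right fun _ => ⟨?_, ?_⟩
    · rintro ⟨r, hr⟩
      refine ⟨r.1.image P.f, (P.map_simplex r.1 r.2.1).1, (P.map_simplex r.1 r.2.1).2.trans r.2.2,
        ?_, hr⟩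
      obtain ⟨j, hj⟩ := h r
      rw [← hj]
      exact Finset.mem_image_of_mem _ (vert_mem r j)
    · rintro ⟨τ, ⟨-, p, hp⟩, hcard, hq, hs⟩
      have hτ : (∃ p, τ = upTri p) ∨ ∃ p, τ = downTri p := by
        rcases hp with hp | hp
        · exact Or.inl ⟨p, Finset.eq_of_subset_of_card_le hp (hcard ▸ Finset.card_le_three)⟩
        · exact Or.inr ⟨p, Finset.eq_of_subset_of_card_le hp (hcard ▸ Finset.card_le_three)⟩
      obtain ⟨e, b, w, he, hw, hb⟩ := exists_grid_param hτ
      obtain ⟨a, ha⟩ := (hw _).1 hq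
      obtain ⟨r, hr, hrv⟩ := exists_star hi (he.imp And.left And.left) a
      have hr : sgn r = e := hr
      have hrv : vert r a = vert t i := hrv
      refine ⟨r, fun x hx => ?_⟩
      obtain ⟨j, rfl⟩ := (hw x).1 (hs hx)
      refine Finset.mem_image.2 ⟨vert r j, vert_mem r j, gridCoord_injective (funext fun l => ?_)⟩
      have h1 := coord_vert r l a
      rw [hrv, ← ha, hb, hr] at h1
      rw [coord_vert, hb, hr]
      omega

end GridPolygon

theorem lemma3p4 {V : Type*} (P : GridPolygon V) (hP : P.Indecomposable)
    (h3 : P.OnlyThreeCycles) : P.IsUnitTriangle ∨ P.IsUnitHexagon := by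
  classical
  obtain ⟨disk⟩ := hP.exists_disk
  have : Finite P.Tri := P.finite.subset fun _ h => h.1
  have : Nonempty P.Tri := by
    have := P.simplyConnected
    obtain ⟨w, -, s, hs, -⟩ := (inferInstance : Nonempty P.complex.realization)
    obtain ⟨t, -⟩ := GridPolygon.exists_tri_of_mem hs
    exact ⟨t⟩
  rcases TriSurface.triangle_or_hexagon_of_hits (GridPolygon.OnlyThreeCycles.hits (disk := disk) h3)
    with ⟨t, ht⟩ | ⟨t, i, hi, h⟩
  · exact Or.inl (GridPolygon.isUnitTriangle_of_forall_eq ht)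
  · exact Or.inr (GridPolygon.isUnitHexagon_of_star (disk := disk) hi h)
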